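/- Let $n\ge 2$, $p>1$, $0<c_1\le c_2<\infty$, and let $W:\mathbb R\to[0,\infty)$ be continuous and vanish exactly at $0$ and $1$. Let $\mathcal F$ be the set of Borel functions $f:\mathbb R^n\times\mathbb R\times\mathbb R^n\to[0,\infty)$ with $c_1(W(u)+|\xi|^p)\le f(x,u,\xi)\le c_2(W(u)+|\xi|^p)$ for all $x,u,\xi$. Let $\mathcal A$ be the family of bounded open subsets of $\mathbb R^n$ with Lipschitz boundary. Let $(f_k)\subset\mathcal F$, let $(\varepsilon_k)\subset(0,1]$ be decreasing with $\varepsilon_k\to0$, and for $u\in L^1_{\rm loc}(\mathbb R^n)$, $A\in\mathcal A$ put $$\mathscr F_k(u,A)=\frac1{\varepsilon_k}\int_A f_k(x,u,\varepsilon_k\nabla u)\,dx\ \text{ if } u\in W^{1,p}(A),\ 0\le u\le1 \text{ a.e. in } A,\qquad \mathscr F_k(u,A)=+\infty\ \text{ otherwise.}$$ For each $\nu\in\mathbb S^{n-1}$ fix an orthogonal matrix $R_\nu$ with $R_\nu e_n=\nu$, and let $Q^\nu_\rho(x)=x+R_\nu(-\tfrac\rho2,\tfrac\rho2)^n$. Let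 $u^\nu_x(y)=1$ if $(y-x)\cdot\nu\ge0$ and $u^\nu_x(y)=0$ otherwise. Fix $\mathrm u\in C^1(\mathbb R)$ with $0\le\mathrm u\le1$, $\mathrm u(t)=1$ for $t>1$ and $\mathrm u(t)=0$ for $t<-1$, and let $\bar u^\nu_{x,\varepsilon}(y)=\mathrm u(\tfrac1\varepsilon(y-x)\cdot\nu)$. Put $$\mathbf m_k(\bar u^\nu_{x,\varepsilon_k},A)=\inf\{\mathscr F_k(u,A): u\in W^{1,p}(A),\ 0\le u\le1,\ u=\bar u^\nu_{x,\varepsilon_k}\text{ near }\partial A\},$$ where "near $\partial A$" means a.e. in the intersection of $A$ with some open neighbourhood of $\partial A$. Let $(k_j)$ be a strictly increasing sequence of indices and let $\mathscr F_\infty:L^1_{\rm loc}(\mathbb R^n)\times\mathcal A\to[0,+\infty]$ be such that for every $A\in\mathcal A$ the functionals $\mathscr F_{k_j}(\cdot,A)$ $\Gamma$-converge in $L^1(A)$ to $\mathscr F_\infty(\cdot,A)$. Let $\hat f$ be the surface density of $\mathscr F_\infty$, defined for $x\in\mathbb R^n$, $\nu\in\mathbb S^{n-1}$ by $$\hat f(x,\nu)=\limsup_{\rho\to0^+}\frac1{\rho^{n-1}}\inf\{\mathscr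 F_\infty(u,Q^\nu_\rho(x)): u\in BV(Q^\nu_\rho(x);\{0,1\}),\ u=u^\nu_x\text{ near }\partial Q^\nu_\rho(x)\}.$$ Then for every $x\in\mathbb R^n$ and every $\nu\in\mathbb S^{n-1}$ $$\hat f(x,\nu)=f'(x,\nu)=f''(x,\nu),$$ where $$f'(x,\nu)=\limsup_{\rho\to0^+}\frac1{\rho^{n-1}}\liminf_{j\to\infty}\mathbf m_{k_j}(\bar u^\nu_{x,\varepsilon_{k_j}},Q^\nu_\rho(x)),\qquad f''(x,\nu)=\limsup_{\rho\to0^+}\frac1{\rho^{n-1}}\limsup_{j\to\infty}\mathbf m_{k_j}(\bar u^\nu_{x,\varepsilon_{k_j}},Q^\nu_\rho(x)).$$ -/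

import Mathlib

open MeasureTheory Filter Topology Set
open scoped ENNReal ContDiff

noncomputable section

namespace PhaseTransition

/-- `ℝⁿ` with its Euclidean structure. -/
abbrev Rn (n : ℕ) : Type := EuclideanSpace ℝ (Fin n)

/-- The unit sphere of `ℝⁿ`. -/
abbrev Sph (n : ℕ) : Type := Metric.sphere (0 : Rn n) 1

variable {n : ℕ}

/-! ### Domains and cubes -/

/-- `A` has Lipschitz boundary: near each boundary point there are a unit vector `e` and a Lipschitz
function `γ` of the component orthogonal to `e` such that `A` is locally the strict epigraph of `γ`
in direction `e`. -/
def HasLipschitzBoundary (A : Set (Rn n)) : Prop :=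
  ∀ x ∈ frontier A, ∃ e : Rn n, ‖e‖ = 1 ∧ ∃ (K : NNReal) (γ : Rn n → ℝ), LipschitzWith K γ ∧
    ∀ᶠ y in 𝓝 x, (y ∈ A ↔ γ (y - inner ℝ e y • e) < inner ℝ e y)

/-- The open and bounded sets with Lipschitz boundary. -/
def IsLipschitzDomain (A : Set (Rn n)) : Prop :=
  IsOpen A ∧ Bornology.IsBounded A ∧ HasLipschitzBoundary A

/-- The open cube with centre `x` and side length `r`, rotated by `T`, that is
`x + T (r Q)` with `Q = (-1/2, 1/2)ⁿ`. -/
def rotatedCube (T : Rn n ≃ₗᵢ[ℝ] Rn n) (x : Rn n) (r : ℝ) : Set (Rn n) :=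
  {y | ∀ i, |T.symm (y - x) i| < r / 2}

/-! ### Sobolev functions and functions of bounded variation -/

/-- `g` is a weak gradient of `u` in `A`. -/
def IsWeakGradient (A : Set (Rn n)) (u : Rn n → ℝ) (g : Rn n → Rn n) : Prop :=
  ∀ φ : Rn n → ℝ, ContDiff ℝ ∞ φ → HasCompactSupport φ → tsupport φ ⊆ A → ∀ v : Rn n,
    ∫ x in A, u x * fderiv ℝ φ x v = - ∫ x in A, φ x * inner ℝ (g x) v

/-- `u ∈ W^{1,p}(A)`; only the values of `u` in `A` matter. -/
def MemW1p (p : ℝ) (A : Set (Rn n)) (u : Rn n → ℝ) : Prop :=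
  MemLp u (ENNReal.ofReal p) (volume.restrict A) ∧
    ∃ g : Rn n → Rn n, MemLp g (ENNReal.ofReal p) (volume.restrict A) ∧ IsWeakGradient A u g

open Classical in
/-- The gradient in `A` of a function `u ∈ W^{1,p}(A)` (unique up to null sets). -/
def weakGradient (p : ℝ) (A : Set (Rn n)) (u : Rn n → ℝ) : Rn n → Rn n :=
  if h : MemW1p p A u then h.2.choose else 0

/-- The divergence of a vector field. -/
def divergence (φ : Rn n → Rn n) (x : Rn n) : ℝ :=
  ∑ i, fderiv ℝ φ x (EuclideanSpace.single i 1) i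

/-- `u ∈ BV(A)`: `u ∈ L¹(A)` and the total variation
`sup {∫_A u div φ : φ ∈ C¹_c(A; ℝⁿ), |φ| ≤ 1}` is finite. -/
def MemBV (A : Set (Rn n)) (u : Rn n → ℝ) : Prop :=
  IntegrableOn u A ∧ ∃ C : ℝ, ∀ φ : Rn n → Rn n, ContDiff ℝ 1 φ → HasCompactSupport φ →
    tsupport φ ⊆ A → (∀ x, ‖φ x‖ ≤ 1) → ∫ x in A, u x * divergence φ x ≤ C

/-- `u = w` near `∂A`: the two functions agree almost everywhere in the part of `A` that lies in
some neighbourhood of `∂A`. -/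
def EqNearBoundary (A : Set (Rn n)) (u w : Rn n → ℝ) : Prop :=
  ∃ U : Set (Rn n), IsOpen U ∧ frontier A ⊆ U ∧ ∀ᵐ y ∂(volume.restrict (A ∩ U)), u y = w y

/-! ### Potential, integrands, profile -/

/-- A double-well potential: continuous, nonnegative, vanishing exactly at `0` and `1`. -/
structure IsDoubleWell (W : ℝ → ℝ) : Prop where
  continuous : Continuous W
  nonneg : ∀ t, 0 ≤ W t
  eq_zero_iff : ∀ t, W t = 0 ↔ t = 0 ∨ t = 1

/-- The class `𝓕(W, p, c₁, c₂)` of integrands. -/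
structure IsIntegrand (W : ℝ → ℝ) (p c₁ c₂ : ℝ) (f : Rn n → ℝ → Rn n → ℝ) : Prop where
  nonneg : ∀ x u ξ, 0 ≤ f x u ξ
  measurable : Measurable fun q : Rn n × ℝ × Rn n => f q.1 q.2.1 q.2.2
  lower : ∀ x u ξ, c₁ * (W u + ‖ξ‖ ^ p) ≤ f x u ξ
  upper : ∀ x u ξ, f x u ξ ≤ c₂ * (W u + ‖ξ‖ ^ p)

/-- The one-dimensional transition profiles: `C¹`, with values in `[0,1]`, and equal to the
characteristic function of `(0,∞)` where `|t| > 1`. -/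
structure IsProfile (w : ℝ → ℝ) : Prop where
  contDiff : ContDiff ℝ 1 w
  mem_Icc : ∀ t, w t ∈ Icc (0 : ℝ) 1
  eq_indicator : ∀ t, 1 < |t| → w t = (Ioi (0 : ℝ)).indicator 1 t

/-- The jump function across the hyperplane through `x` orthogonal to `ν`. -/
def jumpFun (x : Rn n) (ν : Sph n) (y : Rn n) : ℝ :=
  {z : Rn n | 0 ≤ inner ℝ (z - x) (ν : Rn n)}.indicator 1 y

/-- The regularised jump function at scale `ε` with profile `w`. -/
def regJump (w : ℝ → ℝ) (ε : ℝ) (x : Rn n) (ν : Sph n) (y : Rn n) : ℝ :=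
  w (1 / ε * inner ℝ (y - x) (ν : Rn n))

/-! ### The functionals and their minimum problems -/

open Classical in
/-- `ε⁻¹ ∫_A f (x, u, ε ∇u) dx` if `u ∈ W^{1,p}(A)` and `0 ≤ u ≤ 1` a.e. in `A`, and `+∞`
otherwise. -/
def energy (p ε : ℝ) (f : Rn n → ℝ → Rn n → ℝ) (u : Rn n → ℝ) (A : Set (Rn n)) : ℝ≥0∞ :=
  if MemW1p p A u ∧ ∀ᵐ x ∂(volume.restrict A), u x ∈ Icc (0 : ℝ) 1 then
    ENNReal.ofReal (1 / ε) *
      ∫⁻ x in A, ENNReal.ofReal (f x (u x) (ε • weakGradient p A u x))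
  else ⊤

/-- The admissible class: `u ∈ W^{1,p}(A)`, `0 ≤ u ≤ 1`, `u = w` near `∂A`. -/
def admissible (p : ℝ) (w : Rn n → ℝ) (A : Set (Rn n)) : Set (Rn n → ℝ) :=
  {u | MemW1p p A u ∧ (∀ᵐ x ∂(volume.restrict A), u x ∈ Icc (0 : ℝ) 1) ∧ EqNearBoundary A u w}

/-- The infimum of the energy in `A` over the admissible class with boundary datum `w`. -/
def minEnergy (p ε : ℝ) (f : Rn n → ℝ → Rn n → ℝ) (w : Rn n → ℝ) (A : Set (Rn n)) : ℝ≥0∞ :=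
  ⨅ u ∈ admissible p w A, energy p ε f u A

/-- Γ-convergence in `L¹(A)` of functionals on `L¹_loc(ℝⁿ)`. -/
def GammaConvergesL1 (A : Set (Rn n)) (F : ℕ → (Rn n → ℝ) → ℝ≥0∞) (G : (Rn n → ℝ) → ℝ≥0∞) :
    Prop :=
  ∀ u : Rn n → ℝ, LocallyIntegrable u →
    (∀ v : ℕ → Rn n → ℝ, (∀ j, LocallyIntegrable (v j)) →
      Tendsto (fun j => ∫⁻ x in A, ‖v j x - u x‖ₑ) atTop (𝓝 0) →
      G u ≤ liminf (fun j => F j (v j)) atTop) ∧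
    ∃ v : ℕ → Rn n → ℝ, (∀ j, LocallyIntegrable (v j)) ∧
      Tendsto (fun j => ∫⁻ x in A, ‖v j x - u x‖ₑ) atTop (𝓝 0) ∧
      limsup (fun j => F j (v j)) atTop ≤ G u

/-- The infimum of `G (·, A)` over `u ∈ BV(A; {0,1})` with `u = w` near `∂A`. A function on `A`
is represented by any of its locally integrable extensions to `ℝⁿ`. -/
def minSurface (G : (Rn n → ℝ) → Set (Rn n) → ℝ≥0∞) (w : Rn n → ℝ) (A : Set (Rn n)) : ℝ≥0∞ :=
  ⨅ u ∈ {u : Rn n → ℝ | LocallyIntegrable u ∧ MemBV A u ∧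
    (∀ᵐ x ∂(volume.restrict A), u x = 0 ∨ u x = 1) ∧ EqNearBoundary A u w}, G u A

/-! ### The surface integrands; `R ν` is the rotation that orients the cubes -/

/-- The surface density `f̂` of the limit functional `G`. -/
def fHat (R : Sph n → Rn n ≃ₗᵢ[ℝ] Rn n) (G : (Rn n → ℝ) → Set (Rn n) → ℝ≥0∞)
    (x : Rn n) (ν : Sph n) : ℝ≥0∞ :=
  limsup (fun ρ : ℝ => ENNReal.ofReal (1 / ρ ^ (n - 1)) *
    minSurface G (jumpFun x ν) (rotatedCube (R ν) x ρ)) (𝓝[>] 0)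

/-- The lower cell formula `f'` of the sequence `(ε_k, f_k)`. -/
def fLower (R : Sph n → Rn n ≃ₗᵢ[ℝ] Rn n) (w : ℝ → ℝ) (p : ℝ) (ε : ℕ → ℝ)
    (f : ℕ → Rn n → ℝ → Rn n → ℝ) (x : Rn n) (ν : Sph n) : ℝ≥0∞ :=
  limsup (fun ρ : ℝ => ENNReal.ofReal (1 / ρ ^ (n - 1)) *
    liminf (fun k => minEnergy p (ε k) (f k) (regJump w (ε k) x ν) (rotatedCube (R ν) x ρ))
      atTop) (𝓝[>] 0)

/-- The upper cell formula `f''` of the sequence `(ε_k, f_k)`. -/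
def fUpper (R : Sph n → Rn n ≃ₗᵢ[ℝ] Rn n) (w : ℝ → ℝ) (p : ℝ) (ε : ℕ → ℝ)
    (f : ℕ → Rn n → ℝ → Rn n → ℝ) (x : Rn n) (ν : Sph n) : ℝ≥0∞ :=
  limsup (fun ρ : ℝ => ENNReal.ofReal (1 / ρ ^ (n - 1)) *
    limsup (fun k => minEnergy p (ε k) (f k) (regJump w (ε k) x ν) (rotatedCube (R ν) x ρ))
      atTop) (𝓝[>] 0)

end PhaseTransition

end

/-!
The energies of an almost optimal transition are concentrated near the jump of the limit, so
boundary values can be modified in a thin shell at a cost proportional to the area of the part of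
the hyperplane `{(y - x) · ν = 0}` in the shell. The equalities follow from two inequalities between
minimum problems on concentric cubes, both for fixed `x` and `ν`.

*Upper bound* (`limsup_minEnergy_le_minSurface`): on a fixed cube the upper limit of the minima
with regularised boundary values is at most the minimum of the `Γ`-limit. A recovery sequence of a
competitor `u` converges in `L¹`, near the boundary, to the same jump function as the regularised
jumps, and is joined to them in a shell. The shell is divided into about `1/ε` layers of width `ε`,
a transition is made in each of them by a cutoff with gradient of order `1/ε`, and one of the layers
costs at most the average (`exists_join`). The growth conditions bound the cost of a transition by
the energies of the two functions plus `ε⁻¹ ∫ W(θu + (1 - θ)v) + |u - v|ᵖ`; here the modulus of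
continuity of `W` turns the `L¹` convergence into smallness.

*Lower bound* (`minSurface_le_liminf_minEnergy`): for `ρ < ρ'` the minimum of the `Γ`-limit on the
cube of side `ρ'` is at most the lower limit of the minima on the cube of side `ρ`, plus a multiple
of `ρ'ⁿ⁻¹ - ρⁿ⁻¹`. Almost minimisers are extended by the regularised jump outside the smaller cube.
By compactness a subsequence converges in `L¹` to a characteristic function of bounded variation,
which is the jump function in the outer shell and so competes on the larger cube; the `Γ`-liminf
inequality concludes. After division by `ρⁿ⁻¹` and with `ρ' = tρ`, the error disappears as
`t → 1` (`limsup_le_of_dilation`).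

The compactness (`exists_subseq_tendsto_of_gradEnergy_le`) is that of Modica and Mortola. For a
primitive `Φ` of a suitable power of `W`, Young's inequality bounds `|∇Φ(u)|` by the energy density,
whence `‖Φ(u(· + h)) - Φ(u)‖₁ ≤ C|h|` by mollification (`lintegral_wellPrimitive_translate_le`).
Bounded sequences with this property are precompact in `L¹`, by comparison with their means over
the cells of fine grids (`exists_subseq_tendsto_L1`), and the bound on the translations of the limit
gives its bounded variation (`memBV_of_translate_le`).
-/

noncomputable section

namespace PhaseTransition

/-! ### Sobolev functions with a prescribed weak gradient -/

section

variable {n : ℕ}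

/-- `u ∈ W^{1,p}(A)` with weak gradient `g`. Keeping the gradient explicit avoids the choice made in
`weakGradient`. -/
structure IsSobolevPair (p : ℝ) (A : Set (Rn n)) (u : Rn n → ℝ) (g : Rn n → Rn n) : Prop where
  memLp : MemLp u (ENNReal.ofReal p) (volume.restrict A)
  memLp_grad : MemLp g (ENNReal.ofReal p) (volume.restrict A)
  isWeakGradient : IsWeakGradient A u g

/-- The rescaled energy `ε⁻¹ ∫_A f (x, u, ε g) dx` of a function `u` with gradient field `g`. -/
def gradEnergy (f : Rn n → ℝ → Rn n → ℝ) (ε : ℝ) (A : Set (Rn n)) (u : Rn n → ℝ)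
    (g : Rn n → Rn n) : ℝ≥0∞ :=
  ENNReal.ofReal (1 / ε) * ∫⁻ x in A, ENNReal.ofReal (f x (u x) (ε • g x))

/-- The model integrand `W(u) + |ξ|^p`. -/
def modelIntegrand (W : ℝ → ℝ) (p : ℝ) : Rn n → ℝ → Rn n → ℝ := fun _ u ξ => W u + ‖ξ‖ ^ p

lemma memW1p_iff {p : ℝ} {A : Set (Rn n)} {u : Rn n → ℝ} :
    MemW1p p A u ↔ ∃ g, IsSobolevPair p A u g :=
  ⟨fun ⟨h1, g, h2, h3⟩ => ⟨g, h1, h2, h3⟩, fun ⟨g, h1, h2, h3⟩ => ⟨h1, g, h2, h3⟩⟩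

lemma MemW1p.isSobolevPair {p : ℝ} {A : Set (Rn n)} {u : Rn n → ℝ} (h : MemW1p p A u) :
    IsSobolevPair p A u (weakGradient p A u) := by
  rw [weakGradient, dif_pos h]
  exact ⟨h.1, h.2.choose_spec.1, h.2.choose_spec.2⟩

lemma IsSobolevPair.locallyIntegrable {p : ℝ} (hp : 1 ≤ p) {A : Set (Rn n)} {u : Rn n → ℝ}
    {g : Rn n → Rn n} (h : IsSobolevPair p A u g) : LocallyIntegrable u (volume.restrict A) :=
  h.memLp.locallyIntegrable (by simpa using ENNReal.ofReal_le_ofReal hp)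

lemma IsSobolevPair.locallyIntegrable_grad {p : ℝ} (hp : 1 ≤ p) {A : Set (Rn n)} {u : Rn n → ℝ}
    {g : Rn n → Rn n} (h : IsSobolevPair p A u g) : LocallyIntegrable g (volume.restrict A) :=
  h.memLp_grad.locallyIntegrable (by simpa using ENNReal.ofReal_le_ofReal hp)

lemma locallyIntegrable_integrable_mul {μ : Measure (Rn n)} {u φ : Rn n → ℝ}
    (hu : LocallyIntegrable u μ) (hφ : Continuous φ) (hc : HasCompactSupport φ) :
    Integrable (fun x => u x * φ x) μ := by
  simpa [mul_comm] using hu.integrable_smul_left_of_hasCompactSupport hφ hc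

lemma locallyIntegrable_integrable_mul_inner {μ : Measure (Rn n)} {g : Rn n → Rn n} {φ : Rn n → ℝ}
    (hg : LocallyIntegrable g μ) (hφ : Continuous φ) (hc : HasCompactSupport φ) (v : Rn n) :
    Integrable (fun x => φ x * inner ℝ (g x) v) μ := by
  have := (hg.integrable_smul_left_of_hasCompactSupport hφ hc).inner_const (𝕜 := ℝ) v
  simpa [real_inner_smul_left] using this

lemma continuous_fderiv_apply' {φ : Rn n → ℝ} (hφ : ContDiff ℝ 1 φ) (v : Rn n) :
    Continuous fun x => fderiv ℝ φ x v :=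
  (hφ.continuous_fderiv one_ne_zero).clm_apply continuous_const

lemma continuous_gradient {φ : Rn n → ℝ} (hφ : ContDiff ℝ 1 φ) : Continuous (gradient φ) :=
  (InnerProductSpace.toDual ℝ (Rn n)).symm.continuous.comp (hφ.continuous_fderiv one_ne_zero)

lemma norm_gradient (φ : Rn n → ℝ) (x : Rn n) : ‖gradient φ x‖ = ‖fderiv ℝ φ x‖ :=
  (InnerProductSpace.toDual ℝ (Rn n)).symm.norm_map _

lemma gradient_eq_zero_iff {φ : Rn n → ℝ} {x : Rn n} : gradient φ x = 0 ↔ fderiv ℝ φ x = 0 := by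
  rw [← norm_eq_zero, norm_gradient, norm_eq_zero]

lemma hasCompactSupport_fderiv_apply {φ : Rn n → ℝ} (hφ : HasCompactSupport φ) (v : Rn n) :
    HasCompactSupport fun x => fderiv ℝ φ x v :=
  hφ.fderiv_apply (𝕜 := ℝ) v

/-- Weak gradients are unique up to null sets. -/
lemma IsWeakGradient.ae_eq {A : Set (Rn n)} (hA : IsOpen A) {u : Rn n → ℝ} {g g' : Rn n → Rn n}
    (h : IsWeakGradient A u g) (h' : IsWeakGradient A u g')
    (hg : LocallyIntegrable g (volume.restrict A))
    (hg' : LocallyIntegrable g' (volume.restrict A)) : g =ᵐ[volume.restrict A] g' := by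
  have key := hA.ae_eq_zero_of_integral_contDiff_smul_eq_zero (μ := volume) (f := g - g')
    ((locallyIntegrableOn_of_locallyIntegrable_restrict hg).sub
      (locallyIntegrableOn_of_locallyIntegrable_restrict hg')) ?_
  · rw [Filter.EventuallyEq, ae_restrict_iff' hA.measurableSet]
    filter_upwards [key] with x hx hxA
    simpa [sub_eq_zero] using hx hxA
  · intro φ hφ hc hs
    have e : ∫ x, φ x • (g - g') x = ∫ x in A, φ x • (g - g') x := by
      refine (setIntegral_eq_integral_of_forall_compl_eq_zero fun x hx => ?_).symm
      rw [image_eq_zero_of_notMem_tsupport fun hx' => hx (hs hx'), zero_smul]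
    have i1 := hg.integrable_smul_left_of_hasCompactSupport hφ.continuous hc
    have i2 := hg'.integrable_smul_left_of_hasCompactSupport hφ.continuous hc
    rw [e]
    simp only [Pi.sub_apply, smul_sub]
    rw [integral_sub i1 i2, sub_eq_zero]
    refine ext_inner_right ℝ fun v => ?_
    have a1 := integral_inner (𝕜 := ℝ) i1 v
    have a2 := integral_inner (𝕜 := ℝ) i2 v
    have b1 := h φ hφ hc hs v
    have b2 := h' φ hφ hc hs v
    rw [b1, neg_inj] at b2
    rw [real_inner_comm, ← a1, real_inner_comm, ← a2]
    simpa only [real_inner_smul_right, real_inner_comm] using b2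

lemma IsSobolevPair.ae_eq {p : ℝ} (hp : 1 ≤ p) {A : Set (Rn n)} (hA : IsOpen A) {u : Rn n → ℝ}
    {g g' : Rn n → Rn n} (h : IsSobolevPair p A u g) (h' : IsSobolevPair p A u g') :
    g =ᵐ[volume.restrict A] g' :=
  h.isWeakGradient.ae_eq hA h'.isWeakGradient (h.locallyIntegrable_grad hp)
    (h'.locallyIntegrable_grad hp)

lemma gradEnergy_congr {f : Rn n → ℝ → Rn n → ℝ} {ε : ℝ} {A : Set (Rn n)} {u u' : Rn n → ℝ}
    {g g' : Rn n → Rn n} (hu : u =ᵐ[volume.restrict A] u') (hg : g =ᵐ[volume.restrict A] g') :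
    gradEnergy f ε A u g = gradEnergy f ε A u' g' := by
  unfold gradEnergy
  congr 1
  refine lintegral_congr_ae ?_
  filter_upwards [hu, hg] with x h1 h2
  rw [h1, h2]

lemma energy_eq_gradEnergy {p : ℝ} (hp : 1 ≤ p) {A : Set (Rn n)} (hA : IsOpen A) {u : Rn n → ℝ}
    {g : Rn n → Rn n} (h : IsSobolevPair p A u g)
    (hu : ∀ᵐ x ∂(volume.restrict A), u x ∈ Icc (0 : ℝ) 1) (ε : ℝ) (f : Rn n → ℝ → Rn n → ℝ) :
    energy p ε f u A = gradEnergy f ε A u g := by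
  have hm : MemW1p p A u := memW1p_iff.2 ⟨g, h⟩
  rw [energy, if_pos ⟨hm, hu⟩]
  exact gradEnergy_congr ae_eq_rfl (hm.isSobolevPair.ae_eq hp hA h)

/-- A function of finite energy is a Sobolev function with values in `[0,1]`, and its energy is that
of any of its weak gradients. -/
lemma exists_isSobolevPair_of_energy_ne_top {p ε : ℝ} {f : Rn n → ℝ → Rn n → ℝ} {A : Set (Rn n)}
    {u : Rn n → ℝ} (h : energy p ε f u A ≠ ⊤) :
    ∃ g, IsSobolevPair p A u g ∧ (∀ᵐ x ∂(volume.restrict A), u x ∈ Icc (0 : ℝ) 1) ∧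
      energy p ε f u A = gradEnergy f ε A u g := by
  by_cases hc : MemW1p p A u ∧ ∀ᵐ x ∂(volume.restrict A), u x ∈ Icc (0 : ℝ) 1
  · refine ⟨_, hc.1.isSobolevPair, hc.2, ?_⟩
    rw [energy, if_pos hc]
    rfl
  · exact absurd (by rw [energy, if_neg hc]) h

lemma setIntegral_eq_setIntegral_of_zero_off {F : Rn n → ℝ} {A B : Set (Rn n)} (hBA : B ⊆ A)
    (h : ∀ x ∉ B, F x = 0) : ∫ x in A, F x = ∫ x in B, F x := by
  rw [setIntegral_eq_integral_of_forall_compl_eq_zero h,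
    setIntegral_eq_integral_of_forall_compl_eq_zero fun x hx => h x fun hx' => hx (hBA hx')]

lemma fderiv_eq_zero_of_notMem_tsupport {φ : Rn n → ℝ} {x : Rn n} (hx : x ∉ tsupport φ) :
    fderiv ℝ φ x = 0 := by
  by_contra hne
  exact hx (support_fderiv_subset ℝ hne)

lemma IsSobolevPair.mono {p : ℝ} {A B : Set (Rn n)} {u : Rn n → ℝ}
    {g : Rn n → Rn n} (h : IsSobolevPair p A u g) (hBA : B ⊆ A) : IsSobolevPair p B u g := by
  refine ⟨h.memLp.mono_measure (Measure.restrict_mono hBA le_rfl),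
    h.memLp_grad.mono_measure (Measure.restrict_mono hBA le_rfl), fun φ hφ hc hs v => ?_⟩
  have key := h.isWeakGradient φ hφ hc (hs.trans hBA) v
  rwa [setIntegral_eq_setIntegral_of_zero_off hBA fun x hx => by
      simp [fderiv_eq_zero_of_notMem_tsupport fun hx' => hx (hs hx')],
    setIntegral_eq_setIntegral_of_zero_off hBA fun x hx => by
      simp [image_eq_zero_of_notMem_tsupport fun hx' => hx (hs hx')]] at key

lemma IsSobolevPair.congr {p : ℝ} {A : Set (Rn n)} {u u' : Rn n → ℝ}
    {g g' : Rn n → Rn n} (h : IsSobolevPair p A u g) (hu : u =ᵐ[volume.restrict A] u')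
    (hg : g =ᵐ[volume.restrict A] g') : IsSobolevPair p A u' g' := by
  refine ⟨h.memLp.ae_eq hu, h.memLp_grad.ae_eq hg, fun φ hφ hc hs v => ?_⟩
  have e1 : ∫ x in A, u' x * fderiv ℝ φ x v = ∫ x in A, u x * fderiv ℝ φ x v :=
    integral_congr_ae (by filter_upwards [hu] with x hx; rw [hx])
  have e2 : ∫ x in A, φ x * inner ℝ (g' x) v = ∫ x in A, φ x * inner ℝ (g x) v :=
    integral_congr_ae (by filter_upwards [hg] with x hx; rw [hx])
  rw [e1, e2]
  exact h.isWeakGradient φ hφ hc hs v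

lemma IsSobolevPair.add {p : ℝ} (hp : 1 ≤ p) {A : Set (Rn n)} {u u' : Rn n → ℝ}
    {g g' : Rn n → Rn n} (h : IsSobolevPair p A u g) (h' : IsSobolevPair p A u' g') :
    IsSobolevPair p A (fun x => u x + u' x) (fun x => g x + g' x) := by
  refine ⟨h.memLp.add h'.memLp, h.memLp_grad.add h'.memLp_grad, fun φ hφ hc hs v => ?_⟩
  have hφ1 : ContDiff ℝ 1 φ := hφ.of_le (by exact_mod_cast le_top)
  simp only [add_mul, inner_add_left, mul_add]
  rw [integral_add, integral_add, h.isWeakGradient φ hφ hc hs v, h'.isWeakGradient φ hφ hc hs v]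
  · ring
  · exact locallyIntegrable_integrable_mul_inner (h.locallyIntegrable_grad hp) hφ.continuous hc v
  · exact locallyIntegrable_integrable_mul_inner (h'.locallyIntegrable_grad hp) hφ.continuous hc v
  · exact locallyIntegrable_integrable_mul (h.locallyIntegrable hp) (continuous_fderiv_apply' hφ1 v)
      (hasCompactSupport_fderiv_apply hc v)
  · exact locallyIntegrable_integrable_mul (h'.locallyIntegrable hp)
      (continuous_fderiv_apply' hφ1 v) (hasCompactSupport_fderiv_apply hc v)

lemma isSobolevPair_of_contDiff {p : ℝ} {A : Set (Rn n)} (hb : Bornology.IsBounded A)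
    {u : Rn n → ℝ} (hu : ContDiff ℝ 1 u) : IsSobolevPair p A u (gradient u) := by
  have hK : IsCompact (closure A) := hb.isCompact_closure
  have mem : ∀ {F : Type} [NormedAddCommGroup F] [SecondCountableTopology F]
      (h : Rn n → F), Continuous h →
      MemLp h (ENNReal.ofReal p) (volume.restrict A) := by
    intro F _ _ h hh
    obtain ⟨C, hC⟩ := hK.exists_bound_of_continuousOn hh.continuousOn
    have : IsFiniteMeasure (volume.restrict A) := ⟨by
      rw [Measure.restrict_apply_univ]; exact hb.measure_lt_top⟩
    refine MemLp.of_bound hh.aestronglyMeasurable C ?_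
    have : ∀ᵐ x ∂(volume.restrict (closure A)), ‖h x‖ ≤ C := by
      filter_upwards [ae_restrict_mem isClosed_closure.measurableSet] with x hx using hC x hx
    exact ae_restrict_of_ae_restrict_of_subset subset_closure this
  refine ⟨mem u hu.continuous, mem _ (continuous_gradient hu), fun φ hφ hc hs v => ?_⟩
  have hφ1 : ContDiff ℝ 1 φ := hφ.of_le (by exact_mod_cast le_top)
  have hz : ∀ x ∉ A, φ x = 0 := fun x hx =>
    image_eq_zero_of_notMem_tsupport fun hx' => hx (hs hx')
  have hz' : ∀ x ∉ A, fderiv ℝ φ x = 0 := fun x hx =>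
    fderiv_eq_zero_of_notMem_tsupport fun hx' => hx (hs hx')
  rw [setIntegral_eq_integral_of_forall_compl_eq_zero fun x hx => by simp [hz' x hx],
    setIntegral_eq_integral_of_forall_compl_eq_zero fun x hx => by simp [hz x hx]]
  have hl : LocallyIntegrable u := hu.continuous.locallyIntegrable
  have := integral_mul_fderiv_eq_neg_fderiv_mul_of_integrable (μ := (volume : Measure (Rn n)))
    (f := u) (g := φ) (v := v) ?_ ?_ ?_ (fun x _ => hu.differentiable one_ne_zero x)
    (fun x _ => hφ1.differentiable one_ne_zero x)
  · rw [this]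
    simp_rw [inner_gradient_left, mul_comm]
  · exact locallyIntegrable_integrable_mul (continuous_fderiv_apply' hu v).locallyIntegrable
      hφ.continuous hc
  · exact locallyIntegrable_integrable_mul hl (continuous_fderiv_apply' hφ1 v)
      (hasCompactSupport_fderiv_apply hc v)
  · exact locallyIntegrable_integrable_mul hl hφ.continuous hc

/-- The product of a Sobolev function on `Q` and a bounded smooth function `ζ` with bounded gradient
is a Sobolev function on any larger set `B` in which `ζ` is supported in `Q`. -/
lemma IsSobolevPair.mul_smooth {p : ℝ} (hp : 1 ≤ p) {Q B : Set (Rn n)} (hQ : MeasurableSet Q)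
    (hQB : Q ⊆ B) {u : Rn n → ℝ} {g : Rn n → Rn n} (h : IsSobolevPair p Q u g) {ζ : Rn n → ℝ}
    (hB : MeasurableSet B) (hζ : ContDiff ℝ ∞ ζ) {C : ℝ} (hζC : ∀ x, |ζ x| ≤ C)
    (hζC' : ∀ x, ‖fderiv ℝ ζ x‖ ≤ C)
    (hsupp : tsupport ζ ∩ B ⊆ Q) :
    IsSobolevPair p B (fun x => ζ x * u x) (fun x => ζ x • g x + u x • gradient ζ x) := by
  have hζ1 : ContDiff ℝ 1 ζ := hζ.of_le (by exact_mod_cast le_top)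
  have hz : ∀ x ∈ B, x ∉ Q → ζ x = 0 := fun x hx hx' =>
    image_eq_zero_of_notMem_tsupport fun h' => hx' (hsupp ⟨h', hx⟩)
  have hz' : ∀ x ∈ B, x ∉ Q → fderiv ℝ ζ x = 0 := fun x hx hx' =>
    fderiv_eq_zero_of_notMem_tsupport fun h' => hx' (hsupp ⟨h', hx⟩)
  have ext : ∀ {F : Type} [NormedAddCommGroup F] (k : Rn n → F),
      (∀ x ∈ B, x ∉ Q → k x = 0) → MemLp k (ENNReal.ofReal p) (volume.restrict Q) →
      MemLp k (ENNReal.ofReal p) (volume.restrict B) := by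
    intro F _ k hk hm
    have h1 : MemLp (Q.indicator k) (ENNReal.ofReal p) (volume.restrict B) := by
      rw [memLp_indicator_iff_restrict hQ, Measure.restrict_restrict hQ,
        inter_eq_left.2 hQB]
      exact hm
    refine h1.ae_eq ?_
    filter_upwards [ae_restrict_mem hB] with x hx
    by_cases hxQ : x ∈ Q
    · simp [hxQ]
    · simp [hxQ, hk x hx hxQ]
  refine ⟨ext _ (fun x hx hx' => by simp [hz x hx hx']) ?_,
    ext _ (fun x hx hx' => by simp [hz x hx hx', gradient_eq_zero_iff.2 (hz' x hx hx')]) ?_,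
    fun φ hφ hc hs v => ?_⟩
  · refine h.memLp.of_le_mul (c := C)
      (hζ.continuous.aestronglyMeasurable.mul h.memLp.aestronglyMeasurable)
      (Eventually.of_forall fun x => ?_)
    rw [norm_mul]
    exact mul_le_mul_of_nonneg_right (hζC x) (norm_nonneg _)
  · refine MemLp.add (f := fun x => ζ x • g x) (g := fun x => u x • gradient ζ x) ?_ ?_
    · refine h.memLp_grad.of_le_mul (c := C)
        (hζ.continuous.aestronglyMeasurable.smul h.memLp_grad.aestronglyMeasurable)
        (Eventually.of_forall fun x => ?_)
      rw [norm_smul]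
      exact mul_le_mul_of_nonneg_right (hζC x) (norm_nonneg _)
    · refine h.memLp.of_le_mul (c := C)
        (h.memLp.aestronglyMeasurable.smul (continuous_gradient hζ1).aestronglyMeasurable)
        (Eventually.of_forall fun x => ?_)
      rw [norm_smul, norm_gradient, mul_comm]
      exact mul_le_mul_of_nonneg_right (hζC' x) (norm_nonneg _)
  · have hφ1 : ContDiff ℝ 1 φ := hφ.of_le (by exact_mod_cast le_top)
    have lu := h.locallyIntegrable hp
    have lg := h.locallyIntegrable_grad hp
    have hcζ : HasCompactSupport fun x => ζ x * φ x := hc.mul_left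
    -- `ζ φ` is a test function in `Q`
    have key := h.isWeakGradient (fun x => ζ x * φ x) (hζ.mul hφ) hcζ (fun x hx =>
      hsupp ⟨tsupport_mul_subset_left hx, hs (tsupport_mul_subset_right hx)⟩) v
    have hd : ∀ x, fderiv ℝ (fun x => ζ x * φ x) x v
        = ζ x * fderiv ℝ φ x v + φ x * fderiv ℝ ζ x v := fun x => by
      rw [fderiv_fun_mul (hζ1.differentiable one_ne_zero x) (hφ1.differentiable one_ne_zero x)]
      simp
    have restr : ∀ k : Rn n → ℝ, (∀ x ∈ B, x ∉ Q → k x = 0) →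
        ∫ x in B, k x = ∫ x in Q, k x := fun k hk =>
      setIntegral_eq_of_subset_of_forall_sdiff_eq_zero hB hQB fun x hx => hk x hx.1 hx.2
    rw [restr _ fun x hx hx' => by simp [hz x hx hx'],
      restr _ fun x hx hx' => by
        simp [hz x hx hx', gradient_eq_zero_iff.2 (hz' x hx hx')]]
    have i1 : Integrable (fun x => u x * (ζ x * fderiv ℝ φ x v)) (volume.restrict Q) :=
      locallyIntegrable_integrable_mul lu (hζ.continuous.mul (continuous_fderiv_apply' hφ1 v))
        (hasCompactSupport_fderiv_apply hc v).mul_left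
    have i2 : Integrable (fun x => u x * (φ x * fderiv ℝ ζ x v)) (volume.restrict Q) :=
      locallyIntegrable_integrable_mul lu (hφ.continuous.mul (continuous_fderiv_apply' hζ1 v))
        hc.mul_right
    have i3 : Integrable (fun x => (ζ x * φ x) * inner ℝ (g x) v) (volume.restrict Q) :=
      locallyIntegrable_integrable_mul_inner lg (hζ.mul hφ).continuous hcζ v
    simp only [hd, mul_add] at key
    rw [integral_add i1 i2] at key
    have e1 : ∫ x in Q, φ x * inner ℝ (ζ x • g x + u x • gradient ζ x) v
        = (∫ x in Q, (ζ x * φ x) * inner ℝ (g x) v)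
          + ∫ x in Q, u x * (φ x * fderiv ℝ ζ x v) := by
      rw [← integral_add i3 i2]
      refine integral_congr_ae (Eventually.of_forall fun x => ?_)
      simp only [inner_add_left, real_inner_smul_left, inner_gradient_left]
      ring
    have e2 : ∫ x in Q, ζ x * u x * fderiv ℝ φ x v
        = ∫ x in Q, u x * (ζ x * fderiv ℝ φ x v) :=
      integral_congr_ae (Eventually.of_forall fun x => by ring)
    rw [e1, e2]
    linarith

/-- A cutoff function interpolates between a Sobolev function `u` on `Q` and a Sobolev function `v`
on a larger set `B`. -/
lemma IsSobolevPair.interpolate {p : ℝ} (hp : 1 ≤ p) {Q B : Set (Rn n)} (hQ : MeasurableSet Q)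
    (hB : MeasurableSet B) (hQB : Q ⊆ B) {u v : Rn n → ℝ} {g h : Rn n → Rn n}
    (hu : IsSobolevPair p Q u g) (hv : IsSobolevPair p B v h) {θ : Rn n → ℝ}
    (hθ : ContDiff ℝ ∞ θ) (hθI : ∀ x, θ x ∈ Icc (0 : ℝ) 1) (hθc : HasCompactSupport θ)
    (hθQ : tsupport θ ⊆ Q) :
    IsSobolevPair p B (fun x => θ x * u x + (1 - θ x) * v x)
      (fun x => θ x • g x + (1 - θ x) • h x + (u x - v x) • gradient θ x) := by
  have hθ1 : ContDiff ℝ 1 θ := hθ.of_le (by exact_mod_cast le_top)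
  obtain ⟨C, hC⟩ := (hθc.fderiv (𝕜 := ℝ)).exists_bound_of_continuous
    (hθ1.continuous_fderiv one_ne_zero)
  have e : ∀ x, fderiv ℝ (fun x => 1 - θ x) x = - fderiv ℝ θ x := fun x => by
    rw [fderiv_const_sub]
  have h1 := hu.mul_smooth hp hQ hQB hB hθ (C := max C 1)
    (fun x => by rw [abs_of_nonneg (hθI x).1]; exact (hθI x).2.trans (le_max_right _ _))
    (fun x => (hC x).trans (le_max_left _ _)) (inter_subset_left.trans hθQ)
  have h2 := hv.mul_smooth hp hB subset_rfl hB (ζ := fun x => 1 - θ x) (contDiff_const.sub hθ)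
    (C := max C 1)
    (fun x => by
      rw [abs_of_nonneg (by linarith [(hθI x).2])]
      exact le_trans (by linarith [(hθI x).1]) (le_max_right _ _))
    (fun x => by rw [e, norm_neg]; exact (hC x).trans (le_max_left _ _)) inter_subset_right
  refine (h1.add hp h2).congr ae_eq_rfl (Eventually.of_forall fun x => ?_)
  have e' : gradient (fun x => 1 - θ x) x = - gradient θ x := by
    simp only [gradient, e, map_neg]
  simp only [e', smul_neg, sub_smul]
  abel

/-- A smooth cutoff between a compact set and an open neighbourhood of it. -/
lemma exists_smooth_cutoff {K Q : Set (Rn n)} (hK : IsCompact K) (hQ : IsOpen Q) (hKQ : K ⊆ Q) :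
    ∃ θ : Rn n → ℝ, ContDiff ℝ ∞ θ ∧ (∀ x, θ x ∈ Icc (0 : ℝ) 1) ∧ HasCompactSupport θ ∧
      tsupport θ ⊆ Q ∧ ∀ x ∈ K, θ x = 1 := by
  obtain ⟨L, hL, hKL, hLQ⟩ := exists_compact_between hK hQ hKQ
  obtain ⟨θ, h1, h2, h3⟩ := exists_contMDiffMap_one_nhds_of_subset_interior
    (n := ⊤) (modelWithCornersSelf ℝ (Rn n)) hK.isClosed hKL
  have hs : tsupport θ ⊆ L := closure_minimal (fun x hx => by
    by_contra hxL; exact hx (h2 x hxL)) hL.isClosed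
  refine ⟨θ, θ.contMDiff.contDiff, h3, hL.of_isClosed_subset (isClosed_tsupport _) hs,
    hs.trans hLQ, fun x hx => h1.self_of_nhdsSet x hx⟩

lemma gradient_eq_zero_of_eq_zero {θ : Rn n → ℝ} (hθI : ∀ x, θ x ∈ Icc (0 : ℝ) 1) {x : Rn n}
    (hx : θ x = 0) : gradient θ x = 0 := by
  rw [gradient_eq_zero_iff]
  exact IsLocalMin.fderiv_eq_zero (Eventually.of_forall fun y => by rw [hx]; exact (hθI y).1)

lemma gradient_eq_zero_of_eq_one {θ : Rn n → ℝ} (hθI : ∀ x, θ x ∈ Icc (0 : ℝ) 1) {x : Rn n}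
    (hx : θ x = 1) : gradient θ x = 0 := by
  rw [gradient_eq_zero_iff]
  exact IsLocalMax.fderiv_eq_zero (Eventually.of_forall fun y => by rw [hx]; exact (hθI y).2)

open Classical in
/-- Extension of a Sobolev function on `Q` by one on `B ⊇ Q` that agrees with it near `∂Q`. -/
lemma IsSobolevPair.extend {p : ℝ} (hp : 1 ≤ p) {Q B : Set (Rn n)} (hQ : IsOpen Q)
    (hQb : Bornology.IsBounded Q) (hB : MeasurableSet B) (hQB : Q ⊆ B) {u v : Rn n → ℝ}
    {g h : Rn n → Rn n} (hu : IsSobolevPair p Q u g) (hv : IsSobolevPair p B v h)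
    (huv : EqNearBoundary Q u v) :
    IsSobolevPair p B (Q.piecewise u v) (Q.piecewise g h) := by
  obtain ⟨U, hU, hfU, hae⟩ := huv
  have hK : IsCompact (closure Q \ U) := hQb.isCompact_closure.diff hU
  have hKQ : closure Q \ U ⊆ Q := fun x hx => by
    by_contra hxQ
    exact hx.2 (hfU ⟨hx.1, by rwa [hQ.interior_eq]⟩)
  obtain ⟨θ, hθ, hθI, hθc, hθQ, hθK⟩ := exists_smooth_cutoff hK hQ hKQ
  have hQU : IsOpen (Q ∩ U) := hQ.inter hU
  have hgh : g =ᵐ[volume.restrict (Q ∩ U)] h :=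
    IsSobolevPair.ae_eq hp hQU ((hu.mono inter_subset_left).congr hae ae_eq_rfl)
      (hv.mono (inter_subset_left.trans hQB))
  have hint := hu.interpolate hp hQ.measurableSet hB hQB hv hθ hθI hθc hθQ
  rw [ae_restrict_iff' hQU.measurableSet] at hae
  rw [Filter.EventuallyEq, ae_restrict_iff' hQU.measurableSet] at hgh
  have hout : ∀ x ∉ Q, θ x = 0 := fun x hx =>
    image_eq_zero_of_notMem_tsupport fun hx' => hx (hθQ hx')
  refine hint.congr ?_ ?_
  · filter_upwards [ae_restrict_of_ae hae] with x hx
    by_cases hxQ : x ∈ Q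
    · rw [Set.piecewise_eq_of_mem _ _ _ hxQ]
      by_cases hxU : x ∈ U
      · rw [hx ⟨hxQ, hxU⟩]; ring
      · rw [hθK x ⟨subset_closure hxQ, hxU⟩]; ring
    · rw [Set.piecewise_eq_of_notMem _ _ _ hxQ, hout x hxQ]; ring
  · filter_upwards [ae_restrict_of_ae hae, ae_restrict_of_ae hgh] with x hx hx'
    by_cases hxQ : x ∈ Q
    · rw [Set.piecewise_eq_of_mem _ _ _ hxQ]
      by_cases hxU : x ∈ U
      · rw [hx ⟨hxQ, hxU⟩, hx' ⟨hxQ, hxU⟩, ← add_smul]; simp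
      · have h1 := hθK x ⟨subset_closure hxQ, hxU⟩
        rw [gradient_eq_zero_of_eq_one hθI h1, h1]; simp
    · rw [Set.piecewise_eq_of_notMem _ _ _ hxQ, gradient_eq_zero_of_eq_zero hθI (hout x hxQ),
        hout x hxQ]; simp

end

/-! ### Rotated cubes -/

section

variable {n : ℕ}

/-- The gauge of the rotated cubes centred at `x`: the maximum norm of the rotated coordinates. -/
def cubeNorm (T : Rn n ≃ₗᵢ[ℝ] Rn n) (x y : Rn n) : ℝ := ‖WithLp.ofLp (T.symm (y - x))‖

lemma continuous_cubeNorm (T : Rn n ≃ₗᵢ[ℝ] Rn n) (x : Rn n) : Continuous (cubeNorm T x) := by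
  unfold cubeNorm
  exact ((PiLp.continuous_ofLp 2 _).comp
    (T.symm.continuous.comp (continuous_id.sub continuous_const))).norm

lemma abs_coord_le_cubeNorm (T : Rn n ≃ₗᵢ[ℝ] Rn n) (x y : Rn n) (i : Fin n) :
    |T.symm (y - x) i| ≤ cubeNorm T x y :=
  norm_le_pi_norm (WithLp.ofLp (T.symm (y - x))) i

lemma cubeNorm_lt_iff [NeZero n] (T : Rn n ≃ₗᵢ[ℝ] Rn n) (x y : Rn n) (r : ℝ) :
    cubeNorm T x y < r ↔ ∀ i, |T.symm (y - x) i| < r := by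
  refine ⟨fun h i => (abs_coord_le_cubeNorm T x y i).trans_lt h, fun h => ?_⟩
  have hr : 0 < r := (abs_nonneg _).trans_lt (h 0)
  exact (pi_norm_lt_iff hr).2 h

lemma mem_rotatedCube [NeZero n] {T : Rn n ≃ₗᵢ[ℝ] Rn n} {x y : Rn n} {r : ℝ} :
    y ∈ rotatedCube T x r ↔ cubeNorm T x y < r / 2 := (cubeNorm_lt_iff T x y _).symm

lemma exists_coord_eq_cubeNorm [NeZero n] (T : Rn n ≃ₗᵢ[ℝ] Rn n) (x y : Rn n) :
    ∃ i, |T.symm (y - x) i| = cubeNorm T x y := by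
  by_contra! h
  exact lt_irrefl _ ((cubeNorm_lt_iff T x y _).2 fun i =>
    lt_of_le_of_ne (abs_coord_le_cubeNorm T x y i) (h i))

lemma cubeNorm_add_le (T : Rn n ≃ₗᵢ[ℝ] Rn n) (x y h : Rn n) :
    cubeNorm T x (y + h) ≤ cubeNorm T x y + ‖h‖ := by
  unfold cubeNorm
  rw [add_sub_right_comm, map_add, WithLp.ofLp_add]
  refine (norm_add_le _ _).trans (add_le_add le_rfl ?_)
  refine (pi_norm_le_iff_of_nonneg (norm_nonneg _)).2 fun i => ?_
  rw [← T.symm.norm_map h]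
  exact PiLp.norm_apply_le (T.symm h) i

lemma isOpen_rotatedCube [NeZero n] (T : Rn n ≃ₗᵢ[ℝ] Rn n) (x : Rn n) (r : ℝ) :
    IsOpen (rotatedCube T x r) := by
  have : rotatedCube T x r = cubeNorm T x ⁻¹' Iio (r / 2) := by ext y; exact mem_rotatedCube
  rw [this]
  exact isOpen_Iio.preimage (continuous_cubeNorm T x)

lemma isBounded_rotatedCube [NeZero n] (T : Rn n ≃ₗᵢ[ℝ] Rn n) (x : Rn n) (r : ℝ) :
    Bornology.IsBounded (rotatedCube T x r) := by
  refine (Metric.isBounded_iff_subset_closedBall x).2 ⟨∑ _i : Fin n, r / 2, fun y hy => ?_⟩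
  rw [mem_closedBall_iff_norm, ← T.symm.norm_map]
  have h1 : ‖T.symm (y - x)‖ ≤ ∑ i, |T.symm (y - x) i| := by
    have := (EuclideanSpace.basisFun (Fin n) ℝ).sum_repr (T.symm (y - x))
    conv_lhs => rw [← this]
    refine (norm_sum_le _ _).trans (le_of_eq ?_)
    simp [norm_smul]
  exact h1.trans (Finset.sum_le_sum fun i _ => (hy i).le)

lemma cubeNorm_eq_of_mem_frontier [NeZero n] {T : Rn n ≃ₗᵢ[ℝ] Rn n} {x y : Rn n} {r : ℝ}
    (hy : y ∈ frontier (rotatedCube T x r)) : cubeNorm T x y = r / 2 := by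
  refine le_antisymm ?_ ?_
  · have : closure (rotatedCube T x r) ⊆ cubeNorm T x ⁻¹' Iic (r / 2) :=
      closure_minimal (fun z hz => (mem_rotatedCube.1 hz).le)
        (isClosed_Iic.preimage (continuous_cubeNorm T x))
    exact this hy.1
  · by_contra! h
    have h2 := hy.2
    rw [(isOpen_rotatedCube T x r).interior_eq] at h2
    exact h2 (mem_rotatedCube.2 h)

lemma rotatedCube_mono [NeZero n] (T : Rn n ≃ₗᵢ[ℝ] Rn n) (x : Rn n) {r s : ℝ} (h : r ≤ s) :
    rotatedCube T x r ⊆ rotatedCube T x s := fun y hy => by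
  rw [mem_rotatedCube] at *; linarith

lemma add_mem_rotatedCube [NeZero n] {T : Rn n ≃ₗᵢ[ℝ] Rn n} {x y h : Rn n} {r s : ℝ}
    (hy : y ∈ rotatedCube T x r) (hh : r / 2 + ‖h‖ ≤ s / 2) : y + h ∈ rotatedCube T x s := by
  rw [mem_rotatedCube] at *
  linarith [cubeNorm_add_le T x y h]

/-- Rotated cubes have Lipschitz boundary. Near a boundary point with rotated coordinates `b`, the
cube is the set where `s i * z i < r / 2` for all `i`, with `s i` the sign of `b i`; in the inward
direction `-(s i / √n)_i` this is an epigraph. -/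
lemma isLipschitzDomain_rotatedCube [NeZero n] (T : Rn n ≃ₗᵢ[ℝ] Rn n) (x : Rn n) {r : ℝ}
    (hr : 0 < r) : IsLipschitzDomain (rotatedCube T x r) := by
  refine ⟨isOpen_rotatedCube T x r, isBounded_rotatedCube T x r, fun b hb => ?_⟩
  have hn0 : (0 : ℝ) < n := by exact_mod_cast NeZero.pos n
  have hsq : 0 < √(n : ℝ) := Real.sqrt_pos.2 hn0
  have hsign : ∃ s : Fin n → ℝ, ∀ i, s i * s i = 1 ∧ |s i| = 1 ∧ 0 ≤ s i * T.symm (b - x) i := by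
    refine ⟨fun i => if 0 ≤ T.symm (b - x) i then 1 else -1, fun i => ?_⟩
    dsimp only
    split_ifs with h
    · refine ⟨by norm_num, by norm_num, by linarith⟩
    · refine ⟨by norm_num, by norm_num, by linarith⟩
  obtain ⟨s, hs'⟩ := hsign
  have hs := fun i => (hs' i).1
  have hs1 := fun i => (hs' i).2.1
  let e₀ : Rn n := WithLp.toLp 2 fun i => -(s i / √n)
  have he₀ : ∀ i, e₀ i = -(s i / √n) := fun i => rfl
  have hnorm : ‖e₀‖ = 1 := by
    rw [EuclideanSpace.norm_eq, Real.sqrt_eq_one]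
    have : ∀ i, ‖e₀ i‖ ^ 2 = 1 / n := fun i => by
      rw [he₀, norm_neg, norm_div, Real.norm_eq_abs, hs1, div_pow, Real.norm_eq_abs, sq_abs,
        Real.sq_sqrt hn0.le, one_pow]
    simp only [this, Finset.sum_const, Finset.card_univ, Fintype.card_fin, nsmul_eq_mul]
    field_simp
  let m : Rn n → ℝ := fun z => Finset.univ.sup' Finset.univ_nonempty
    fun i => s i * T.symm (z - x) i
  have hm : ∀ z z', m z ≤ m z' + ‖z - z'‖ := fun z z' => by
    refine Finset.sup'_le _ _ fun i hi => ?_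
    have h1 : s i * T.symm (z' - x) i ≤ m z' :=
      Finset.le_sup' (fun i => s i * T.symm (z' - x) i) hi
    have h2 : s i * T.symm (z - z') i ≤ ‖z - z'‖ := by
      refine (le_abs_self _).trans ?_
      rw [abs_mul, hs1, one_mul, ← T.symm.norm_map (z - z')]
      exact PiLp.norm_apply_le (T.symm (z - z')) i
    have h3 : T.symm (z - x) i = T.symm (z - z') i + T.symm (z' - x) i := by
      rw [← PiLp.add_apply, ← map_add, sub_add_sub_cancel]
    rw [h3, mul_add]; linarith
  refine ⟨T e₀, by rw [T.norm_map, hnorm], (√(n : ℝ)).toNNReal, fun z => √n * (m z - r / 2), ?_, ?_⟩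
  · refine LipschitzWith.of_le_add_mul _ fun z z' => ?_
    rw [dist_eq_norm, Real.coe_toNNReal _ hsq.le]
    nlinarith [hm z z']
  · -- in a neighbourhood of `b` the constraints `-(r/2) < s i * z i` are inactive
    have hbn := cubeNorm_eq_of_mem_frontier hb
    have hev : ∀ᶠ y in 𝓝 b, ∀ i, -(r / 2) < s i * T.symm (y - x) i := by
      refine eventually_all.2 fun i => ?_
      have hc : Continuous fun y : Rn n => s i * T.symm (y - x) i := by fun_prop
      refine hc.continuousAt.eventually (lt_mem_nhds ?_)
      linarith [(hs' i).2.2]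
    filter_upwards [hev] with y hy
    set t : ℝ := inner ℝ (T e₀) y with ht
    have hcoord : ∀ i, s i * T.symm (y - t • T e₀ - x) i = s i * T.symm (y - x) i + t / √n :=
      fun i => by
      have h3 : T.symm (y - t • T e₀ - x) = T.symm (y - x) - t • e₀ := by
        rw [sub_right_comm, map_sub, map_smul, T.symm_apply_apply]
      rw [h3, PiLp.sub_apply, PiLp.smul_apply, he₀, smul_eq_mul]
      have := hs i
      linear_combination (t / √n) * this
    have hM : m (y - t • T e₀) - r / 2 < t / √n ↔
        ∀ i, s i * T.symm (y - x) i < r / 2 := by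
      rw [sub_lt_iff_lt_add, Finset.sup'_lt_iff]
      simp only [Finset.mem_univ, true_imp_iff, hcoord]
      exact forall_congr' fun i => by constructor <;> intro h <;> linarith
    have hQ : y ∈ rotatedCube T x r ↔ ∀ i, s i * T.symm (y - x) i < r / 2 := by
      refine forall_congr' fun i => ?_
      have h1 : |T.symm (y - x) i| = |s i * T.symm (y - x) i| := by rw [abs_mul, hs1, one_mul]
      rw [h1, abs_lt]
      exact ⟨fun h => h.2, fun h => ⟨hy i, h⟩⟩
    rw [hQ, ← hM, lt_div_iff₀ hsq, mul_comm]

/-- The part of a rotated cube of side `r` that lies in a slab of half-width `δ` orthogonal to one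
of its axes has measure at most `2 δ r^{n-1}`, and removing a concentric cube of side `s > 2δ`
leaves at most `2 δ (r^{n-1} - s^{n-1})`. -/
lemma volume_rotatedCube_inter_slab [NeZero n] (T : Rn n ≃ₗᵢ[ℝ] Rn n) (x : Rn n) (k : Fin n)
    {r s δ : ℝ} (hs : 0 ≤ s) (hsr : s ≤ r) (hδ : 0 ≤ δ) :
    volume (rotatedCube T x r ∩ {y | |T.symm (y - x) k| ≤ δ})
        ≤ ENNReal.ofReal (2 * δ * r ^ (n - 1)) ∧
      (δ < s / 2 → volume ((rotatedCube T x r \ rotatedCube T x s) ∩ {y | |T.symm (y - x) k| ≤ δ})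
        ≤ ENNReal.ofReal (2 * δ * (r ^ (n - 1) - s ^ (n - 1)))) := by
  have hr : 0 ≤ r := hs.trans hsr
  let box : ℝ → Set (Fin n → ℝ) := fun a =>
    univ.pi fun i => if i = k then Icc (-δ) δ else Ioo (-(a / 2)) (a / 2)
  have hbm : ∀ a, MeasurableSet (box a) := fun a => MeasurableSet.univ_pi fun i => by
    split_ifs
    · exact measurableSet_Icc
    · exact measurableSet_Ioo
  have hbv : ∀ a, 0 ≤ a → volume (box a) = ENNReal.ofReal (2 * δ * a ^ (n - 1)) := fun a ha => by
    have h1 : ∀ i, volume (if i = k then Icc (-δ) δ else Ioo (-(a / 2)) (a / 2))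
        = ENNReal.ofReal (if i = k then 2 * δ else a) := fun i => by
      split_ifs
      · rw [Real.volume_Icc]; ring_nf
      · rw [Real.volume_Ioo]; ring_nf
    rw [volume_pi_pi, Finset.prod_congr rfl fun i _ => h1 i, ← ENNReal.ofReal_prod_of_nonneg]
    · congr 1
      rw [Finset.prod_ite, Finset.filter_eq' Finset.univ k]
      simp only [Finset.mem_univ, if_true, Finset.prod_const, Finset.card_singleton, pow_one]
      rw [Finset.filter_ne' Finset.univ k, Finset.card_erase_of_mem (Finset.mem_univ k),
        Finset.card_univ, Fintype.card_fin]
    · intro i _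
      split_ifs <;> linarith
  let Y : Rn n → Fin n → ℝ := fun y => WithLp.ofLp (T.symm (y - x))
  have hY : MeasurePreserving Y volume volume :=
    (PiLp.volume_preserving_ofLp (Fin n)).comp
      (T.symm.measurePreserving.comp (measurePreserving_sub_right volume x))
  have hout : ∀ y, y ∈ rotatedCube T x r ∩ {y | |T.symm (y - x) k| ≤ δ} → Y y ∈ box r := by
    rintro y ⟨h1, h2⟩ i -
    dsimp only
    split_ifs with hi
    · rw [hi]; exact abs_le.1 h2
    · exact abs_lt.1 (h1 i)
  refine ⟨?_, fun hδs => ?_⟩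
  · rw [← hbv r hr, ← hY.measure_preimage (hbm r).nullMeasurableSet]
    exact measure_mono hout
  · have hsub : box s ⊆ box r := by
      refine pi_mono fun i _ => ?_
      split_ifs
      · exact subset_rfl
      · exact Ioo_subset_Ioo (by linarith) (by linarith)
    calc volume ((rotatedCube T x r \ rotatedCube T x s) ∩ {y | |T.symm (y - x) k| ≤ δ})
        ≤ volume (Y ⁻¹' (box r \ box s)) := by
          refine measure_mono ?_
          rintro y ⟨⟨h1, h2⟩, h3⟩
          refine ⟨hout y ⟨h1, h3⟩, fun h4 => h2 fun i => ?_⟩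
          have h5 := h4 i (mem_univ i)
          dsimp only at h5
          split_ifs at h5 with hi
          · rw [hi]; exact lt_of_le_of_lt h3 hδs
          · exact abs_lt.2 h5
      _ = volume (box r) - volume (box s) := by
          rw [hY.measure_preimage ((hbm r).diff (hbm s)).nullMeasurableSet,
            measure_sdiff hsub (hbm s).nullMeasurableSet
              (by rw [hbv s hs]; exact ENNReal.ofReal_ne_top)]
      _ ≤ _ := by
          rw [hbv r hr, hbv s hs, ← ENNReal.ofReal_sub _ (by positivity), mul_sub]

/-! ### Cutoff functions in thin layers between concentric cubes -/

lemma exists_bound_deriv_of_eq_zero {w : ℝ → ℝ} (hw : ContDiff ℝ 1 w) {a : ℝ}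
    (h : ∀ t, a < |t| → deriv w t = 0) : ∃ C, 0 ≤ C ∧ ∀ t, |deriv w t| ≤ C := by
  obtain ⟨C, hC⟩ := (isCompact_Icc (a := -a) (b := a)).exists_bound_of_continuousOn
    (hw.continuous_deriv le_rfl).continuousOn
  refine ⟨max C 0, le_max_right _ _, fun t => ?_⟩
  by_cases ht : |t| ≤ a
  · exact (hC t (abs_le.1 ht)).trans (le_max_left _ _)
  · rw [h t (not_le.1 ht), abs_zero]; exact le_max_right _ _

lemma exists_lipschitzWith_smoothTransition :
    ∃ L : NNReal, LipschitzWith L Real.smoothTransition := by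
  have hd : ContDiff ℝ 1 Real.smoothTransition := Real.smoothTransition.contDiff
  obtain ⟨C, h0, hC⟩ := exists_bound_deriv_of_eq_zero (a := 1) hd fun t ht => by
    rcases lt_abs.1 ht with h | h
    · refine IsLocalMax.deriv_eq_zero (Eventually.of_forall fun s => ?_)
      rw [Real.smoothTransition.one_of_one_le h.le]
      exact Real.smoothTransition.le_one s
    · refine IsLocalMin.deriv_eq_zero (Eventually.of_forall fun s => ?_)
      rw [Real.smoothTransition.zero_of_nonpos (by linarith)]
      exact Real.smoothTransition.nonneg s
  refine ⟨C.toNNReal, lipschitzWith_of_nnnorm_deriv_le (hd.differentiable one_ne_zero) fun t => ?_⟩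
  rw [← NNReal.coe_le_coe, Real.coe_toNNReal _ h0]
  exact hC t

/-- Cutoff functions equal to `1` in `{cubeNorm ≤ a}`, to `0` in `{cubeNorm ≥ a + ε}`, and with
gradient of order `1/ε`, uniformly in `a` and `ε`. -/
lemma exists_layer_cutoff [NeZero n] (T : Rn n ≃ₗᵢ[ℝ] Rn n) (x : Rn n) :
    ∃ C : ℝ, 0 ≤ C ∧ ∀ a ε : ℝ, 0 < ε → ∃ θ : Rn n → ℝ, ContDiff ℝ ∞ θ ∧
      (∀ y, θ y ∈ Icc (0 : ℝ) 1) ∧ (∀ y, cubeNorm T x y ≤ a → θ y = 1) ∧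
      (∀ y, a + ε ≤ cubeNorm T x y → θ y = 0) ∧ ∀ y, ‖ε • gradient θ y‖ ≤ C := by
  obtain ⟨L, hL⟩ := exists_lipschitzWith_smoothTransition
  have hL' : ∀ s t, |Real.smoothTransition s - Real.smoothTransition t| ≤ L * |s - t| :=
    fun s t => by simpa [Real.dist_eq] using hL.dist_le_mul s t
  refine ⟨L * (n * (2 * L)), by positivity, fun a ε hε => ?_⟩
  let c : Rn n → Fin n → ℝ := fun y i => T.symm (y - x) i
  have hc : ∀ y z i, |c y i - c z i| ≤ ‖y - z‖ := fun y z i => by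
    have h3 : c y i - c z i = T.symm (y - z) i := by
      change T.symm (y - x) i - T.symm (z - x) i = _
      rw [← PiLp.sub_apply, ← map_sub, sub_sub_sub_cancel_right]
    rw [h3, ← T.symm.norm_map (y - z)]
    exact PiLp.norm_apply_le (T.symm (y - z)) i
  let S : Rn n → ℝ := fun y => ∑ i, (Real.smoothTransition ((c y i - a) / ε)
    + Real.smoothTransition ((-c y i - a) / ε))
  have hcd : ∀ i, ContDiff ℝ ∞ fun y => c y i := fun i => by
    have : ContDiff ℝ ∞ fun y : Rn n => T.symm (y - x) :=
      T.symm.contDiff.comp (contDiff_id.sub contDiff_const)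
    exact (contDiff_euclidean.1 this) i
  have hS : ContDiff ℝ ∞ S := ContDiff.sum fun i _ =>
    (Real.smoothTransition.contDiff.comp (((hcd i).sub contDiff_const).div_const ε)).add
      (Real.smoothTransition.contDiff.comp (((hcd i).neg.sub contDiff_const).div_const ε))
  have hSL : ∀ y z, |S y - S z| ≤ n * (2 * L) / ε * ‖y - z‖ := fun y z => by
    have : ∀ i ∈ Finset.univ, |(Real.smoothTransition ((c y i - a) / ε)
        + Real.smoothTransition ((-c y i - a) / ε)) - (Real.smoothTransition ((c z i - a) / ε)
        + Real.smoothTransition ((-c z i - a) / ε))| ≤ 2 * L / ε * ‖y - z‖ := fun i _ => by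
      have h1 := hL' ((c y i - a) / ε) ((c z i - a) / ε)
      have h2 := hL' ((-c y i - a) / ε) ((-c z i - a) / ε)
      have e1 : (c y i - a) / ε - (c z i - a) / ε = (c y i - c z i) / ε := by ring
      have e2 : (-c y i - a) / ε - (-c z i - a) / ε = -((c y i - c z i) / ε) := by ring
      rw [e1, abs_div, abs_of_pos hε] at h1
      rw [e2, abs_neg, abs_div, abs_of_pos hε] at h2
      have h3 : (L : ℝ) * (|c y i - c z i| / ε) ≤ L / ε * ‖y - z‖ := by
        have := div_le_div_of_nonneg_right (hc y z i) hε.le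
        calc (L : ℝ) * (|c y i - c z i| / ε) ≤ L * (‖y - z‖ / ε) :=
              mul_le_mul_of_nonneg_left this L.coe_nonneg
          _ = _ := by ring
      rw [add_sub_add_comm]
      refine (abs_add_le _ _).trans ((add_le_add (h1.trans h3) (h2.trans h3)).trans (le_of_eq ?_))
      ring
    rw [← Finset.sum_sub_distrib]
    refine (Finset.abs_sum_le_sum_abs _ _).trans ((Finset.sum_le_sum this).trans (le_of_eq ?_))
    rw [Finset.sum_const, Finset.card_univ, Fintype.card_fin, nsmul_eq_mul]
    ring
  have hnn : ∀ y i, 0 ≤ Real.smoothTransition ((c y i - a) / ε)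
      + Real.smoothTransition ((-c y i - a) / ε) := fun y i =>
    add_nonneg (Real.smoothTransition.nonneg _) (Real.smoothTransition.nonneg _)
  refine ⟨fun y => Real.smoothTransition (1 - S y),
    Real.smoothTransition.contDiff.comp (contDiff_const.sub hS),
    fun y => ⟨Real.smoothTransition.nonneg _, Real.smoothTransition.le_one _⟩, fun y hy => ?_,
    fun y hy => ?_, fun y => ?_⟩
  · have : S y = 0 := Finset.sum_eq_zero fun i _ => by
      have h1 := abs_le.1 ((abs_coord_le_cubeNorm T x y i).trans hy)
      rw [Real.smoothTransition.zero_of_nonpos, Real.smoothTransition.zero_of_nonpos, add_zero]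
      · exact div_nonpos_of_nonpos_of_nonneg (by linarith [h1.1]) hε.le
      · exact div_nonpos_of_nonpos_of_nonneg (by linarith [h1.2]) hε.le
    simp only [this, sub_zero, Real.smoothTransition.one]
  · obtain ⟨i, hi⟩ := exists_coord_eq_cubeNorm T x y
    refine Real.smoothTransition.zero_of_nonpos ?_
    have h1 : 1 ≤ Real.smoothTransition ((c y i - a) / ε)
        + Real.smoothTransition ((-c y i - a) / ε) := by
      rw [← hi] at hy
      rcases le_abs.1 hy with h | h
      · rw [Real.smoothTransition.one_of_one_le (x := (c y i - a) / ε)]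
        · linarith [Real.smoothTransition.nonneg ((-c y i - a) / ε)]
        · rw [le_div_iff₀ hε]; linarith
      · rw [Real.smoothTransition.one_of_one_le (x := (-c y i - a) / ε)]
        · linarith [Real.smoothTransition.nonneg ((c y i - a) / ε)]
        · rw [le_div_iff₀ hε]; linarith
    have h2 : _ ≤ S y := Finset.single_le_sum (fun j _ => hnn y j) (Finset.mem_univ i)
    linarith
  · have hlip : LipschitzWith (Real.toNNReal (L * (n * (2 * L) / ε)))
        fun y => Real.smoothTransition (1 - S y) := by
      refine LipschitzWith.of_dist_le_mul fun y z => ?_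
      rw [Real.coe_toNNReal _ (by positivity), Real.dist_eq, dist_eq_norm]
      refine (hL' _ _).trans ?_
      rw [sub_sub_sub_cancel_left, abs_sub_comm, mul_assoc]
      exact mul_le_mul_of_nonneg_left (hSL y z) L.coe_nonneg
    have := norm_fderiv_le_of_lipschitz ℝ (x₀ := y) hlip
    rw [Real.coe_toNNReal _ (by positivity)] at this
    rw [norm_smul, norm_gradient, Real.norm_of_nonneg hε.le]
    calc _ ≤ ε * (L * (n * (2 * L) / ε)) := mul_le_mul_of_nonneg_left this hε.le
      _ = _ := by field_simp

end

/-! ### The regularised jump: energy and convergence -/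

section

variable {n : ℕ}

lemma IsProfile.eq_zero_or_one {w : ℝ → ℝ} (hw : IsProfile w) {t : ℝ} (ht : 1 < |t|) :
    w t = 0 ∨ w t = 1 := by
  rw [hw.eq_indicator t ht]
  by_cases h : t ∈ Ioi (0 : ℝ) <;> simp [h]

lemma IsProfile.deriv_eq_zero {w : ℝ → ℝ} (hw : IsProfile w) {t : ℝ} (ht : 1 < |t|) :
    deriv w t = 0 := by
  rcases hw.eq_zero_or_one ht with h | h
  · exact IsLocalMin.deriv_eq_zero (Eventually.of_forall fun s => by
      rw [h]; exact (hw.mem_Icc s).1)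
  · exact IsLocalMax.deriv_eq_zero (Eventually.of_forall fun s => by
      rw [h]; exact (hw.mem_Icc s).2)

lemma IsDoubleWell.exists_bound {W : ℝ → ℝ} (hW : IsDoubleWell W) :
    ∃ C, 0 ≤ C ∧ ∀ t ∈ Icc (0 : ℝ) 1, W t ≤ C := by
  obtain ⟨C, hC⟩ := (isCompact_Icc (a := (0 : ℝ)) (b := 1)).exists_bound_of_continuousOn
    hW.continuous.continuousOn
  refine ⟨max C 0, le_max_right _ _, fun t ht => ?_⟩
  exact (le_abs_self _).trans ((hC t ht).trans (le_max_left _ _))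

lemma contDiff_regJump {w : ℝ → ℝ} (hw : IsProfile w) (ε : ℝ) (x : Rn n) (ν : Sph n) :
    ContDiff ℝ 1 (regJump w ε x ν) := by
  unfold regJump
  exact hw.contDiff.comp (contDiff_const.mul
    ((contDiff_id.sub contDiff_const).inner ℝ contDiff_const))

lemma norm_smul_gradient_regJump {w : ℝ → ℝ} (hw : IsProfile w) {ε : ℝ} (hε : 0 < ε) (x : Rn n)
    (ν : Sph n) (y : Rn n) :
    ‖ε • gradient (regJump w ε x ν) y‖ = |deriv w (1 / ε * inner ℝ (y - x) (ν : Rn n))| := by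
  have hg : HasGradientAt (regJump w ε x ν)
      ((deriv w (1 / ε * inner ℝ (y - x) (ν : Rn n)) * (1 / ε)) • (ν : Rn n)) y := by
    rw [hasGradientAt_iff_hasFDerivAt]
    have h1 : HasFDerivAt (fun y : Rn n => 1 / ε * inner ℝ (y - x) (ν : Rn n))
        ((1 / ε) • InnerProductSpace.toDual ℝ (Rn n) (ν : Rn n)) y := by
      have h2 : HasFDerivAt (fun y : Rn n => InnerProductSpace.toDual ℝ (Rn n) (ν : Rn n) (y - x))
          (InnerProductSpace.toDual ℝ (Rn n) (ν : Rn n)) y :=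
        (InnerProductSpace.toDual ℝ (Rn n) (ν : Rn n)).hasFDerivAt.comp y
          ((hasFDerivAt_id y).sub_const x)
      have h3 := h2.const_mul (1 / ε)
      simpa only [InnerProductSpace.toDual_apply_apply, real_inner_comm] using h3
    have h4 := ((hw.contDiff.differentiable one_ne_zero _).hasDerivAt).comp_hasFDerivAt y h1
    refine h4.congr_fderiv ?_
    rw [map_smul, smul_smul]
  rw [hg.gradient, smul_smul, norm_smul, norm_eq_of_mem_sphere, mul_one, Real.norm_eq_abs]
  congr 1
  field_simp

lemma regJump_mem_Icc {w : ℝ → ℝ} (hw : IsProfile w) (ε : ℝ) (x : Rn n) (ν : Sph n) (y : Rn n) :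
    regJump w ε x ν y ∈ Icc (0 : ℝ) 1 := hw.mem_Icc _

lemma jumpFun_mem_Icc (x : Rn n) (ν : Sph n) (y : Rn n) : jumpFun x ν y ∈ Icc (0 : ℝ) 1 := by
  unfold jumpFun
  by_cases h : y ∈ {z : Rn n | 0 ≤ inner ℝ (z - x) (ν : Rn n)}
  · rw [indicator_of_mem h]; simp
  · rw [indicator_of_notMem h]; simp

lemma regJump_eq_jumpFun {w : ℝ → ℝ} (hw : IsProfile w) {ε : ℝ} (hε : 0 < ε) (x : Rn n)
    (ν : Sph n) {y : Rn n} (hy : ε < |inner ℝ (y - x) (ν : Rn n)|) :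
    regJump w ε x ν y = jumpFun x ν y := by
  have h1 : 1 < |1 / ε * inner ℝ (y - x) (ν : Rn n)| := by
    rw [abs_mul, abs_of_pos (by positivity), one_div, ← div_eq_inv_mul, lt_div_iff₀ hε, one_mul]
    exact hy
  have h0 : inner ℝ (y - x) (ν : Rn n) ≠ 0 := fun h => by
    rw [h, abs_zero] at hy; linarith
  rw [regJump, hw.eq_indicator _ h1, jumpFun]
  by_cases h : 0 ≤ inner ℝ (y - x) (ν : Rn n)
  · have h2 : 0 < inner ℝ (y - x) (ν : Rn n) := lt_of_le_of_ne h h0.symm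
    rw [indicator_of_mem (by rw [mem_Ioi]; positivity), indicator_of_mem (by exact h)]
    rfl
  · rw [indicator_of_notMem, indicator_of_notMem (by exact h)]
    rw [mem_Ioi, not_lt]
    exact mul_nonpos_of_nonneg_of_nonpos (by positivity) (not_le.1 h).le

/-- The slab of half-width `δ` around the hyperplane through `x` orthogonal to `ν`. -/
def slab (x : Rn n) (ν : Sph n) (δ : ℝ) : Set (Rn n) := {y | |inner ℝ (y - x) (ν : Rn n)| ≤ δ}

lemma measurableSet_slab (x : Rn n) (ν : Sph n) (δ : ℝ) : MeasurableSet (slab x ν δ) := by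
  refine (IsClosed.measurableSet ?_)
  exact isClosed_le (by fun_prop) continuous_const

/-- The energy density of the regularised jump is bounded and concentrated in the slab of half-width
`ε`, since the potential vanishes at `0` and `1`. -/
lemma exists_gradEnergy_regJump_le {p c₁ c₂ : ℝ} (hp : 1 < p) (hc₂ : 0 ≤ c₂) {W w : ℝ → ℝ}
    (hW : IsDoubleWell W) (hw : IsProfile w) :
    ∃ M, 0 ≤ M ∧ ∀ (f : Rn n → ℝ → Rn n → ℝ), IsIntegrand W p c₁ c₂ f → ∀ (ε : ℝ), 0 < ε →
      ∀ (x : Rn n) (ν : Sph n) (S : Set (Rn n)), MeasurableSet S →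
      gradEnergy f ε S (regJump w ε x ν) (gradient (regJump w ε x ν))
        ≤ ENNReal.ofReal (1 / ε * M) * volume (S ∩ slab x ν ε) := by
  obtain ⟨C, hC0, hC⟩ := hW.exists_bound
  obtain ⟨D, hD0, hD⟩ := exists_bound_deriv_of_eq_zero (a := 1) hw.contDiff
    fun t ht => hw.deriv_eq_zero ht
  refine ⟨c₂ * (C + D ^ p), by positivity, fun f hf ε hε x ν S hS => ?_⟩
  rw [ENNReal.ofReal_mul (by positivity), mul_assoc, gradEnergy]
  refine mul_le_mul_right ?_ _
  calc ∫⁻ y in S, ENNReal.ofReal (f y (regJump w ε x ν y)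
        (ε • gradient (regJump w ε x ν) y))
      ≤ ∫⁻ y in S, (slab x ν ε).indicator (fun _ => ENNReal.ofReal (c₂ * (C + D ^ p))) y := by
        refine lintegral_mono fun y => ?_
        by_cases hy : y ∈ slab x ν ε
        · rw [indicator_of_mem hy]
          refine ENNReal.ofReal_le_ofReal ((hf.upper _ _ _).trans ?_)
          refine mul_le_mul_of_nonneg_left (add_le_add (hC _ (hw.mem_Icc _)) ?_) hc₂
          rw [norm_smul_gradient_regJump hw hε]
          exact Real.rpow_le_rpow (abs_nonneg _) (hD _) (by linarith)
        · rw [indicator_of_notMem hy, nonpos_iff_eq_zero, ENNReal.ofReal_eq_zero]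
          refine (hf.upper _ _ _).trans (le_of_eq ?_)
          have h1 : 1 < |1 / ε * inner ℝ (y - x) (ν : Rn n)| := by
            rw [abs_mul, abs_of_pos (by positivity), one_div, ← div_eq_inv_mul, lt_div_iff₀ hε,
              one_mul]
            exact not_le.1 hy
          rw [norm_smul_gradient_regJump hw hε, hw.deriv_eq_zero h1, abs_zero,
            Real.zero_rpow (by linarith), regJump, (hW.eq_zero_iff _).2 (hw.eq_zero_or_one h1)]
          ring
    _ = _ := by
        rw [lintegral_indicator (measurableSet_slab x ν ε), setLIntegral_const,
          Measure.restrict_apply (measurableSet_slab x ν ε), inter_comm]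

variable {T : Rn n ≃ₗᵢ[ℝ] Rn n} {ν : Sph n} {k : Fin n}

lemma inner_eq_coord (hT : T (EuclideanSpace.single k (1 : ℝ)) = (ν : Rn n)) (x y : Rn n) :
    inner ℝ (y - x) (ν : Rn n) = T.symm (y - x) k := by
  rw [← hT, ← T.apply_symm_apply (y - x), T.inner_map_map, T.symm_apply_apply]
  simp [EuclideanSpace.inner_single_right]

variable [NeZero n]

lemma volume_cube_inter_slab (hT : T (EuclideanSpace.single k (1 : ℝ)) = (ν : Rn n)) (x : Rn n)
    {r δ : ℝ} (hr : 0 ≤ r) (hδ : 0 ≤ δ) :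
    volume (rotatedCube T x r ∩ slab x ν δ) ≤ ENNReal.ofReal (2 * δ * r ^ (n - 1)) := by
  simpa only [slab, inner_eq_coord hT] using
    (volume_rotatedCube_inter_slab T x k le_rfl hr hδ).1

lemma volume_shell_inter_slab (hT : T (EuclideanSpace.single k (1 : ℝ)) = (ν : Rn n)) (x : Rn n)
    {r s δ : ℝ} (hsr : s ≤ r) (hδ : 0 ≤ δ) (hδs : δ < s / 2) :
    volume ((rotatedCube T x r \ rotatedCube T x s) ∩ slab x ν δ)
      ≤ ENNReal.ofReal (2 * δ * (r ^ (n - 1) - s ^ (n - 1))) := by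
  simpa only [slab, inner_eq_coord hT] using
    (volume_rotatedCube_inter_slab T x k (by linarith) hsr hδ).2 hδs

lemma lintegral_regJump_sub_jumpFun_le {w : ℝ → ℝ} (hw : IsProfile w)
    (hT : T (EuclideanSpace.single k (1 : ℝ)) = (ν : Rn n)) (x : Rn n) {r ε : ℝ} (hr : 0 ≤ r)
    (hε : 0 < ε) :
    ∫⁻ y in rotatedCube T x r, ‖regJump w ε x ν y - jumpFun x ν y‖ₑ
      ≤ ENNReal.ofReal (2 * ε * r ^ (n - 1)) := by
  calc ∫⁻ y in rotatedCube T x r, ‖regJump w ε x ν y - jumpFun x ν y‖ₑ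
      ≤ ∫⁻ y in rotatedCube T x r, (slab x ν ε).indicator (fun _ => 1) y := by
        refine lintegral_mono fun y => ?_
        by_cases hy : y ∈ slab x ν ε
        · rw [indicator_of_mem hy]
          rw [← ofReal_norm, ← ENNReal.ofReal_one]
          refine ENNReal.ofReal_le_ofReal ?_
          have h1 := regJump_mem_Icc hw ε x ν y
          have h2 := jumpFun_mem_Icc x ν y
          exact abs_le.2 ⟨by linarith [h1.1, h2.2], by linarith [h1.2, h2.1]⟩
        · rw [indicator_of_notMem hy, regJump_eq_jumpFun hw hε x ν (not_le.1 hy)]; simp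
    _ = volume (rotatedCube T x r ∩ slab x ν ε) := by
        rw [lintegral_indicator (measurableSet_slab x ν ε), setLIntegral_const,
          Measure.restrict_apply (measurableSet_slab x ν ε), inter_comm, one_mul]
    _ ≤ _ := volume_cube_inter_slab hT x hr hε.le

lemma ofReal_mul_volume_le {M ε a : ℝ} (hM : 0 ≤ M) (hε : 0 < ε) {V : ℝ≥0∞}
    (h : V ≤ ENNReal.ofReal (2 * ε * a)) :
    ENNReal.ofReal (1 / ε * M) * V ≤ ENNReal.ofReal (2 * M * a) := by
  refine (mul_le_mul_right h _).trans (le_of_eq ?_)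
  rw [← ENNReal.ofReal_mul (by positivity)]
  congr 1
  field_simp

end

/-! ### Joining two functions in a thin layer -/

section

variable {n : ℕ}

lemma gradEnergy_model_le {W : ℝ → ℝ} {p c₁ c₂ : ℝ} (hc₁ : 0 < c₁)
    {f : Rn n → ℝ → Rn n → ℝ} (hf : IsIntegrand W p c₁ c₂ f) (ε : ℝ) (A : Set (Rn n))
    (u : Rn n → ℝ) (g : Rn n → Rn n) :
    gradEnergy (modelIntegrand W p) ε A u g ≤ ENNReal.ofReal (1 / c₁) * gradEnergy f ε A u g := by
  unfold gradEnergy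
  rw [mul_left_comm]
  refine mul_le_mul_right ?_ _
  rw [← lintegral_const_mul' _ _ ENNReal.ofReal_ne_top]
  refine lintegral_mono fun y => ?_
  rw [← ENNReal.ofReal_mul (by positivity)]
  refine ENNReal.ofReal_le_ofReal ?_
  rw [one_div, ← div_eq_inv_mul, le_div_iff₀ hc₁, mul_comm]
  exact hf.lower _ _ _

/-- Uniform continuity of the potential on `[0,1]`, in a form that is linear in the distance. -/
lemma IsDoubleWell.exists_modulus {W : ℝ → ℝ} (hW : IsDoubleWell W) {η : ℝ} (hη : 0 < η) :
    ∃ C, 0 ≤ C ∧ ∀ s ∈ Icc (0 : ℝ) 1, ∀ t ∈ Icc (0 : ℝ) 1, W s ≤ W t + η + C * |s - t| := by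
  have huc := (isCompact_Icc (a := (0 : ℝ)) (b := 1)).uniformContinuousOn_of_continuous
    hW.continuous.continuousOn
  obtain ⟨d, hd, hd'⟩ := Metric.uniformContinuousOn_iff.1 huc η hη
  obtain ⟨B, hB0, hB⟩ := hW.exists_bound
  refine ⟨B / d, by positivity, fun s hs t ht => ?_⟩
  by_cases h : |s - t| < d
  · have h1 := hd' s hs t ht h
    rw [Real.dist_eq] at h1
    have h2 : 0 ≤ B / d * |s - t| := by positivity
    linarith [(abs_lt.1 h1).2]
  · have h1 : B ≤ B / d * |s - t| := by
      rw [div_mul_eq_mul_div, le_div_iff₀ hd]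
      exact mul_le_mul_of_nonneg_left (not_lt.1 h) hB0
    linarith [hB s hs, hW.nonneg t]

lemma add_add_rpow_le {p a b c : ℝ} (hp : 0 ≤ p) (ha : 0 ≤ a) (hb : 0 ≤ b) (hc : 0 ≤ c) :
    (a + b + c) ^ p ≤ 3 ^ p * (a ^ p + b ^ p + c ^ p) := by
  have h1 := Real.rpow_nonneg ha p
  have h2 := Real.rpow_nonneg hb p
  have h3 := Real.rpow_nonneg hc p
  have key : ∀ m, 0 ≤ m → a ≤ m → b ≤ m → c ≤ m → m ^ p ≤ a ^ p + b ^ p + c ^ p →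
      (a + b + c) ^ p ≤ 3 ^ p * (a ^ p + b ^ p + c ^ p) := fun m hm ham hbm hcm h => by
    calc (a + b + c) ^ p ≤ (3 * m) ^ p := Real.rpow_le_rpow (by positivity) (by linarith) hp
      _ = 3 ^ p * m ^ p := Real.mul_rpow (by norm_num) hm
      _ ≤ _ := mul_le_mul_of_nonneg_left h (by positivity)
  rcases le_total a b with hab | hab
  · rcases le_total b c with hbc | hbc
    · exact key c hc (hab.trans hbc) hbc le_rfl (by linarith)
    · exact key b hb hab le_rfl hbc (by linarith)
  · rcases le_total a c with hac | hac
    · exact key c hc hac (hab.trans hac) le_rfl (by linarith)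
    · exact key a ha le_rfl hab hac (by linarith)

/-- Energy density in the transition layer: `a` and `b` are the values of the two functions, `g` and
`h` their gradients, `t` and `z` the value and the gradient of the cutoff function. -/
lemma layer_density_le {W : ℝ → ℝ} (hW : IsDoubleWell W) {p c₁ c₂ : ℝ} (hp : 1 < p)
    (hc₂ : 0 ≤ c₂)
    {f : Rn n → ℝ → Rn n → ℝ} (hf : IsIntegrand W p c₁ c₂ f) {C η Cη : ℝ} (hη : 0 ≤ η)
    (hCη : 0 ≤ Cη) (hC : 0 ≤ C)
    (hmod : ∀ s ∈ Icc (0 : ℝ) 1, ∀ t ∈ Icc (0 : ℝ) 1, W s ≤ W t + η + Cη * |s - t|)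
    {ε : ℝ} (y : Rn n) {a b t : ℝ} {g h z : Rn n} (ha : a ∈ Icc (0 : ℝ) 1)
    (hb : b ∈ Icc (0 : ℝ) 1) (ht : t ∈ Icc (0 : ℝ) 1) (hz : ‖ε • z‖ ≤ C) :
    f y (t * a + (1 - t) * b) (ε • (t • g + (1 - t) • h + (a - b) • z))
      ≤ c₂ * (3 ^ p * (1 + C ^ p)) * ((W a + ‖ε • g‖ ^ p) + (W b + ‖ε • h‖ ^ p)
        + (η + (Cη + 1) * |a - b|)) := by
  have hU : t * a + (1 - t) * b ∈ Icc (0 : ℝ) 1 := by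
    obtain ⟨h1, h2⟩ := ha; obtain ⟨h3, h4⟩ := hb; obtain ⟨h5, h6⟩ := ht
    constructor <;> nlinarith
  have hab1 : |a - b| ≤ 1 := abs_le.2 ⟨by linarith [ha.1, hb.2], by linarith [ha.2, hb.1]⟩
  have hUb : |t * a + (1 - t) * b - b| ≤ |a - b| := by
    rw [show t * a + (1 - t) * b - b = t * (a - b) by ring, abs_mul, abs_of_nonneg ht.1]
    exact mul_le_of_le_one_left (abs_nonneg _) ht.2
  have hWU : W (t * a + (1 - t) * b) ≤ W b + η + Cη * |a - b| :=
    (hmod _ hU _ hb).trans (by gcongr)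
  have hgrad : ‖ε • (t • g + (1 - t) • h + (a - b) • z)‖ ≤ ‖ε • g‖ + ‖ε • h‖ + C * |a - b| := by
    have e : ε • (t • g + (1 - t) • h + (a - b) • z)
        = t • (ε • g) + (1 - t) • (ε • h) + (a - b) • (ε • z) := by
      simp only [smul_add, smul_comm ε]
    rw [e]
    refine (norm_add₃_le).trans (add_le_add (add_le_add ?_ ?_) ?_)
    · rw [norm_smul, Real.norm_of_nonneg ht.1]
      exact mul_le_of_le_one_left (norm_nonneg _) ht.2
    · rw [norm_smul, Real.norm_of_nonneg (by linarith [ht.2])]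
      exact mul_le_of_le_one_left (norm_nonneg _) (by linarith [ht.1])
    · rw [norm_smul, mul_comm, Real.norm_eq_abs]
      exact mul_le_mul_of_nonneg_right hz (abs_nonneg _)
  have hpow : ‖ε • (t • g + (1 - t) • h + (a - b) • z)‖ ^ p
      ≤ 3 ^ p * (‖ε • g‖ ^ p + ‖ε • h‖ ^ p + C ^ p * |a - b|) := by
    refine (Real.rpow_le_rpow (norm_nonneg _) hgrad (by linarith)).trans ?_
    refine (add_add_rpow_le (by linarith) (norm_nonneg _) (norm_nonneg _)
      (by positivity)).trans ?_
    gcongr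
    rw [Real.mul_rpow hC (abs_nonneg _)]
    gcongr
    calc |a - b| ^ p ≤ |a - b| ^ (1 : ℝ) :=
          Real.rpow_le_rpow_of_exponent_ge' (abs_nonneg _) hab1 zero_le_one hp.le
      _ = |a - b| := Real.rpow_one _
  have h3 : (1 : ℝ) ≤ 3 ^ p := Real.one_le_rpow (by norm_num) (by linarith)
  have hCp : 0 ≤ C ^ p := Real.rpow_nonneg hC p
  refine (hf.upper _ _ _).trans ?_
  rw [mul_assoc]
  refine mul_le_mul_of_nonneg_left ((add_le_add hWU hpow).trans ?_) hc₂
  have w1 := hW.nonneg a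
  have w2 := hW.nonneg b
  have g1 : 0 ≤ ‖ε • g‖ ^ p := by positivity
  have g2 : 0 ≤ ‖ε • h‖ ^ p := by positivity
  have d0 := abs_nonneg (a - b)
  have e1 : W b + η + Cη * |a - b| ≤ 3 ^ p * (W b + η + Cη * |a - b|) :=
    le_mul_of_one_le_left (by positivity) h3
  calc _ ≤ 3 ^ p * (W b + η + Cη * |a - b|)
        + 3 ^ p * (‖ε • g‖ ^ p + ‖ε • h‖ ^ p + C ^ p * |a - b|) := by linarith
    _ = 3 ^ p * (W b + η + Cη * |a - b| + ‖ε • g‖ ^ p + ‖ε • h‖ ^ p + C ^ p * |a - b|) := by ring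
    _ ≤ 3 ^ p * ((1 + C ^ p) * ((W a + ‖ε • g‖ ^ p) + (W b + ‖ε • h‖ ^ p)
        + (η + (Cη + 1) * |a - b|))) := by
        refine mul_le_mul_of_nonneg_left ?_ (by positivity)
        have : 0 ≤ C ^ p * ((W a + ‖ε • g‖ ^ p) + (W b + ‖ε • h‖ ^ p) + (η + Cη * |a - b|)) := by
          positivity
        nlinarith
    _ = _ := by ring

lemma exists_layer_le {X : Type*} [MeasurableSpace X] {μ : Measure X} {d : X → ℝ}
    (hd : Measurable d) (F : X → ℝ≥0∞) {S : Set X} {a ε : ℝ} (hε : 0 < ε) {N : ℕ} (hN : N ≠ 0)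
    (hS : ∀ y, a ≤ d y → d y < a + N * ε → y ∈ S) :
    ∃ i < N, ∫⁻ y in {y | a + i * ε ≤ d y ∧ d y < a + i * ε + ε}, F y ∂μ
      ≤ (N : ℝ≥0∞)⁻¹ * ∫⁻ y in S, F y ∂μ := by
  let L : ℕ → Set X := fun i => {y | a + i * ε ≤ d y ∧ d y < a + i * ε + ε}
  have hLm : ∀ i, MeasurableSet (L i) := fun i =>
    (measurableSet_le measurable_const hd).inter (measurableSet_lt hd measurable_const)
  have hLd : ((Finset.range N : Finset ℕ) : Set ℕ).PairwiseDisjoint L := by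
    have aux : ∀ i j : ℕ, i < j → Disjoint (L i) (L j) := fun i j hij => by
      refine disjoint_left.2 fun y h1 h2 => ?_
      have : (i : ℝ) + 1 ≤ j := by exact_mod_cast hij
      have h3 := h1.2
      have h4 := h2.1
      nlinarith
    intro i _ j _ hij
    rcases lt_or_gt_of_ne hij with h | h
    · exact aux i j h
    · exact (aux j i h).symm
  have hsum : ∑ i ∈ Finset.range N, ∫⁻ y in L i, F y ∂μ ≤ ∫⁻ y in S, F y ∂μ := by
    rw [← lintegral_biUnion_finset hLd fun i _ => hLm i]
    refine lintegral_mono_set ?_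
    refine iUnion₂_subset fun i hi y hy => hS y ?_ ?_
    · have : 0 ≤ (i : ℝ) * ε := by positivity
      linarith [hy.1]
    · have : (i : ℝ) + 1 ≤ N := by exact_mod_cast Finset.mem_range.1 hi
      have h3 := hy.2
      nlinarith
  obtain ⟨i, hi, hmin⟩ := Finset.exists_min_image (Finset.range N)
    (fun i => ∫⁻ y in L i, F y ∂μ) (Finset.nonempty_range_iff.2 hN)
  refine ⟨i, Finset.mem_range.1 hi, ?_⟩
  have h1 := (Finset.card_nsmul_le_sum _ _ _ hmin).trans hsum
  rw [Finset.card_range, nsmul_eq_mul] at h1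
  have hN0 : (N : ℝ≥0∞) ≠ 0 := by exact_mod_cast hN
  have h2 := mul_le_mul_right h1 (N : ℝ≥0∞)⁻¹
  rwa [← mul_assoc, ENNReal.inv_mul_cancel hN0 (ENNReal.natCast_ne_top N), one_mul] at h2

variable [NeZero n]

/-- Two Sobolev functions on a cube can be joined in one of `N` concentric layers of width `ε`,
chosen so that the cost of the transition is at most the average over the layers. -/
lemma exists_join {W : ℝ → ℝ} (hW : IsDoubleWell W) {p c₁ c₂ : ℝ} (hp : 1 < p)
    (hc₂ : 0 ≤ c₂) (T : Rn n ≃ₗᵢ[ℝ] Rn n) (x : Rn n) :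
    ∃ K : ℝ, 0 ≤ K ∧ ∀ {f : Rn n → ℝ → Rn n → ℝ}, IsIntegrand W p c₁ c₂ f →
      ∀ {η Cη : ℝ}, 0 ≤ η → 0 ≤ Cη →
      (∀ s ∈ Icc (0 : ℝ) 1, ∀ t ∈ Icc (0 : ℝ) 1, W s ≤ W t + η + Cη * |s - t|) →
      ∀ {ρ a ε : ℝ} {N : ℕ}, 0 < ε → N ≠ 0 → a + N * ε < ρ / 2 →
      ∀ {u v : Rn n → ℝ} {g h : Rn n → Rn n}, IsSobolevPair p (rotatedCube T x ρ) u g →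
      IsSobolevPair p (rotatedCube T x ρ) v h →
      (∀ᵐ y ∂(volume.restrict (rotatedCube T x ρ)), u y ∈ Icc (0 : ℝ) 1) →
      (∀ y, v y ∈ Icc (0 : ℝ) 1) →
      minEnergy p ε f v (rotatedCube T x ρ) ≤ gradEnergy f ε (rotatedCube T x ρ) u g
        + gradEnergy f ε (rotatedCube T x ρ \ rotatedCube T x (2 * a)) v h
        + ENNReal.ofReal (1 / ε) * ((N : ℝ≥0∞)⁻¹ *
          ∫⁻ y in rotatedCube T x ρ \ rotatedCube T x (2 * a),
            ENNReal.ofReal (K * ((W (u y) + ‖ε • g y‖ ^ p) + (W (v y) + ‖ε • h y‖ ^ p)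
              + (η + (Cη + 1) * |u y - v y|)))) := by
  obtain ⟨C, hC, hcut⟩ := exists_layer_cutoff T x
  refine ⟨c₂ * (3 ^ p * (1 + C ^ p)), by positivity, ?_⟩
  intro f hf η Cη hη hCη hmod ρ a ε N hε hN haN u v g h hu hv huI hvI
  set Q := rotatedCube T x ρ with hQdef
  set S := Q \ rotatedCube T x (2 * a) with hSdef
  set D : Rn n → ℝ≥0∞ := fun y => ENNReal.ofReal (c₂ * (3 ^ p * (1 + C ^ p)) *
    ((W (u y) + ‖ε • g y‖ ^ p) + (W (v y) + ‖ε • h y‖ ^ p) + (η + (Cη + 1) * |u y - v y|)))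
    with hD
  have hQo : IsOpen Q := isOpen_rotatedCube T x ρ
  have hSm : ∀ y, y ∈ S ↔ cubeNorm T x y < ρ / 2 ∧ a ≤ cubeNorm T x y := fun y => by
    rw [hSdef, Set.mem_sdiff, hQdef, mem_rotatedCube, mem_rotatedCube, not_lt,
      mul_div_cancel_left₀ _ two_ne_zero]
  have hdc := continuous_cubeNorm T x
  obtain ⟨i, hiN, hi⟩ := exists_layer_le (μ := (volume : Measure (Rn n))) hdc.measurable D
    (S := S) hε hN fun y h1 h2 => (hSm y).2 ⟨by linarith, h1⟩
  set b : ℝ := a + i * ε with hb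
  have hab : a ≤ b := by have : 0 ≤ (i : ℝ) * ε := by positivity
                         linarith
  have hbρ : b + ε < ρ / 2 := by
    have : (i : ℝ) + 1 ≤ N := by exact_mod_cast hiN
    nlinarith
  obtain ⟨θ, hθ, hθI, hθ1, hθ0, hθg⟩ := hcut b ε hε
  have hts : tsupport θ ⊆ {y | cubeNorm T x y ≤ b + ε} := by
    refine closure_minimal (fun y hy => ?_) (isClosed_le hdc continuous_const)
    by_contra hne
    exact hy (hθ0 y (not_le.1 hne).le)
  have htsQ : tsupport θ ⊆ Q := fun y hy => mem_rotatedCube.2 ((hts hy).trans_lt hbρ)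
  have hθc : HasCompactSupport θ :=
    Metric.isCompact_of_isClosed_isBounded (isClosed_tsupport _)
      ((isBounded_rotatedCube T x ρ).subset htsQ)
  have hpair := hu.interpolate hp.le hQo.measurableSet hQo.measurableSet subset_rfl hv hθ hθI hθc
    htsQ
  have hUI : ∀ᵐ y ∂(volume.restrict Q), θ y * u y + (1 - θ y) * v y ∈ Icc (0 : ℝ) 1 := by
    filter_upwards [huI] with y hy
    obtain ⟨h1, h2⟩ := hy; obtain ⟨h3, h4⟩ := hvI y; obtain ⟨h5, h6⟩ := hθI y
    constructor <;> nlinarith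
  have hadm : (fun y => θ y * u y + (1 - θ y) * v y) ∈ admissible p v Q := by
    refine ⟨memW1p_iff.2 ⟨_, hpair⟩, hUI, {y | b + ε < cubeNorm T x y},
      isOpen_lt continuous_const hdc, fun y hy => ?_, ?_⟩
    · rw [mem_ofPred_eq, cubeNorm_eq_of_mem_frontier hy]; exact hbρ
    · filter_upwards [ae_restrict_mem
        (hQo.inter (isOpen_lt continuous_const hdc)).measurableSet] with y hy
      rw [hθ0 y (le_of_lt hy.2)]; ring
  refine (iInf₂_le _ hadm).trans ?_
  rw [energy_eq_gradEnergy hp.le hQo hpair hUI]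
  -- the cube is the union of the region inside the layer, the layer, and the region outside
  set A₁ := Q ∩ {y | cubeNorm T x y < b} with hA₁
  set A₂ := {y | b ≤ cubeNorm T x y ∧ cubeNorm T x y < b + ε} with hA₂
  set A₃ := Q ∩ {y | b + ε ≤ cubeNorm T x y} with hA₃
  have hcover : Q ⊆ A₁ ∪ (A₃ ∪ A₂) := fun y hy => by
    by_cases h1 : cubeNorm T x y < b
    · exact Or.inl ⟨hy, h1⟩
    · by_cases h2 : cubeNorm T x y < b + ε
      · exact Or.inr (Or.inr ⟨not_lt.1 h1, h2⟩)
      · exact Or.inr (Or.inl ⟨hy, not_lt.1 h2⟩)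
  have mA₁ : MeasurableSet A₁ :=
    hQo.measurableSet.inter (measurableSet_lt hdc.measurable measurable_const)
  have mA₂ : MeasurableSet A₂ := (measurableSet_le measurable_const hdc.measurable).inter
    (measurableSet_lt hdc.measurable measurable_const)
  have mA₃ : MeasurableSet A₃ :=
    hQo.measurableSet.inter (measurableSet_le measurable_const hdc.measurable)
  have hA₂Q : A₂ ⊆ Q := fun y hy => mem_rotatedCube.2 (hy.2.trans hbρ)
  rw [ae_restrict_iff' hQo.measurableSet] at huI
  unfold gradEnergy
  rw [← mul_add, ← mul_add]
  refine mul_le_mul_right ?_ _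
  refine (lintegral_mono_set hcover).trans ((lintegral_union_le _ _ _).trans ?_)
  rw [add_assoc]
  refine add_le_add ?_ ((lintegral_union_le _ _ _).trans (add_le_add ?_ (le_trans ?_ hi)))
  · refine le_trans (setLIntegral_mono' mA₁ fun y hy => ?_) (lintegral_mono_set inter_subset_left)
    have h1 := hθ1 y (le_of_lt hy.2)
    simp only [gradient_eq_zero_of_eq_one hθI h1, h1]
    simp
  · refine le_trans (setLIntegral_mono' mA₃ fun y hy => ?_)
      (lintegral_mono_set (t := S) fun y hy => ?_)
    · have h1 := hθ0 y hy.2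
      simp only [gradient_eq_zero_of_eq_zero hθI h1, h1]
      simp
    · have h2 : b + ε ≤ cubeNorm T x y := hy.2
      exact (hSm y).2 ⟨mem_rotatedCube.1 hy.1, by linarith⟩
  · refine setLIntegral_mono_ae' mA₂ ?_
    filter_upwards [huI] with y hy hyA
    exact ENNReal.ofReal_le_ofReal (layer_density_le hW hp hc₂ hf hη hCη hC hmod y
      (hy (hA₂Q hyA)) (hvI y) (hθI y) (hθg y))

end

/-! ### The upper bound: adjusting the boundary values of recovery sequences -/

section

variable {n : ℕ}

lemma exists_shell_subset [NeZero n] (T : Rn n ≃ₗᵢ[ℝ] Rn n) (x : Rn n) (ρ : ℝ) {U : Set (Rn n)}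
    (hU : IsOpen U) (hfU : frontier (rotatedCube T x ρ) ⊆ U) :
    ∃ b < ρ / 2, ∀ a, b < a →
      rotatedCube T x ρ \ rotatedCube T x (2 * a) ⊆ rotatedCube T x ρ ∩ U := by
  have hK : IsCompact (closure (rotatedCube T x ρ) \ U) :=
    (isBounded_rotatedCube T x ρ).isCompact_closure.diff hU
  have hKQ : ∀ y ∈ closure (rotatedCube T x ρ) \ U, cubeNorm T x y < ρ / 2 := fun y hy => by
    rw [← mem_rotatedCube]
    by_contra hyQ
    exact hy.2 (hfU ⟨hy.1, by rwa [(isOpen_rotatedCube T x ρ).interior_eq]⟩)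
  have : ∃ b < ρ / 2, ∀ y ∈ closure (rotatedCube T x ρ) \ U, cubeNorm T x y ≤ b := by
    rcases (closure (rotatedCube T x ρ) \ U).eq_empty_or_nonempty with he | hne
    · exact ⟨ρ / 2 - 1, by linarith, by simp [he]⟩
    · obtain ⟨z, hz, hmax⟩ := hK.exists_isMaxOn hne (continuous_cubeNorm T x).continuousOn
      exact ⟨_, hKQ z hz, fun y hy => hmax hy⟩
  obtain ⟨b, hb, hb'⟩ := this
  refine ⟨b, hb, fun a ha y hy => ⟨hy.1, ?_⟩⟩
  by_contra hyU
  refine hy.2 (mem_rotatedCube.2 ?_)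
  rw [mul_div_cancel_left₀ _ two_ne_zero]
  exact (hb' y ⟨subset_closure hy.1, hyU⟩).trans_lt ha

lemma aemeasurable_model {W : ℝ → ℝ} (hW : IsDoubleWell W) {p : ℝ} {A S : Set (Rn n)}
    {u : Rn n → ℝ} {g : Rn n → Rn n} (hu : IsSobolevPair p A u g) (hSA : S ⊆ A) (ε : ℝ) :
    AEMeasurable (fun y => ENNReal.ofReal (W (u y) + ‖ε • g y‖ ^ p)) (volume.restrict S) := by
  have h1 : AEMeasurable u (volume.restrict S) :=
    hu.memLp.aestronglyMeasurable.aemeasurable.mono_measure (Measure.restrict_mono hSA le_rfl)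
  have h2 : AEMeasurable g (volume.restrict S) :=
    hu.memLp_grad.aestronglyMeasurable.aemeasurable.mono_measure (Measure.restrict_mono hSA le_rfl)
  exact ((hW.continuous.measurable.comp_aemeasurable h1).add
    ((h2.const_smul ε).norm.pow_const p)).ennreal_ofReal

/-- The cost of a transition, in terms of the energies of the two functions and of their
distance. -/
lemma layer_cost_le {W : ℝ → ℝ} (hW : IsDoubleWell W) {p K η c ε : ℝ} (hK : 0 ≤ K) (hη : 0 ≤ η)
    (hc : 0 ≤ c) {Q S : Set (Rn n)} (hSQ : S ⊆ Q) {u v : Rn n → ℝ} {g h : Rn n → Rn n}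
    (hu : IsSobolevPair p Q u g) (hv : IsSobolevPair p Q v h) (θ : ℝ≥0∞) :
    ENNReal.ofReal (1 / ε) * (θ * ∫⁻ y in S,
        ENNReal.ofReal (K * ((W (u y) + ‖ε • g y‖ ^ p) + (W (v y) + ‖ε • h y‖ ^ p)
          + (η + c * |u y - v y|))))
      ≤ ENNReal.ofReal K * (θ * (gradEnergy (modelIntegrand W p) ε Q u g
          + gradEnergy (modelIntegrand W p) ε Q v h)
        + ENNReal.ofReal (1 / ε) * θ * (ENNReal.ofReal η * volume Q
          + ENNReal.ofReal c * ∫⁻ y in S, ‖u y - v y‖ₑ)) := by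
  have e : ∫⁻ y in S, ENNReal.ofReal (K * ((W (u y) + ‖ε • g y‖ ^ p)
        + (W (v y) + ‖ε • h y‖ ^ p) + (η + c * |u y - v y|)))
      = ENNReal.ofReal K * ((∫⁻ y in S, ENNReal.ofReal (W (u y) + ‖ε • g y‖ ^ p))
        + (∫⁻ y in S, ENNReal.ofReal (W (v y) + ‖ε • h y‖ ^ p))
        + (ENNReal.ofReal η * volume S + ENNReal.ofReal c * ∫⁻ y in S, ‖u y - v y‖ₑ)) := by
    rw [← lintegral_const_mul' _ _ ENNReal.ofReal_ne_top, ← setLIntegral_const,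
      ← lintegral_add_left measurable_const, ← lintegral_add_left' (aemeasurable_model hW hu hSQ ε),
      ← lintegral_add_left' (f := fun y => ENNReal.ofReal (W (u y) + ‖ε • g y‖ ^ p)
        + ENNReal.ofReal (W (v y) + ‖ε • h y‖ ^ p))
        ((aemeasurable_model hW hu hSQ ε).add (aemeasurable_model hW hv hSQ ε)),
      ← lintegral_const_mul' _ _ ENNReal.ofReal_ne_top]
    refine lintegral_congr fun y => ?_
    have w1 := hW.nonneg (u y)
    have w2 := hW.nonneg (v y)
    rw [← ofReal_norm, Real.norm_eq_abs, ← ENNReal.ofReal_mul hc,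
      ← ENNReal.ofReal_add hη (by positivity), ← ENNReal.ofReal_add (by positivity) (by positivity),
      ← ENNReal.ofReal_add (by positivity) (by positivity), ← ENNReal.ofReal_mul hK]
  rw [e]
  set o := ENNReal.ofReal (1 / ε)
  have m1 : (∫⁻ y in S, ENNReal.ofReal (W (u y) + ‖ε • g y‖ ^ p))
      ≤ ∫⁻ y in Q, ENNReal.ofReal (W (u y) + ‖ε • g y‖ ^ p) := lintegral_mono_set hSQ
  have m2 : (∫⁻ y in S, ENNReal.ofReal (W (v y) + ‖ε • h y‖ ^ p))
      ≤ ∫⁻ y in Q, ENNReal.ofReal (W (v y) + ‖ε • h y‖ ^ p) := lintegral_mono_set hSQ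
  have m3 : volume S ≤ volume Q := measure_mono hSQ
  calc _ ≤ o * (θ * (ENNReal.ofReal K * ((∫⁻ y in Q, ENNReal.ofReal (W (u y) + ‖ε • g y‖ ^ p))
        + (∫⁻ y in Q, ENNReal.ofReal (W (v y) + ‖ε • h y‖ ^ p))
        + (ENNReal.ofReal η * volume Q + ENNReal.ofReal c * ∫⁻ y in S, ‖u y - v y‖ₑ)))) := by
        gcongr
    _ = _ := by
        simp only [gradEnergy, modelIntegrand]
        ring

lemma exists_floor_bounds {δ ε : ℝ} (hε : 0 < ε) (hεδ : ε ≤ δ / 2) :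
    ⌊δ / ε⌋₊ ≠ 0 ∧ ⌊δ / ε⌋₊ * ε ≤ δ ∧
      ENNReal.ofReal (1 / ε) * ((⌊δ / ε⌋₊ : ℕ) : ℝ≥0∞)⁻¹ ≤ ENNReal.ofReal (2 / δ) := by
  have hδ : 0 < δ := by linarith
  have h1 : (⌊δ / ε⌋₊ : ℝ) ≤ δ / ε := Nat.floor_le (by positivity)
  have h2 : δ / ε < ⌊δ / ε⌋₊ + 1 := Nat.lt_floor_add_one _
  rw [le_div_iff₀ hε] at h1
  rw [div_lt_iff₀ hε] at h2
  have h3 : δ / 2 ≤ ⌊δ / ε⌋₊ * ε := by linarith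
  have h4 : (0 : ℝ) < ⌊δ / ε⌋₊ := by
    by_contra hne
    have : (⌊δ / ε⌋₊ : ℝ) = 0 := le_antisymm (not_lt.1 hne) (Nat.cast_nonneg _)
    rw [this] at h3; linarith
  refine ⟨fun h => by rw [h] at h4; simp at h4, h1, ?_⟩
  rw [← ENNReal.ofReal_natCast, ← ENNReal.ofReal_inv_of_pos h4,
    ← ENNReal.ofReal_mul (by positivity)]
  refine ENNReal.ofReal_le_ofReal ?_
  rw [one_div, ← mul_inv, mul_comm, inv_le_comm₀ (by positivity) (by positivity), inv_div]
  exact h3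

lemma lintegral_enorm_sub_le {A : Set (Rn n)} {a b c : Rn n → ℝ}
    (ha : AEStronglyMeasurable a (volume.restrict A))
    (hb : AEStronglyMeasurable b (volume.restrict A)) :
    ∫⁻ y in A, ‖a y - c y‖ₑ ≤ (∫⁻ y in A, ‖a y - b y‖ₑ) + ∫⁻ y in A, ‖b y - c y‖ₑ := by
  rw [← lintegral_add_left' (f := fun y => ‖a y - b y‖ₑ) (ha.sub hb).enorm]
  refine lintegral_mono fun y => ?_
  rw [← sub_add_sub_cancel (a y) (b y) (c y)]
  exact enorm_add_le _ _

lemma measurable_jumpFun (x : Rn n) (ν : Sph n) : Measurable (jumpFun x ν) := by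
  unfold jumpFun
  refine (measurable_const (a := (1 : ℝ))).indicator ?_
  exact (isClosed_le continuous_const (by fun_prop)).measurableSet

variable [NeZero n]

/-- Upper bound: the minima with regularised boundary values do not exceed, in the limit, the
minimum of the `Γ`-limit. -/
theorem limsup_minEnergy_le_minSurface {W w : ℝ → ℝ} (hW : IsDoubleWell W) (hw : IsProfile w)
    {p c₁ c₂ : ℝ} (hp : 1 < p) (hc₁ : 0 < c₁) (hc : c₁ ≤ c₂) {ε : ℕ → ℝ} (hε : ∀ j, 0 < ε j)
    (hε0 : Tendsto ε atTop (𝓝 0)) {f : ℕ → Rn n → ℝ → Rn n → ℝ}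
    (hf : ∀ j, IsIntegrand W p c₁ c₂ (f j)) {T : Rn n ≃ₗᵢ[ℝ] Rn n} {ν : Sph n} {k : Fin n}
    (hT : T (EuclideanSpace.single k (1 : ℝ)) = (ν : Rn n)) (x : Rn n) {ρ : ℝ} (hρ : 0 < ρ)
    (G : (Rn n → ℝ) → Set (Rn n) → ℝ≥0∞)
    (hG : GammaConvergesL1 (rotatedCube T x ρ)
      (fun j u => energy p (ε j) (f j) u (rotatedCube T x ρ)) (fun u => G u (rotatedCube T x ρ))) :
    limsup (fun j => minEnergy p (ε j) (f j) (regJump w (ε j) x ν) (rotatedCube T x ρ)) atTop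
      ≤ minSurface G (jumpFun x ν) (rotatedCube T x ρ) := by
  have hc₂ : 0 ≤ c₂ := hc₁.le.trans hc
  set Q := rotatedCube T x ρ with hQ
  have hQo : IsOpen Q := isOpen_rotatedCube T x ρ
  have hQb : Bornology.IsBounded Q := isBounded_rotatedCube T x ρ
  have hQv : volume Q ≠ ⊤ := hQb.measure_lt_top.ne
  refine le_iInf₂ fun u hu => ?_
  obtain ⟨hul, -, -, U, hU, hfU, hae⟩ := hu
  by_cases hGu : G u Q = ⊤
  · rw [hGu]; exact le_top
  obtain ⟨z, hzl, hz, hzsup⟩ := (hG u hul).2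
  obtain ⟨M, hM, hreg⟩ := exists_gradEnergy_regJump_le (n := n) (c₁ := c₁) hp hc₂ hW hw
  obtain ⟨K, hK, hjoin⟩ := exists_join hW (c₁ := c₁) hp hc₂ T x
  refine ENNReal.le_of_forall_pos_le_add fun τ hτ _ => ?_
  -- the width of the shell in which the boundary values are adjusted
  obtain ⟨b, hb, hshell⟩ := exists_shell_subset T x ρ hU hfU
  have hτ' : (0 : ℝ) < τ := hτ
  obtain ⟨a, ha0, hab, haρ, haτ⟩ : ∃ a, 0 < a ∧ b < a ∧ a < ρ / 2 ∧
      2 * M * (ρ ^ (n - 1) - (2 * a) ^ (n - 1)) < τ / 3 := by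
    have hcont : Tendsto (fun a : ℝ => 2 * M * (ρ ^ (n - 1) - (2 * a) ^ (n - 1)))
        (𝓝[<] (ρ / 2)) (𝓝 (2 * M * (ρ ^ (n - 1) - (2 * (ρ / 2)) ^ (n - 1)))) :=
      (Continuous.tendsto (by fun_prop) _).mono_left nhdsWithin_le_nhds
    rw [mul_div_cancel₀ _ two_ne_zero, sub_self, mul_zero] at hcont
    have h1 := hcont.eventually (gt_mem_nhds (show (0 : ℝ) < τ / 3 by positivity))
    have h2 : ∀ᶠ a in 𝓝[<] (ρ / 2), max 0 b < a :=
      mem_nhdsWithin_of_mem_nhds (lt_mem_nhds (max_lt (by positivity) hb))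
    obtain ⟨a, h3, h4, h5⟩ := (h1.and (h2.and self_mem_nhdsWithin)).exists
    exact ⟨a, (le_max_left _ _).trans_lt h4, (le_max_right _ _).trans_lt h4, h5, h3⟩
  set S := Q \ rotatedCube T x (2 * a) with hS
  set δ : ℝ := (ρ / 2 - a) / 2 with hδ
  have hδ0 : 0 < δ := by rw [hδ]; linarith
  obtain ⟨η, hη, hητ⟩ : ∃ η : ℝ, 0 < η ∧ K * (2 / δ * (η * (volume Q).toReal)) < τ / 3 := by
    refine ⟨τ / 3 / (K * (2 / δ * (volume Q).toReal) + 1), by positivity, ?_⟩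
    rw [show K * (2 / δ * (τ / 3 / (K * (2 / δ * (volume Q).toReal) + 1) * (volume Q).toReal))
      = τ / 3 * (K * (2 / δ * (volume Q).toReal) / (K * (2 / δ * (volume Q).toReal) + 1)) by ring]
    refine mul_lt_of_lt_one_right (by positivity) ?_
    rw [div_lt_one (by positivity)]
    linarith
  obtain ⟨Cη, hCη, hmod⟩ := hW.exists_modulus hη
  -- in the shell the limit is the jump function, so both sequences converge to it there
  have hI : Tendsto (fun j => ∫⁻ y in S, ‖z j y - regJump w (ε j) x ν y‖ₑ) atTop (𝓝 0) := by
    have hub : Tendsto (fun j => (∫⁻ y in Q, ‖z j y - u y‖ₑ)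
        + ENNReal.ofReal (2 * ε j * ρ ^ (n - 1))) atTop (𝓝 0) := by
      have h1 : Tendsto (fun j => ENNReal.ofReal (2 * ε j * ρ ^ (n - 1))) atTop (𝓝 0) := by
        have := ENNReal.tendsto_ofReal ((hε0.const_mul 2).mul_const (ρ ^ (n - 1)))
        simpa using this
      simpa using hz.add h1
    refine tendsto_of_tendsto_of_tendsto_of_le_of_le tendsto_const_nhds hub
      (fun j => zero_le) fun j => ?_
    have hSQ : S ⊆ Q := sdiff_subset
    have m1 : AEStronglyMeasurable (z j) (volume.restrict S) :=
      (hzl j).aestronglyMeasurable.mono_measure Measure.restrict_le_self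
    have m2 : AEStronglyMeasurable u (volume.restrict S) :=
      hul.aestronglyMeasurable.mono_measure Measure.restrict_le_self
    refine (lintegral_enorm_sub_le m1 m2).trans (add_le_add (lintegral_mono_set hSQ) ?_)
    have h1 : ∫⁻ y in S, ‖u y - regJump w (ε j) x ν y‖ₑ
        = ∫⁻ y in S, ‖regJump w (ε j) x ν y - jumpFun x ν y‖ₑ := by
      refine lintegral_congr_ae ?_
      filter_upwards [ae_restrict_of_ae_restrict_of_subset (hshell a hab) hae] with y hy
      rw [hy, enorm_sub_rev]
    rw [h1]
    exact (lintegral_mono_set hSQ).trans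
      (lintegral_regJump_sub_jumpFun_le hw hT x hρ.le (hε j))
  set E : ℝ≥0∞ := ENNReal.ofReal (1 / c₁) * (G u Q + (τ / 3 : NNReal))
    + ENNReal.ofReal (1 / c₁) * ENNReal.ofReal (2 * M * ρ ^ (n - 1)) with hE
  have hEtop : E ≠ ⊤ := ENNReal.add_ne_top.2
    ⟨ENNReal.mul_ne_top ENNReal.ofReal_ne_top (ENNReal.add_ne_top.2 ⟨hGu, ENNReal.coe_ne_top⟩),
      ENNReal.mul_ne_top ENNReal.ofReal_ne_top ENNReal.ofReal_ne_top⟩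
  have hcost : Tendsto (fun j => ENNReal.ofReal K * (((⌊δ / ε j⌋₊ : ℕ) : ℝ≥0∞)⁻¹ * E
      + ENNReal.ofReal (2 / δ) * (ENNReal.ofReal η * volume Q
        + ENNReal.ofReal (Cη + 1) * ∫⁻ y in S, ‖z j y - regJump w (ε j) x ν y‖ₑ))) atTop
      (𝓝 (ENNReal.ofReal K * (0 * E + ENNReal.ofReal (2 / δ) * (ENNReal.ofReal η * volume Q
        + ENNReal.ofReal (Cη + 1) * 0)))) := by
    have hN : Tendsto (fun j => ⌊δ / ε j⌋₊) atTop atTop := by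
      refine tendsto_nat_floor_atTop.comp ?_
      have : Tendsto ε atTop (𝓝[>] 0) :=
        tendsto_nhdsWithin_iff.2 ⟨hε0, Eventually.of_forall hε⟩
      simp only [div_eq_mul_inv]
      exact (tendsto_inv_nhdsGT_zero.comp this).const_mul_atTop hδ0
    have hN' := ENNReal.tendsto_inv_nat_nhds_zero.comp hN
    refine ENNReal.Tendsto.const_mul (Tendsto.add (ENNReal.Tendsto.mul_const hN' (Or.inr hEtop))
      (ENNReal.Tendsto.const_mul (tendsto_const_nhds.add (ENNReal.Tendsto.const_mul hI
        (Or.inr ENNReal.ofReal_ne_top))) (Or.inr ENNReal.ofReal_ne_top)))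
        (Or.inr ENNReal.ofReal_ne_top)
  have hlim : ENNReal.ofReal K * (0 * E + ENNReal.ofReal (2 / δ) * (ENNReal.ofReal η * volume Q
        + ENNReal.ofReal (Cη + 1) * 0)) < (τ / 3 : NNReal) := by
    rw [zero_mul, zero_add, mul_zero, add_zero, ← ENNReal.ofReal_toReal hQv,
      ← ENNReal.ofReal_mul hη.le, ← ENNReal.ofReal_mul (by positivity), ← ENNReal.ofReal_mul hK,
      ← ENNReal.ofReal_coe_nnreal]
    refine (ENNReal.ofReal_lt_ofReal_iff (by positivity)).2 ?_
    simpa using hητ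
  have hGlt : limsup (fun j => energy p (ε j) (f j) (z j) Q) atTop < G u Q + (τ / 3 : NNReal) :=
    hzsup.trans_lt (ENNReal.lt_add_right hGu (by simpa using hτ.ne'))
  have hεa : ∀ᶠ j in atTop, ε j < a := hε0.eventually (gt_mem_nhds ha0)
  have hεδ : ∀ᶠ j in atTop, ε j < δ / 2 := hε0.eventually (gt_mem_nhds (by positivity))
  refine limsup_le_of_le (by isBoundedDefault) ?_
  filter_upwards [eventually_lt_of_limsup_lt hGlt, hcost.eventually (gt_mem_nhds hlim), hεa, hεδ]
    with j h1 h2 h3 h4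
  obtain ⟨g, hg, hzI, hzE⟩ := exists_isSobolevPair_of_energy_ne_top (ne_top_of_lt h1)
  have hvp : IsSobolevPair p Q (regJump w (ε j) x ν) (gradient (regJump w (ε j) x ν)) :=
    isSobolevPair_of_contDiff hQb (contDiff_regJump hw (ε j) x ν)
  obtain ⟨hN0, hNδ, hNinv⟩ := exists_floor_bounds (hε j) h4.le
  have hj := hjoin (hf j) hη.le hCη hmod (hε j) hN0
    (by rw [hδ] at hNδ ⊢; linarith : a + ⌊δ / ε j⌋₊ * ε j < ρ / 2) hg hvp hzI
    (fun y => hw.mem_Icc _)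
  have hSm : MeasurableSet S :=
    hQo.measurableSet.diff (isOpen_rotatedCube T x (2 * a)).measurableSet
  have t1 : gradEnergy (f j) (ε j) Q (z j) g ≤ G u Q + (τ / 3 : NNReal) := hzE ▸ h1.le
  have t2 : gradEnergy (f j) (ε j) S (regJump w (ε j) x ν) (gradient (regJump w (ε j) x ν))
      ≤ (τ / 3 : NNReal) := by
    refine (hreg (f j) (hf j) (ε j) (hε j) x ν S hSm).trans ((ofReal_mul_volume_le hM (hε j)
      (volume_shell_inter_slab hT x (by linarith) (hε j).le
        (by rwa [mul_div_cancel_left₀ _ two_ne_zero]))).trans ?_)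
    rw [← ENNReal.ofReal_coe_nnreal]
    refine ENNReal.ofReal_le_ofReal ?_
    simpa using haτ.le
  have t3 : gradEnergy (f j) (ε j) Q (regJump w (ε j) x ν) (gradient (regJump w (ε j) x ν))
      ≤ ENNReal.ofReal (2 * M * ρ ^ (n - 1)) :=
    (hreg (f j) (hf j) (ε j) (hε j) x ν Q hQo.measurableSet).trans
      (ofReal_mul_volume_le hM (hε j) (volume_cube_inter_slab hT x hρ.le (hε j).le))
  have t4 : gradEnergy (modelIntegrand W p) (ε j) Q (z j) g
      + gradEnergy (modelIntegrand W p) (ε j) Q (regJump w (ε j) x ν)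
        (gradient (regJump w (ε j) x ν)) ≤ E :=
    add_le_add ((gradEnergy_model_le hc₁ (hf j) _ _ _ _).trans (mul_le_mul_right t1 _))
      ((gradEnergy_model_le hc₁ (hf j) _ _ _ _).trans (mul_le_mul_right t3 _))
  have t5 := layer_cost_le hW hK hη.le (by positivity : 0 ≤ Cη + 1) (sdiff_subset : S ⊆ Q) hg hvp
    (ε := ε j) ((⌊δ / ε j⌋₊ : ℕ) : ℝ≥0∞)⁻¹
  have t6 : ENNReal.ofReal K * (((⌊δ / ε j⌋₊ : ℕ) : ℝ≥0∞)⁻¹ * (gradEnergy (modelIntegrand W p)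
        (ε j) Q (z j) g + gradEnergy (modelIntegrand W p) (ε j) Q (regJump w (ε j) x ν)
        (gradient (regJump w (ε j) x ν)))
      + ENNReal.ofReal (1 / ε j) * ((⌊δ / ε j⌋₊ : ℕ) : ℝ≥0∞)⁻¹ * (ENNReal.ofReal η * volume Q
        + ENNReal.ofReal (Cη + 1) * ∫⁻ y in S, ‖z j y - regJump w (ε j) x ν y‖ₑ))
      ≤ (τ / 3 : NNReal) := by
    refine le_trans ?_ h2.le
    gcongr
  refine hj.trans ((add_le_add (add_le_add t1 t2) (t5.trans t6)).trans (le_of_eq ?_))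
  rw [add_assoc, add_assoc, ← ENNReal.coe_add, ← ENNReal.coe_add, ← add_assoc, add_thirds]

end

/-! ### Mollification -/

section

variable {n : ℕ}

/-- The mollification `y ↦ ∫ V(t) η(y - t) dt` of `V` by a normalised bump function. -/
def mollify (φ : ContDiffBump (0 : Rn n)) (V : Rn n → ℝ) : Rn n → ℝ :=
  convolution V (φ.normed volume) (ContinuousLinearMap.lsmul ℝ ℝ) volume

lemma mollify_apply (φ : ContDiffBump (0 : Rn n)) (V : Rn n → ℝ) (x : Rn n) :
    mollify φ V x = ∫ t, V t * φ.normed volume (x - t) := by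
  simp [mollify, convolution_def]

lemma contDiff_mollify (φ : ContDiffBump (0 : Rn n)) {V : Rn n → ℝ} (hV : LocallyIntegrable V) :
    ContDiff ℝ 1 (mollify φ V) :=
  φ.hasCompactSupport_normed.contDiff_convolution_right _ hV
    (ContDiffBump.contDiff_normed φ (n := 1))

lemma lintegral_normed (φ : ContDiffBump (0 : Rn n)) :
    ∫⁻ x, ENNReal.ofReal (φ.normed volume x) = 1 := by
  rw [← ofReal_integral_eq_lintegral_ofReal φ.integrable_normed
    (Eventually.of_forall fun x => φ.nonneg_normed x), φ.integral_normed, ENNReal.ofReal_one]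

lemma mollify_mem_Icc (φ : ContDiffBump (0 : Rn n)) {V : Rn n → ℝ} (hV : LocallyIntegrable V)
    (hI : ∀ᵐ x, V x ∈ Icc (0 : ℝ) 1) (x : Rn n) : mollify φ V x ∈ Icc (0 : ℝ) 1 := by
  have i1 : Integrable fun t => φ.normed volume (x - t) := φ.integrable_normed.comp_sub_left x
  have i2 : Integrable fun t => V t * φ.normed volume (x - t) := by
    refine locallyIntegrable_integrable_mul hV (φ.continuous_normed.comp (by fun_prop)) ?_
    exact φ.hasCompactSupport_normed.comp_homeomorph (Homeomorph.subLeft x)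
  rw [mollify_apply]
  refine ⟨integral_nonneg_of_ae ?_, ?_⟩
  · filter_upwards [hI] with t ht using mul_nonneg ht.1 (φ.nonneg_normed _)
  · rw [← φ.integral_normed (μ := volume),
      ← integral_sub_left_eq_self (fun t => φ.normed volume t) volume x]
    refine integral_mono_ae i2 i1 ?_
    filter_upwards [hI] with t ht using mul_le_of_le_one_left (φ.nonneg_normed _) ht.2

/-- The gradient of a mollification is controlled by the average of the norm of the weak
gradient. -/
lemma enorm_fderiv_mollify_le {p : ℝ} {B : Set (Rn n)} (hB : MeasurableSet B)
    {V : Rn n → ℝ} {H : Rn n → Rn n} (h : IsSobolevPair p B V H) (φ : ContDiffBump (0 : Rn n))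
    (hV : LocallyIntegrable (B.indicator V)) {x : Rn n}
    (hx : Metric.closedBall x φ.rOut ⊆ B) :
    ‖fderiv ℝ (mollify φ (B.indicator V)) x‖ₑ
      ≤ ∫⁻ t in B, ENNReal.ofReal (φ.normed volume (x - t)) * ‖H t‖ₑ := by
  set ψ : Rn n → ℝ := fun t => φ.normed volume (x - t) with hψ
  have hφd : ContDiff ℝ ∞ (φ.normed (volume : Measure (Rn n))) := φ.contDiff_normed (n := ⊤)
  have hψd : ContDiff ℝ ∞ ψ := hφd.comp (contDiff_const.sub contDiff_id)
  have hψc : HasCompactSupport ψ :=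
    φ.hasCompactSupport_normed.comp_homeomorph (Homeomorph.subLeft x)
  have hψB : tsupport ψ ⊆ B := by
    refine subset_trans (closure_minimal (fun t ht => ?_) Metric.isClosed_closedBall) hx
    have h1 : x - t ∈ Metric.ball (0 : Rn n) φ.rOut := by
      rw [← φ.support_normed_eq (μ := volume)]; exact ht
    rw [mem_closedBall_iff_norm']
    exact (mem_ball_zero_iff.1 h1).le
  have hderiv : ∀ v, fderiv ℝ (mollify φ (B.indicator V)) x v
      = ∫ t in B, ψ t * inner ℝ (H t) v := fun v => by
    have h1 := (φ.hasCompactSupport_normed.hasFDerivAt_convolution_right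
      (ContinuousLinearMap.lsmul ℝ ℝ) hV (hφd.of_le (by exact_mod_cast le_top)) x).fderiv
    rw [mollify, h1, convolution_precompR_apply _ hV (φ.hasCompactSupport_normed.fderiv (𝕜 := ℝ))
      ((hφd.of_le (by exact_mod_cast le_top) : ContDiff ℝ 1 _).continuous_fderiv one_ne_zero),
      convolution_def]
    have h2 : ∀ t, fderiv ℝ ψ t v = - fderiv ℝ (φ.normed volume) (x - t) v := fun t => by
      have : HasFDerivAt ψ (-(fderiv ℝ (φ.normed volume) (x - t))) t := by
        have h3 := (hφd.differentiable (by simp) (x - t)).hasFDerivAt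
        have h4 := h3.comp t ((hasFDerivAt_id t).const_sub x)
        refine h4.congr_fderiv ?_
        ext z; simp
      rw [this.fderiv]; rfl
    have h3 := h.isWeakGradient ψ hψd hψc hψB v
    rw [← neg_eq_iff_eq_neg] at h3
    rw [← h3, ← integral_neg, ← integral_indicator hB]
    refine integral_congr_ae (Eventually.of_forall fun t => ?_)
    by_cases ht : t ∈ B
    · simp [ht, h2]
    · simp [ht]
  refine ContinuousLinearMap.opENorm_le_bound _ fun v => ?_
  rw [hderiv v]
  refine (enorm_integral_le_lintegral_enorm _).trans ?_
  rw [← lintegral_mul_const' _ _ enorm_ne_top]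
  refine lintegral_mono fun t => ?_
  rw [enorm_mul, mul_assoc, ← ofReal_norm (ψ t), Real.norm_of_nonneg (φ.nonneg_normed _)]
  refine mul_le_mul_right ?_ _
  rw [← ofReal_norm, ← ofReal_norm, ← ofReal_norm, ← ENNReal.ofReal_mul (norm_nonneg _)]
  exact ENNReal.ofReal_le_ofReal (norm_inner_le_norm _ _)

/-- Jensen's inequality for the averages in `enorm_fderiv_mollify_le`. -/
lemma lintegral_normed_mul_rpow_le {p : ℝ} (hp : 1 ≤ p) (φ : ContDiffBump (0 : Rn n))
    {F : Rn n → ℝ≥0∞} (hF : AEMeasurable F) (x : Rn n) :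
    (∫⁻ t, ENNReal.ofReal (φ.normed volume (x - t)) * F t) ^ p
      ≤ ∫⁻ t, ENNReal.ofReal (φ.normed volume (x - t)) * F t ^ p := by
  have hk : AEMeasurable (fun t : Rn n => ENNReal.ofReal (φ.normed volume (x - t))) :=
    (φ.continuous_normed.comp
      (by fun_prop : Continuous fun t : Rn n => x - t)).measurable.ennreal_ofReal.aemeasurable
  set μ : Measure (Rn n) := volume.withDensity fun t => ENNReal.ofReal (φ.normed volume (x - t))
    with hμ
  have hprob : IsProbabilityMeasure μ := ⟨by
    rw [hμ, withDensity_apply _ MeasurableSet.univ, Measure.restrict_univ,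
      lintegral_sub_left_eq_self (fun t => ENNReal.ofReal (φ.normed volume t)) x,
      lintegral_normed]⟩
  have hF' : AEMeasurable F μ := hF.mono_ac (withDensity_absolutelyContinuous _ _)
  have e : ∀ q : ℝ, ∫⁻ t, F t ^ q ∂μ = ∫⁻ t, ENNReal.ofReal (φ.normed volume (x - t)) * F t ^ q :=
    fun q => lintegral_withDensity_eq_lintegral_mul₀ hk (hF.pow_const q)
  have key := eLpNorm'_le_eLpNorm'_of_exponent_le zero_lt_one hp μ hF'.aestronglyMeasurable
  simp only [eLpNorm', enorm_eq_self, ENNReal.rpow_one, div_one] at key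
  have e1 := e 1
  simp only [ENNReal.rpow_one] at e1
  rw [e1, e p] at key
  have := ENNReal.rpow_le_rpow key (zero_le_one.trans hp)
  rwa [← ENNReal.rpow_mul, one_div, inv_mul_cancel₀ (by linarith), ENNReal.rpow_one] at this

lemma lintegral_enorm_fderiv_mollify_le {p : ℝ} (hp : 1 ≤ p) {B K : Set (Rn n)}
    (hB : MeasurableSet B)
    {V : Rn n → ℝ} {H : Rn n → Rn n} (h : IsSobolevPair p B V H) (φ : ContDiffBump (0 : Rn n))
    (hV : LocallyIntegrable (B.indicator V)) (hK : MeasurableSet K)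
    (hKB : ∀ x ∈ K, Metric.closedBall x φ.rOut ⊆ B) :
    ∫⁻ x in K, ‖fderiv ℝ (mollify φ (B.indicator V)) x‖ₑ ^ p ≤ ∫⁻ t in B, ‖H t‖ₑ ^ p := by
  have hH : AEMeasurable (B.indicator fun t => ‖H t‖ₑ) :=
    (aemeasurable_indicator_iff hB).2 h.memLp_grad.aestronglyMeasurable.enorm
  have e : ∀ t, (B.indicator (fun t => ‖H t‖ₑ) t) ^ p = B.indicator (fun t => ‖H t‖ₑ ^ p) t :=
    fun t => by
      by_cases ht : t ∈ B
      · simp [ht]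
      · simp [ht, ENNReal.zero_rpow_of_pos (by linarith : 0 < p)]
  calc ∫⁻ x in K, ‖fderiv ℝ (mollify φ (B.indicator V)) x‖ₑ ^ p
      ≤ ∫⁻ x in K, ∫⁻ t, ENNReal.ofReal (φ.normed volume (x - t))
          * (B.indicator (fun t => ‖H t‖ₑ) t) ^ p := by
        refine setLIntegral_mono' hK fun x hx => ?_
        refine le_trans (ENNReal.rpow_le_rpow ((enorm_fderiv_mollify_le hB h φ hV
          (hKB x hx)).trans (le_of_eq ?_)) (by linarith)) (lintegral_normed_mul_rpow_le hp φ hH x)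
        rw [← lintegral_indicator hB]
        refine lintegral_congr fun t => ?_
        by_cases ht : t ∈ B <;> simp [ht]
    _ ≤ ∫⁻ x, ∫⁻ t, ENNReal.ofReal (φ.normed volume (x - t))
          * (B.indicator (fun t => ‖H t‖ₑ) t) ^ p := setLIntegral_le_lintegral _ _
    _ = ∫⁻ t, ∫⁻ x, ENNReal.ofReal (φ.normed volume (x - t))
          * (B.indicator (fun t => ‖H t‖ₑ) t) ^ p := by
        refine lintegral_lintegral_swap ?_
        refine AEMeasurable.mul ?_ ?_
        · exact (φ.continuous_normed.comp (continuous_fst.sub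
            continuous_snd)).measurable.ennreal_ofReal.aemeasurable
        · exact (hH.pow_const p).comp_snd
    _ = ∫⁻ t, (B.indicator (fun t => ‖H t‖ₑ) t) ^ p := by
        refine lintegral_congr fun t => ?_
        have hm : Measurable fun x : Rn n => ENNReal.ofReal (φ.normed volume (x - t)) :=
          (φ.continuous_normed.comp (by fun_prop :
            Continuous fun x : Rn n => x - t)).measurable.ennreal_ofReal
        rw [lintegral_mul_const _ hm,
          lintegral_sub_right_eq_self (fun x => ENNReal.ofReal (φ.normed volume x)) t,
          lintegral_normed, one_mul]
    _ = ∫⁻ t in B, ‖H t‖ₑ ^ p := by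
        simp only [e]
        rw [lintegral_indicator hB]

/-- A family of bump functions that shrinks to the origin. -/
def bumpSeq (n : ℕ) (r : ℝ) (hr : 0 < r) (m : ℕ) : ContDiffBump (0 : Rn n) where
  rIn := r / (m + 1) / 2
  rOut := r / (m + 1)
  rIn_pos := by positivity
  rIn_lt_rOut := half_lt_self (by positivity)

lemma bumpSeq_rOut_le {r : ℝ} (hr : 0 < r) (m : ℕ) : (bumpSeq n r hr m).rOut ≤ r :=
  div_le_self hr.le (by linarith [(Nat.cast_nonneg m : (0 : ℝ) ≤ m)])

lemma ae_tendsto_mollify {r : ℝ} (hr : 0 < r) {V : Rn n → ℝ} (hV : LocallyIntegrable V) :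
    ∀ᵐ x, Tendsto (fun m => mollify (bumpSeq n r hr m) V x) atTop (𝓝 (V x)) := by
  have h1 : Tendsto (fun m : ℕ => (bumpSeq n r hr m).rOut) atTop (𝓝 0) := by
    have := (tendsto_one_div_add_atTop_nhds_zero_nat (𝕜 := ℝ)).const_mul r
    simpa [bumpSeq, div_eq_mul_inv] using this
  filter_upwards [ContDiffBump.ae_convolution_tendsto_right_of_locallyIntegrable
    (φ := fun m => bumpSeq n r hr m) (μ := volume) (K := 2) h1
    (Eventually.of_forall fun m => by simp only [bumpSeq]; linarith) hV] with x hx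
  refine hx.congr fun m => ?_
  rw [mollify_apply, convolution_lsmul_swap]
  exact integral_congr_ae (Eventually.of_forall fun t => by simp [mul_comm])

end

/-! ### The transformed variable `Φ(u)` and its translations -/

section

variable {n : ℕ}

/-- The primitive `Φ(t) = ∫₀ᵗ W^{1 - 1/p}`. By Young's inequality the rescaled energy of `u` bounds
the total variation of `Φ(u)` uniformly in the scale. -/
def wellPrimitive (W : ℝ → ℝ) (p t : ℝ) : ℝ := ∫ s in (0 : ℝ)..t, W s ^ (1 - 1 / p)

lemma one_sub_inv_pos {p : ℝ} (hp : 1 < p) : 0 < 1 - 1 / p := by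
  rw [sub_pos, div_lt_one (by linarith)]; exact hp

lemma hasDerivAt_wellPrimitive {W : ℝ → ℝ} (hW : IsDoubleWell W) {p : ℝ} (hp : 1 < p) (t : ℝ) :
    HasDerivAt (wellPrimitive W p) (W t ^ (1 - 1 / p)) t := by
  have hc : Continuous fun s => W s ^ (1 - 1 / p) :=
    hW.continuous.rpow_const fun s => Or.inr (one_sub_inv_pos hp).le
  exact intervalIntegral.integral_hasDerivAt_right (hc.intervalIntegrable _ _)
    (hc.stronglyMeasurableAtFilter _ _) hc.continuousAt

lemma continuous_wellPrimitive {W : ℝ → ℝ} (hW : IsDoubleWell W) {p : ℝ} (hp : 1 < p) :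
    Continuous (wellPrimitive W p) :=
  continuous_iff_continuousAt.2 fun t => (hasDerivAt_wellPrimitive hW hp t).continuousAt

lemma strictMonoOn_wellPrimitive {W : ℝ → ℝ} (hW : IsDoubleWell W) {p : ℝ} (hp : 1 < p) :
    StrictMonoOn (wellPrimitive W p) (Icc 0 1) := by
  refine strictMonoOn_of_deriv_pos (convex_Icc 0 1) (continuous_wellPrimitive hW hp).continuousOn
    fun t ht => ?_
  rw [interior_Icc] at ht
  rw [(hasDerivAt_wellPrimitive hW hp t).deriv]
  refine Real.rpow_pos_of_pos (lt_of_le_of_ne (hW.nonneg t) fun h => ?_) _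
  rcases (hW.eq_zero_iff t).1 h.symm with h | h <;> linarith [ht.1, ht.2]

lemma wellPrimitive_zero (W : ℝ → ℝ) (p : ℝ) : wellPrimitive W p 0 = 0 := by
  simp [wellPrimitive]

lemma wellPrimitive_one_pos {W : ℝ → ℝ} (hW : IsDoubleWell W) {p : ℝ} (hp : 1 < p) :
    0 < wellPrimitive W p 1 := by
  have := strictMonoOn_wellPrimitive hW hp (left_mem_Icc.2 zero_le_one)
    (right_mem_Icc.2 zero_le_one) zero_lt_one
  rwa [wellPrimitive_zero] at this

lemma wellPrimitive_mem_Icc {W : ℝ → ℝ} (hW : IsDoubleWell W) {p : ℝ} (hp : 1 < p) {t : ℝ}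
    (ht : t ∈ Icc (0 : ℝ) 1) : wellPrimitive W p t ∈ Icc 0 (wellPrimitive W p 1) := by
  have hm := (strictMonoOn_wellPrimitive hW hp).monotoneOn
  constructor
  · rw [← wellPrimitive_zero W p]
    exact hm (left_mem_Icc.2 zero_le_one) ht ht.1
  · exact hm ht (right_mem_Icc.2 zero_le_one) ht.2

/-- Young's inequality in the form of Modica and Mortola. -/
lemma young_modica_mortola {p a b ε : ℝ} (hp : 1 < p) (ha : 0 ≤ a) (hb : 0 ≤ b) (hε : 0 < ε) :
    a ^ (1 - 1 / p) * b ≤ 1 / ε * (a + (ε * b) ^ p) := by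
  have hpq : (p / (p - 1)).HolderConjugate p := (Real.HolderConjugate.conjExponent hp).symm
  have h1 := Real.young_inequality_of_nonneg (Real.rpow_nonneg ha (1 - 1 / p))
    (mul_nonneg hε.le hb) hpq
  have hp1 : 0 < p - 1 := by linarith
  have hp0 : 0 < p := by linarith
  rw [← Real.rpow_mul ha, show (1 - 1 / p) * (p / (p - 1)) = 1 by field_simp, Real.rpow_one] at h1
  have h2 : a / (p / (p - 1)) ≤ a := div_le_self ha (by rw [le_div_iff₀ hp1]; linarith)
  have h3 : (ε * b) ^ p / p ≤ (ε * b) ^ p := div_le_self (by positivity) hp.le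
  rw [div_mul_eq_mul_div, one_mul, le_div_iff₀ hε]
  linarith

/-- Increments of `Φ(v)` for smooth `v`, by the fundamental theorem of calculus. -/
lemma enorm_wellPrimitive_sub_le {W : ℝ → ℝ} (hW : IsDoubleWell W) {p ε : ℝ} (hp : 1 < p)
    (hε : 0 < ε) {v : Rn n → ℝ} (hv : ContDiff ℝ 1 v) (x h : Rn n) :
    ‖wellPrimitive W p (v (x + h)) - wellPrimitive W p (v x)‖ₑ
      ≤ ∫⁻ t in Ioc (0 : ℝ) 1, ENNReal.ofReal (‖h‖ * (1 / ε *
          (W (v (x + t • h)) + (ε * ‖fderiv ℝ v (x + t • h)‖) ^ p))) := by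
  have hd : ∀ t : ℝ, HasDerivAt (fun t : ℝ => wellPrimitive W p (v (x + t • h)))
      (W (v (x + t • h)) ^ (1 - 1 / p) * fderiv ℝ v (x + t • h) h) t := fun t => by
    have h1 : HasDerivAt (fun t : ℝ => x + t • h) h t := by
      simpa using ((hasDerivAt_id t).smul_const h).const_add x
    have h2 := (hv.differentiable one_ne_zero (x + t • h)).hasFDerivAt.comp_hasDerivAt t h1
    exact (hasDerivAt_wellPrimitive hW hp _).comp t h2
  have hc : Continuous fun t : ℝ =>
      W (v (x + t • h)) ^ (1 - 1 / p) * fderiv ℝ v (x + t • h) h := by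
    refine Continuous.mul ?_ ?_
    · refine Continuous.rpow_const ?_ fun s => Or.inr (one_sub_inv_pos hp).le
      exact hW.continuous.comp (hv.continuous.comp (by fun_prop))
    · exact ((hv.continuous_fderiv one_ne_zero).comp (by fun_prop)).clm_apply continuous_const
  have key := intervalIntegral.integral_eq_sub_of_hasDerivAt (a := 0) (b := 1)
    (fun t _ => hd t) (hc.intervalIntegrable _ _)
  simp only [one_smul, zero_smul, add_zero] at key
  rw [← key, intervalIntegral.integral_of_le zero_le_one]
  refine (enorm_integral_le_lintegral_enorm _).trans (lintegral_mono fun t => ?_)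
  rw [← ofReal_norm]
  refine ENNReal.ofReal_le_ofReal ?_
  have w0 := hW.nonneg (v (x + t • h))
  rw [norm_mul, Real.norm_of_nonneg (Real.rpow_nonneg w0 _)]
  calc W (v (x + t • h)) ^ (1 - 1 / p) * ‖fderiv ℝ v (x + t • h) h‖
      ≤ W (v (x + t • h)) ^ (1 - 1 / p) * (‖fderiv ℝ v (x + t • h)‖ * ‖h‖) :=
        mul_le_mul_of_nonneg_left (ContinuousLinearMap.le_opNorm _ _) (Real.rpow_nonneg w0 _)
    _ = ‖h‖ * (W (v (x + t • h)) ^ (1 - 1 / p) * ‖fderiv ℝ v (x + t • h)‖) := by ring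
    _ ≤ _ := mul_le_mul_of_nonneg_left
        (young_modica_mortola hp w0 (norm_nonneg _) hε) (norm_nonneg _)

lemma ofReal_mul_norm_rpow {F : Type*} [NormedAddCommGroup F] {p ε : ℝ} (hp : 0 ≤ p) (hε : 0 ≤ ε)
    (a : F) : ENNReal.ofReal ((ε * ‖a‖) ^ p) = ENNReal.ofReal (ε ^ p) * ‖a‖ₑ ^ p := by
  rw [Real.mul_rpow hε (norm_nonneg _), ENNReal.ofReal_mul (by positivity),
    ← ENNReal.ofReal_rpow_of_nonneg (norm_nonneg a) hp, ofReal_norm]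

/-- Translations of `Φ(V)` in `L¹` are controlled by the energy of `V`. -/
lemma lintegral_wellPrimitive_translate_le {W : ℝ → ℝ} (hW : IsDoubleWell W) {p ε : ℝ}
    (hp : 1 < p) (hε : 0 < ε) {B K : Set (Rn n)} (hB : MeasurableSet B)
    (hBb : Bornology.IsBounded B) (hK : MeasurableSet K) {V : Rn n → ℝ} {H : Rn n → Rn n}
    (hVH : IsSobolevPair p B V H) (hVI : ∀ᵐ x ∂(volume.restrict B), V x ∈ Icc (0 : ℝ) 1)
    {r : ℝ} (hr : 0 < r) {h : Rn n}
    (hKB : ∀ x ∈ K, ∀ t ∈ Icc (0 : ℝ) 1, Metric.closedBall (x + t • h) r ⊆ B) :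
    ∫⁻ x in K, ‖wellPrimitive W p (V (x + h)) - wellPrimitive W p (V x)‖ₑ
      ≤ ENNReal.ofReal ‖h‖ * gradEnergy (modelIntegrand W p) ε B V H := by
  have hp0 : 0 < p := by linarith
  have hBfin : volume B ≠ ⊤ := hBb.measure_lt_top.ne
  have hfin : IsFiniteMeasure (volume.restrict B) := ⟨by
    rw [Measure.restrict_apply_univ]; exact hBb.measure_lt_top⟩
  have hVl : LocallyIntegrable (B.indicator V) := by
    refine Integrable.locallyIntegrable ?_
    rw [integrable_indicator_iff hB]
    exact hVH.memLp.integrable (by simpa using ENNReal.ofReal_le_ofReal hp.le)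
  have hVI0 : ∀ᵐ x, B.indicator V x ∈ Icc (0 : ℝ) 1 := by
    rw [ae_restrict_iff' hB] at hVI
    filter_upwards [hVI] with x hx
    by_cases hxB : x ∈ B
    · rw [indicator_of_mem hxB]; exact hx hxB
    · rw [indicator_of_notMem hxB]; simp
  let V' : ℕ → Rn n → ℝ := fun m => mollify (bumpSeq n r hr m) (B.indicator V)
  have hV'd : ∀ m, ContDiff ℝ 1 (V' m) := fun m => contDiff_mollify _ hVl
  have hV'I : ∀ m x, V' m x ∈ Icc (0 : ℝ) 1 := fun m x => mollify_mem_Icc _ hVl hVI0 x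
  have hΦ := continuous_wellPrimitive hW hp
  set c : ℝ≥0∞ := ENNReal.ofReal ‖h‖ * ENNReal.ofReal (1 / ε) with hc
  set J : ℝ≥0∞ := ENNReal.ofReal (ε ^ p) * ∫⁻ t in B, ‖H t‖ₑ ^ p with hJ
  have hctop : c ≠ ⊤ := ENNReal.mul_ne_top ENNReal.ofReal_ne_top ENNReal.ofReal_ne_top
  -- the estimate for the mollified functions
  have hsmooth : ∀ m, ∫⁻ x in K, ‖wellPrimitive W p (V' m (x + h)) - wellPrimitive W p (V' m x)‖ₑ
      ≤ c * ((∫⁻ x in B, ENNReal.ofReal (W (V' m x))) + J) := fun m => by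
    let D : Rn n → ℝ≥0∞ := fun z => ENNReal.ofReal (‖h‖ * (1 / ε *
          (W (V' m z) + (ε * ‖fderiv ℝ (V' m) z‖) ^ p)))
    have hfc : Continuous fun z => fderiv ℝ (V' m) z := (hV'd m).continuous_fderiv one_ne_zero
    have hDc : Continuous fun z => ‖h‖ * (1 / ε *
          (W (V' m z) + (ε * ‖fderiv ℝ (V' m) z‖) ^ p)) := by
      refine continuous_const.mul (continuous_const.mul ((hW.continuous.comp
        (hV'd m).continuous).add ((continuous_const.mul hfc.norm).rpow_const
          fun z => Or.inr hp0.le)))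
    have hDm : Measurable D := hDc.measurable.ennreal_ofReal
    calc ∫⁻ x in K, ‖wellPrimitive W p (V' m (x + h)) - wellPrimitive W p (V' m x)‖ₑ
        ≤ ∫⁻ x in K, ∫⁻ t in Ioc (0 : ℝ) 1, D (x + t • h) :=
          lintegral_mono fun x => enorm_wellPrimitive_sub_le hW hp hε (hV'd m) x h
      _ = ∫⁻ t in Ioc (0 : ℝ) 1, ∫⁻ x in K, D (x + t • h) := by
          refine lintegral_lintegral_swap ?_
          exact (hDm.comp (by fun_prop : Continuous fun q : Rn n × ℝ =>
            q.1 + q.2 • h).measurable).aemeasurable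
      _ ≤ ∫⁻ t in Ioc (0 : ℝ) 1, c * ((∫⁻ x in B, ENNReal.ofReal (W (V' m x))) + J) := by
          refine setLIntegral_mono' measurableSet_Ioc fun t ht => ?_
          let Kt : Set (Rn n) := (fun z => z - t • h) ⁻¹' K
          have hKt : MeasurableSet Kt := (measurable_sub_const _) hK
          have hKtB : ∀ z ∈ Kt, Metric.closedBall z r ⊆ B := fun z hz => by
            have := hKB (z - t • h) hz t ⟨ht.1.le, ht.2⟩
            rwa [sub_add_cancel] at this
          have e1 : ∫⁻ x in K, D (x + t • h) = ∫⁻ z in Kt, D z := by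
            rw [← (measurePreserving_add_right volume (t • h)).setLIntegral_comp_preimage hKt hDm]
            congr 2
            ext z; simp [Kt]
          have e2 : ∀ z, D z = c * (ENNReal.ofReal (W (V' m z))
              + ENNReal.ofReal (ε ^ p) * ‖fderiv ℝ (V' m) z‖ₑ ^ p) := fun z => by
            simp only [D]
            rw [ENNReal.ofReal_mul (norm_nonneg _), ENNReal.ofReal_mul (by positivity), hc,
              mul_assoc, ENNReal.ofReal_add (hW.nonneg _) (by positivity),
              ofReal_mul_norm_rpow hp0.le hε.le]
          rw [e1]
          simp only [e2]
          rw [lintegral_const_mul' _ _ hctop, lintegral_add_left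
            (f := fun z => ENNReal.ofReal (W (V' m z)))
            (hW.continuous.comp (hV'd m).continuous).measurable.ennreal_ofReal,
            lintegral_const_mul' _ _ ENNReal.ofReal_ne_top]
          refine mul_le_mul_right (add_le_add ?_ (mul_le_mul_right ?_ _)) _
          · exact lintegral_mono_set fun z hz =>
              hKtB z hz (Metric.mem_closedBall_self hr.le)
          · exact lintegral_enorm_fderiv_mollify_le hp.le hB hVH _ hVl hKt fun z hz =>
              (Metric.closedBall_subset_closedBall (bumpSeq_rOut_le hr m)).trans (hKtB z hz)
      _ = _ := by
          rw [setLIntegral_const, Real.volume_Ioc]; simp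
  -- the mollified functions converge a.e.: Fatou's lemma on the left, dominated convergence on the
  -- right
  have hae := ae_tendsto_mollify hr hVl
  have hae' : ∀ᵐ x, Tendsto (fun m => V' m (x + h)) atTop (𝓝 (B.indicator V (x + h))) :=
    (measurePreserving_add_right volume h).quasiMeasurePreserving.ae hae
  have hlim : Tendsto (fun m => c * ((∫⁻ x in B, ENNReal.ofReal (W (V' m x))) + J)) atTop
      (𝓝 (c * ((∫⁻ x in B, ENNReal.ofReal (W (V x))) + J))) := by
    refine ENNReal.Tendsto.const_mul (Tendsto.add ?_ tendsto_const_nhds) (Or.inr hctop)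
    obtain ⟨C, hC0, hC⟩ := hW.exists_bound
    refine tendsto_lintegral_of_dominated_convergence (fun _ => ENNReal.ofReal C)
      (fun m => (hW.continuous.comp (hV'd m).continuous).measurable.ennreal_ofReal)
      (fun m => Eventually.of_forall fun x => ENNReal.ofReal_le_ofReal (hC _ (hV'I m x))) ?_ ?_
    · rw [setLIntegral_const]
      exact ENNReal.mul_ne_top ENNReal.ofReal_ne_top hBfin
    · filter_upwards [ae_restrict_of_ae hae, ae_restrict_mem hB] with x hx hxB
      rw [indicator_of_mem hxB] at hx
      exact ENNReal.tendsto_ofReal ((hW.continuous.tendsto _).comp hx)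
  calc ∫⁻ x in K, ‖wellPrimitive W p (V (x + h)) - wellPrimitive W p (V x)‖ₑ
      = ∫⁻ x in K, liminf (fun m => ‖wellPrimitive W p (V' m (x + h))
          - wellPrimitive W p (V' m x)‖ₑ) atTop := by
        refine lintegral_congr_ae ?_
        filter_upwards [ae_restrict_of_ae hae, ae_restrict_of_ae hae', ae_restrict_mem hK]
          with x h1 h2 hxK
        have hx1 : x ∈ B := by
          have := hKB x hxK 0 (left_mem_Icc.2 zero_le_one) (Metric.mem_closedBall_self hr.le)
          simpa using this
        have hx2 : x + h ∈ B := by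
          have := hKB x hxK 1 (right_mem_Icc.2 zero_le_one) (Metric.mem_closedBall_self hr.le)
          simpa using this
        rw [indicator_of_mem hx1] at h1
        rw [indicator_of_mem hx2] at h2
        refine (Tendsto.liminf_eq ?_).symm
        exact (((hΦ.tendsto _).comp h2).sub ((hΦ.tendsto _).comp h1)).enorm
    _ ≤ liminf (fun m => ∫⁻ x in K, ‖wellPrimitive W p (V' m (x + h))
          - wellPrimitive W p (V' m x)‖ₑ) atTop := by
        refine lintegral_liminf_le fun m => ?_
        exact ((hΦ.comp ((hV'd m).continuous.comp (by fun_prop))).sub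
          (hΦ.comp (hV'd m).continuous)).measurable.enorm
    _ ≤ liminf (fun m => c * ((∫⁻ x in B, ENNReal.ofReal (W (V' m x))) + J)) atTop :=
        liminf_le_liminf (Eventually.of_forall hsmooth)
    _ = c * ((∫⁻ x in B, ENNReal.ofReal (W (V x))) + J) := hlim.liminf_eq
    _ = _ := by
        rw [hc, hJ, gradEnergy, mul_assoc, ← lintegral_const_mul' _ _ ENNReal.ofReal_ne_top,
          ← lintegral_add_left' (f := fun x => ENNReal.ofReal (W (V x)))
            (hW.continuous.measurable.comp_aemeasurable
              hVH.memLp.aestronglyMeasurable.aemeasurable).ennreal_ofReal]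
        congr 2
        refine lintegral_congr fun x => ?_
        rw [modelIntegrand, ENNReal.ofReal_add (hW.nonneg _) (by positivity), norm_smul,
          Real.norm_of_nonneg hε.le, ofReal_mul_norm_rpow hp0.le hε.le]

end

/-! ### Compactness -/

section

variable {n : ℕ}

/-- If the translations of `u` are Lipschitz in `L¹(A)`, then so is `z ↦ ∫ u(x) ψ(x - z) dx` for
every test function `ψ` in `A`, and the derivative at `z = 0` is `-∫ u ∇ψ`. -/
lemma abs_integral_mul_fderiv_le {A : Set (Rn n)} {u : Rn n → ℝ} (hu : LocallyIntegrable u)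
    {s : ℝ} (hs : 0 < s) {C : ℝ} (hC : 0 ≤ C)
    (hA : ∀ h : Rn n, ‖h‖ < s → ∫⁻ x in A, ‖u (x + h) - u x‖ₑ ≤ ENNReal.ofReal (C * ‖h‖))
    {ψ : Rn n → ℝ} (hψ : ContDiff ℝ 1 ψ) (hψc : HasCompactSupport ψ) (hψA : tsupport ψ ⊆ A)
    (hψ1 : ∀ x, |ψ x| ≤ 1) (v : Rn n) : |∫ x in A, u x * fderiv ℝ ψ x v| ≤ C * ‖v‖ := by
  set g : Rn n → ℝ := fun y => ψ (-y) with hg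
  have hgd : ContDiff ℝ 1 g := hψ.comp contDiff_neg
  have hgc : HasCompactSupport g := hψc.comp_homeomorph (Homeomorph.neg (Rn n))
  set F : Rn n → ℝ := convolution u g (ContinuousLinearMap.lsmul ℝ ℝ) volume with hF
  have hFz : ∀ z, F z = ∫ x, u x * ψ (x - z) := fun z => by
    simp [hF, hg, convolution_def]
  have hd := hgc.hasFDerivAt_convolution_right (ContinuousLinearMap.lsmul ℝ ℝ) hu hgd 0
  have hval : (convolution u (fderiv ℝ g) (ContinuousLinearMap.precompR (Rn n)
      (ContinuousLinearMap.lsmul ℝ ℝ)) volume 0) v = - ∫ x in A, u x * fderiv ℝ ψ x v := by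
    rw [convolution_precompR_apply _ hu (hgc.fderiv (𝕜 := ℝ))
      (hgd.continuous_fderiv one_ne_zero), convolution_def, ← integral_neg,
      setIntegral_eq_integral_of_forall_compl_eq_zero fun x hx => by
        rw [fderiv_eq_zero_of_notMem_tsupport fun hx' => hx (hψA hx')]; simp]
    refine integral_congr_ae (Eventually.of_forall fun x => ?_)
    have h1 : HasFDerivAt g (-(fderiv ℝ ψ x)) (0 - x) := by
      have h2 : HasFDerivAt ψ (fderiv ℝ ψ x) (-(0 - x)) := by
        rw [zero_sub, neg_neg]
        exact (hψ.differentiable one_ne_zero x).hasFDerivAt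
      refine (h2.comp (0 - x) (hasFDerivAt_id (0 - x)).neg).congr_fderiv ?_
      ext z; simp
    dsimp only
    rw [h1.fderiv]
    simp
  have hcont : ∀ z : Rn n, Integrable fun x => u x * ψ (x - z) := fun z =>
    locallyIntegrable_integrable_mul hu (hψ.continuous.comp (by fun_prop))
      (hψc.comp_homeomorph (Homeomorph.subRight z))
  have hlip : ∀ᶠ z in 𝓝 (0 : Rn n), ‖F z - F 0‖ ≤ C * ‖z - 0‖ := by
    filter_upwards [Metric.ball_mem_nhds (0 : Rn n) hs] with z hz
    rw [mem_ball_zero_iff] at hz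
    have hshift : Integrable fun x => u (x + z) * ψ x := by
      have := (hcont z).comp_add_right z
      simpa using this
    have e1 : F z - F 0 = ∫ x, (u (x + z) - u x) * ψ x := by
      rw [hFz, hFz, ← integral_add_right_eq_self (fun x => u x * ψ (x - z)) z]
      simp only [add_sub_cancel_right, sub_zero, sub_mul]
      rw [integral_sub hshift (by simpa using hcont 0)]
    rw [e1, sub_zero]
    have e2 : ∫ x, (u (x + z) - u x) * ψ x = ∫ x in A, (u (x + z) - u x) * ψ x :=
      (setIntegral_eq_integral_of_forall_compl_eq_zero fun x hx => by
        rw [image_eq_zero_of_notMem_tsupport fun hx' => hx (hψA hx'), mul_zero]).symm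
    rw [e2]
    have e3 : ‖∫ x in A, (u (x + z) - u x) * ψ x‖ₑ ≤ ENNReal.ofReal (C * ‖z‖) := by
      refine (enorm_integral_le_lintegral_enorm _).trans (le_trans (lintegral_mono fun x => ?_)
        (hA z hz))
      rw [enorm_mul, ← ofReal_norm (ψ x)]
      refine mul_le_of_le_one_right zero_le ?_
      rw [← ENNReal.ofReal_one]
      exact ENNReal.ofReal_le_ofReal (hψ1 x)
    rw [← ofReal_norm] at e3
    exact (ENNReal.ofReal_le_ofReal_iff (by positivity)).1 e3
  have hnorm := hd.le_of_lip' hC hlip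
  have := (ContinuousLinearMap.le_of_opNorm_le _ hnorm v)
  rwa [hval, norm_neg] at this

/-- A bounded function whose translations are Lipschitz in `L¹(A)` has bounded variation in `A`. -/
lemma memBV_of_translate_le {A : Set (Rn n)} (hAb : Bornology.IsBounded A) {u : Rn n → ℝ}
    (hu : LocallyIntegrable u)
    {s : ℝ} (hs : 0 < s) {C : ℝ} (hC : 0 ≤ C)
    (hA : ∀ h : Rn n, ‖h‖ < s → ∫⁻ x in A, ‖u (x + h) - u x‖ₑ ≤ ENNReal.ofReal (C * ‖h‖)) :
    MemBV A u := by
  refine ⟨(hu.integrableOn_isCompact hAb.isCompact_closure).mono_set subset_closure,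
    ∑ _i : Fin n, C, fun φ hφ hφc hφA hφ1 => ?_⟩
  have hcomp : ∀ i : Fin n, ContDiff ℝ 1 fun y => φ y i := fun i => (contDiff_euclidean.1 hφ) i
  have hsub : ∀ i : Fin n, Function.support (fun y => φ y i) ⊆ Function.support φ :=
    fun i y hy h0 => hy (by simp [h0])
  have hcompc : ∀ i : Fin n, HasCompactSupport fun y => φ y i := fun i => hφc.mono (hsub i)
  have hder : ∀ (x : Rn n) (i : Fin n) (v : Rn n),
      fderiv ℝ φ x v i = fderiv ℝ (fun y => φ y i) x v :=
    fun x i v => by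
      have h1 := (hφ.differentiable one_ne_zero x).hasFDerivAt
      have h2 := ((EuclideanSpace.proj (𝕜 := ℝ) i).hasFDerivAt (x := φ x)).comp x h1
      have h3 : HasFDerivAt (fun y => φ y i)
          ((EuclideanSpace.proj (𝕜 := ℝ) i).comp (fderiv ℝ φ x)) x :=
        h2
      rw [h3.fderiv]; rfl
  simp only [divergence, Finset.mul_sum, hder]
  rw [integral_finsetSum]
  · refine Finset.sum_le_sum fun i _ => (le_abs_self _).trans ?_
    have := abs_integral_mul_fderiv_le hu hs hC hA (hcomp i) (hcompc i)
      ((closure_mono (hsub i)).trans hφA)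
      (fun x => (PiLp.norm_apply_le (φ x) i).trans (hφ1 x)) (EuclideanSpace.single i 1)
    simpa using this
  · intro i _
    exact (locallyIntegrable_integrable_mul hu (continuous_fderiv_apply' (hcomp i) _)
      (hasCompactSupport_fderiv_apply (hcompc i) _)).integrableOn

/-- The cell of index `c` of the grid of mesh size `1/(N+1)`. -/
def gridCell (N : ℕ) (c : Fin n → ℤ) : Set (Rn n) := {y | ∀ i, ⌊((N : ℝ) + 1) * y i⌋ = c i}

/-- The index of the grid cell that contains `x`. -/
def gridIndex (N : ℕ) (x : Rn n) (i : Fin n) : ℤ := ⌊((N : ℝ) + 1) * x i⌋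

lemma measurable_gridIndex (N : ℕ) : Measurable (gridIndex (n := n) N) :=
  measurable_pi_lambda _ fun i => Int.measurable_floor.comp (by fun_prop)

lemma measurableSet_gridCell (N : ℕ) (c : Fin n → ℤ) : MeasurableSet (gridCell N c) := by
  have : gridCell N c = gridIndex N ⁻¹' {c} := by
    ext y; simp [gridCell, gridIndex, funext_iff]
  rw [this]
  exact measurable_gridIndex N (measurableSet_singleton c)

lemma ball_subset_gridCell (N : ℕ) (c : Fin n → ℤ) :
    Metric.ball (WithLp.toLp 2 fun i => ((c i : ℝ) + 1 / 2) / ((N : ℝ) + 1))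
        (1 / (2 * ((N : ℝ) + 1)))
      ⊆ (gridCell N c : Set (Rn n)) := by
  intro y hy i
  rw [mem_ball_iff_norm] at hy
  have h1 := (PiLp.norm_apply_le (y - WithLp.toLp 2 fun i => ((c i : ℝ) + 1 / 2) / ((N : ℝ) + 1))
    i).trans_lt hy
  have hN : (0 : ℝ) < (N : ℝ) + 1 := by positivity
  rw [PiLp.sub_apply, Real.norm_eq_abs, abs_lt] at h1
  obtain ⟨h2, h3⟩ := h1
  have e : ((N : ℝ) + 1) * (1 / (2 * ((N : ℝ) + 1))) = 1 / 2 := by field_simp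
  have e' : ((N : ℝ) + 1) * (((c i : ℝ) + 1 / 2) / ((N : ℝ) + 1)) = c i + 1 / 2 := by field_simp
  have h4 := mul_lt_mul_of_pos_left h2 hN
  have h5 := mul_lt_mul_of_pos_left h3 hN
  rw [mul_neg, e, mul_sub, e'] at h4
  rw [e, mul_sub, e'] at h5
  rw [Int.floor_eq_iff]
  constructor <;> linarith

lemma norm_sub_le_of_mem_gridCell {N : ℕ} {x y : Rn n} (hy : y ∈ gridCell N (gridIndex N x)) :
    ‖y - x‖ ≤ n / ((N : ℝ) + 1) := by
  have h1 : ‖y - x‖ ≤ ∑ i, |(y - x) i| := by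
    have := (EuclideanSpace.basisFun (Fin n) ℝ).sum_repr (y - x)
    conv_lhs => rw [← this]
    refine (norm_sum_le _ _).trans (le_of_eq ?_)
    simp [norm_smul]
  have hN : (0 : ℝ) < (N : ℝ) + 1 := by positivity
  refine h1.trans ((Finset.sum_le_sum (g := fun _ => 1 / ((N : ℝ) + 1)) fun i _ => ?_).trans
    (le_of_eq ?_))
  · have h2 := Int.abs_sub_lt_one_of_floor_eq_floor (hy i)
    rw [← mul_sub, abs_mul, abs_of_pos hN] at h2
    rw [PiLp.sub_apply, le_div_iff₀ hN, mul_comm]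
    exact h2.le
  · rw [Finset.sum_const, Finset.card_univ, Fintype.card_fin, nsmul_eq_mul, mul_one_div]

/-- The mean of `z` over a grid cell. -/
def gridMean (z : Rn n → ℝ) (N : ℕ) (c : Fin n → ℤ) : ℝ := ⨍ y in gridCell N c, z y

lemma volume_gridCell_pos (N : ℕ) (c : Fin n → ℤ) : volume (gridCell N c) ≠ 0 := fun h =>
  (Metric.measure_ball_pos volume (WithLp.toLp 2 fun i => ((c i : ℝ) + 1 / 2) / ((N : ℝ) + 1))
    (by positivity : (0 : ℝ) < 1 / (2 * ((N : ℝ) + 1)))).ne'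
    (measure_mono_null (ball_subset_gridCell N c) h)

lemma volume_gridCell_ne_top (N : ℕ) (c : Fin n → ℤ) : volume (gridCell N c) ≠ ⊤ := by
  have hm : WithLp.toLp 2 (fun i => ((c i : ℝ) + 1 / 2) / ((N : ℝ) + 1)) ∈ gridCell N c :=
    ball_subset_gridCell N c (Metric.mem_ball_self (by positivity))
  refine ((Metric.isBounded_closedBall (x := WithLp.toLp 2
    (fun i => ((c i : ℝ) + 1 / 2) / ((N : ℝ) + 1))) (r := n / ((N : ℝ) + 1))).subset
    fun y hy => ?_).measure_lt_top.ne
  rw [mem_closedBall_iff_norm]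
  refine norm_sub_le_of_mem_gridCell fun i => ?_
  rw [gridIndex, hm i]
  exact hy i

lemma abs_gridMean_le {z : Rn n → ℝ} {M : ℝ} (hM : ∀ x, |z x| ≤ M) (N : ℕ) (c : Fin n → ℤ) :
    |gridMean z N c| ≤ M := by
  unfold gridMean average
  have : IsProbabilityMeasure (((volume.restrict (gridCell N c)) univ)⁻¹ •
      (volume.restrict (gridCell N c) : Measure (Rn n))) := ⟨by
    rw [Measure.smul_apply, smul_eq_mul, Measure.restrict_apply_univ]
    exact ENNReal.inv_mul_cancel (volume_gridCell_pos N c) (volume_gridCell_ne_top N c)⟩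
  have := norm_integral_le_of_norm_le_const (μ := ((volume.restrict (gridCell N c)) univ)⁻¹ •
      (volume.restrict (gridCell N c) : Measure (Rn n)))
    (f := z) (C := M) (Eventually.of_forall hM)
  rwa [probReal_univ, mul_one, Real.norm_eq_abs] at this

/-- Replacing a function by its means over the cells of a fine grid changes it little in `L¹`, if
its translations are Lipschitz in `L¹`. -/
lemma lintegral_sub_gridMean_le {z : Rn n → ℝ} (hz : Measurable z) {M : ℝ} (hM : ∀ x, |z x| ≤ M)
    {K : Set (Rn n)} {r : ℝ} {C : ℝ≥0∞}
    (hK : ∀ h : Rn n, ‖h‖ < r → ∫⁻ x in K, ‖z (x + h) - z x‖ₑ ≤ C * ENNReal.ofReal ‖h‖)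
    {N : ℕ} (hN : n / ((N : ℝ) + 1) < r) :
    ∫⁻ x in K, ‖z x - gridMean z N (gridIndex N x)‖ₑ
      ≤ ENNReal.ofReal ((2 * n) ^ n) * (C * ENNReal.ofReal (n / ((N : ℝ) + 1))) := by
  set d : ℝ := n / ((N : ℝ) + 1) with hd
  have hd0 : 0 ≤ d := by positivity
  set q : ℝ := 1 / (2 * ((N : ℝ) + 1)) with hq
  have hq0 : 0 < q := by positivity
  have hvq : volume (Metric.ball (0 : Rn n) q) ≠ 0 := (Metric.measure_ball_pos _ _ hq0).ne'
  have hvq' : volume (Metric.ball (0 : Rn n) q) ≠ ⊤ := measure_ball_lt_top.ne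
  have hpt : ∀ x, ‖z x - gridMean z N (gridIndex N x)‖ₑ ≤ (volume (Metric.ball (0 : Rn n) q))⁻¹ *
      ∫⁻ h in Metric.closedBall (0 : Rn n) d, ‖z (x + h) - z x‖ₑ := fun x => by
    set D := gridCell N (gridIndex N x) with hD
    have hDm : MeasurableSet D := measurableSet_gridCell N _
    have hprob : IsProbabilityMeasure (((volume.restrict D) univ)⁻¹ •
        (volume.restrict D : Measure (Rn n))) := ⟨by
      rw [Measure.smul_apply, smul_eq_mul, Measure.restrict_apply_univ]
      exact ENNReal.inv_mul_cancel (volume_gridCell_pos N _) (volume_gridCell_ne_top N _)⟩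
    have hi : Integrable z (((volume.restrict D) univ)⁻¹ • (volume.restrict D : Measure (Rn n))) :=
      Integrable.of_bound hz.aestronglyMeasurable M (Eventually.of_forall hM)
    have e1 : z x - gridMean z N (gridIndex N x) = ∫ y, (z x - z y) ∂(((volume.restrict D) univ)⁻¹ •
        (volume.restrict D : Measure (Rn n))) := by
      rw [integral_sub (integrable_const _) hi, integral_const, probReal_univ, one_smul]
      rfl
    rw [e1]
    refine (enorm_integral_le_lintegral_enorm _).trans ?_
    rw [lintegral_smul_measure, smul_eq_mul, Measure.restrict_apply_univ]
    refine mul_le_mul' ?_ ?_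
    · refine ENNReal.inv_le_inv.2 ?_
      rw [← Measure.addHaar_ball_center volume
        (WithLp.toLp 2 fun i => (((gridIndex N x i : ℤ) : ℝ) + 1 / 2) / ((N : ℝ) + 1)) q]
      exact measure_mono (ball_subset_gridCell N _)
    · have hmeas : Measurable fun y => ‖z x - z y‖ₑ := (measurable_const.sub hz).enorm
      rw [← (measurePreserving_add_left volume x).setLIntegral_comp_preimage hDm hmeas]
      refine le_trans (lintegral_mono_set fun h hh => ?_)
        (le_of_eq (lintegral_congr fun h => enorm_sub_rev _ _))
      rw [mem_closedBall_zero_iff]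
      have := norm_sub_le_of_mem_gridCell (x := x) (y := x + h) hh
      rwa [add_sub_cancel_left] at this
  have hratio : (volume (Metric.ball (0 : Rn n) q))⁻¹ * volume (Metric.closedBall (0 : Rn n) d)
      = ENNReal.ofReal ((2 * n) ^ n) := by
    have e : d = (2 * n) * q := by rw [hd, hq]; field_simp
    have hv1 : volume (Metric.ball (0 : Rn n) 1) ≠ 0 := (Metric.measure_ball_pos _ _ one_pos).ne'
    have hv1' : volume (Metric.ball (0 : Rn n) 1) ≠ ⊤ := measure_ball_lt_top.ne
    have hqn : ENNReal.ofReal (q ^ n) ≠ 0 := by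
      rw [Ne, ENNReal.ofReal_eq_zero, not_le]; positivity
    rw [Measure.addHaar_closedBall _ _ hd0, Measure.addHaar_ball_of_pos _ _ hq0,
      finrank_euclideanSpace_fin, e, mul_pow, ENNReal.ofReal_mul (by positivity),
      ENNReal.mul_inv (Or.inl hqn) (Or.inl ENNReal.ofReal_ne_top)]
    calc _ = ENNReal.ofReal ((2 * n) ^ n) * ((ENNReal.ofReal (q ^ n))⁻¹ * ENNReal.ofReal (q ^ n))
          * ((volume (Metric.ball (0 : Rn n) 1))⁻¹ * volume (Metric.ball (0 : Rn n) 1)) := by ring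
      _ = _ := by
        rw [ENNReal.inv_mul_cancel hqn ENNReal.ofReal_ne_top, ENNReal.inv_mul_cancel hv1 hv1',
          mul_one, mul_one]
  calc ∫⁻ x in K, ‖z x - gridMean z N (gridIndex N x)‖ₑ
      ≤ ∫⁻ x in K, (volume (Metric.ball (0 : Rn n) q))⁻¹ *
        ∫⁻ h in Metric.closedBall (0 : Rn n) d, ‖z (x + h) - z x‖ₑ := lintegral_mono hpt
    _ = (volume (Metric.ball (0 : Rn n) q))⁻¹ *
        ∫⁻ h in Metric.closedBall (0 : Rn n) d, ∫⁻ x in K, ‖z (x + h) - z x‖ₑ := by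
        rw [lintegral_const_mul' _ _ (ENNReal.inv_ne_top.2 hvq), lintegral_lintegral_swap]
        exact ((hz.comp (measurable_fst.add measurable_snd)).sub
          (hz.comp measurable_fst)).enorm.aemeasurable
    _ ≤ (volume (Metric.ball (0 : Rn n) q))⁻¹ *
        ∫⁻ h in Metric.closedBall (0 : Rn n) d, C * ENNReal.ofReal d := by
        refine mul_le_mul_right (setLIntegral_mono' Metric.isClosed_closedBall.measurableSet
          fun h hh => ?_) _
        rw [mem_closedBall_zero_iff] at hh
        exact (hK h (hh.trans_lt hN)).trans (mul_le_mul_right (ENNReal.ofReal_le_ofReal hh) _)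
    _ = _ := by
        rw [setLIntegral_const, mul_comm (C * _), ← mul_assoc, hratio]

lemma exists_tendsto_of_cauchy_L1 {α : Type*} [MeasurableSpace α] {μ : Measure α}
    {z : ℕ → α → ℝ} (hz : ∀ j, MemLp (z j) 1 μ)
    (h : ∀ τ : ℝ≥0∞, 0 < τ → ∃ J, ∀ i, J ≤ i → ∀ j, J ≤ j → ∫⁻ x, ‖z i x - z j x‖ₑ ∂μ < τ) :
    ∃ ζ : α → ℝ, AEStronglyMeasurable ζ μ ∧
      Tendsto (fun j => ∫⁻ x, ‖z j x - ζ x‖ₑ ∂μ) atTop (𝓝 0) := by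
  have hcauchy : CauchySeq fun j => (hz j).toLp (z j) := by
    refine EMetric.cauchySeq_iff.2 fun τ hτ => ?_
    obtain ⟨J, hJ⟩ := h τ hτ
    refine ⟨J, fun i hi j hj => ?_⟩
    rw [Lp.edist_toLp_toLp, eLpNorm_one_eq_lintegral_enorm]
    exact hJ i hi j hj
  obtain ⟨ζ, hζ⟩ := cauchySeq_tendsto_of_complete hcauchy
  refine ⟨ζ, (Lp.memLp ζ).aestronglyMeasurable, ?_⟩
  rw [tendsto_iff_edist_tendsto_0] at hζ
  refine hζ.congr fun j => ?_
  rw [← Lp.toLp_coeFn ζ (Lp.memLp ζ), Lp.edist_toLp_toLp, eLpNorm_one_eq_lintegral_enorm]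
  simp only [Pi.sub_apply, Lp.toLp_coeFn]

lemma exists_subseq_tendsto_pi {ι : Type*} [Countable ι] {a : ℕ → ι → ℝ} {M : ℝ}
    (ha : ∀ j i, |a j i| ≤ M) :
    ∃ σ : ℕ → ℕ, StrictMono σ ∧ ∃ L : ι → ℝ, ∀ i, Tendsto (fun j => a (σ j) i) atTop (𝓝 (L i)) := by
  have hc : IsCompact (Set.pi univ fun _ : ι => Icc (-M) M) :=
    isCompact_univ_pi fun _ => isCompact_Icc
  obtain ⟨L, -, σ, hσ, hL⟩ := hc.tendsto_subseq (x := a) fun j i _ => abs_le.1 (ha j i)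
  exact ⟨σ, hσ, L, fun i => (tendsto_pi_nhds.1 hL) i⟩

/-- Compactness in `L¹(K)` of bounded sequences with uniformly Lipschitz translations. The means
over the countably many grid cells converge along a subsequence by Tychonoff's theorem, and each
function is uniformly close to its means. -/
lemma exists_subseq_tendsto_L1 {z : ℕ → Rn n → ℝ} (hz : ∀ j, Measurable (z j)) {M : ℝ}
    (hM : ∀ j x, |z j x| ≤ M) {K : Set (Rn n)} (hKb : Bornology.IsBounded K)
    {r : ℝ} (hr : 0 < r) {C : ℝ≥0∞} (hC : C ≠ ⊤)
    (hK : ∀ j, ∀ h : Rn n, ‖h‖ < r →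
      ∫⁻ x in K, ‖z j (x + h) - z j x‖ₑ ≤ C * ENNReal.ofReal ‖h‖) :
    ∃ σ : ℕ → ℕ, StrictMono σ ∧ ∃ ζ : Rn n → ℝ, AEStronglyMeasurable ζ (volume.restrict K) ∧
      Tendsto (fun j => ∫⁻ x in K, ‖z (σ j) x - ζ x‖ₑ) atTop (𝓝 0) := by
  have hKfin : IsFiniteMeasure (volume.restrict K) := ⟨by
    rw [Measure.restrict_apply_univ]; exact hKb.measure_lt_top⟩
  have hKv : volume K ≠ ⊤ := hKb.measure_lt_top.ne
  obtain ⟨σ, hσ, L, hL'⟩ := exists_subseq_tendsto_pi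
    (a := fun j (q : ℕ × (Fin n → ℤ)) => gridMean (z j) q.1 q.2) (M := M)
    fun j q => abs_gridMean_le (hM j) q.1 q.2
  replace hL' : ∀ N c, Tendsto (fun j => gridMean (z (σ j)) N c) atTop (𝓝 (L (N, c))) :=
    fun N c => hL' (N, c)
  refine ⟨σ, hσ, ?_⟩
  have hgm : ∀ (N : ℕ) (A : (Fin n → ℤ) → ℝ), Measurable fun x => A (gridIndex N x) :=
    fun N A => (Measurable.of_discrete (f := A)).comp (measurable_gridIndex N)
  have hconv : ∀ N, Tendsto (fun j => ∫⁻ x in K, ‖gridMean (z (σ j)) N (gridIndex N x)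
      - L (N, gridIndex N x)‖ₑ) atTop (𝓝 0) := fun N => by
    have h0 : (0 : ℝ≥0∞) = ∫⁻ _ in K, (0 : ℝ≥0∞) := by simp
    rw [h0]
    refine tendsto_lintegral_of_dominated_convergence (fun _ => ENNReal.ofReal (M + M))
      (fun j => ((hgm N _).sub (hgm N fun c => L (N, c))).enorm)
      (fun j => Eventually.of_forall fun x => ?_) ?_ (Eventually.of_forall fun x => ?_)
    · dsimp only
      rw [← ofReal_norm]
      refine ENNReal.ofReal_le_ofReal ((norm_sub_le _ _).trans (add_le_add ?_ ?_))
      · exact abs_gridMean_le (hM _) N _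
      · exact le_of_tendsto (hL' N (gridIndex N x)).abs
          (Eventually.of_forall fun j => abs_gridMean_le (hM _) N _)
    · rw [setLIntegral_const]
      exact ENNReal.mul_ne_top ENNReal.ofReal_ne_top hKv
    · have := ((hL' N (gridIndex N x)).sub_const (L (N, gridIndex N x))).enorm
      simpa using this
  have hrN : Tendsto (fun N : ℕ => n / ((N : ℝ) + 1)) atTop (𝓝 0) := by
    have := (tendsto_one_div_add_atTop_nhds_zero_nat (𝕜 := ℝ)).const_mul (n : ℝ)
    simpa only [mul_one_div, mul_zero] using this
  have hfine : Tendsto (fun N : ℕ => ENNReal.ofReal ((2 * n) ^ n)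
      * (C * ENNReal.ofReal (n / ((N : ℝ) + 1)))) atTop (𝓝 0) := by
    have h1 := ENNReal.tendsto_ofReal hrN
    rw [ENNReal.ofReal_zero] at h1
    have h2 := ENNReal.Tendsto.const_mul (a := ENNReal.ofReal ((2 * n) ^ n))
      (ENNReal.Tendsto.const_mul (a := C) h1 (Or.inr hC)) (Or.inr ENNReal.ofReal_ne_top)
    simpa only [mul_zero] using h2
  refine exists_tendsto_of_cauchy_L1 (fun j => MemLp.of_bound (hz _).aestronglyMeasurable M
    (Eventually.of_forall (hM _))) fun τ hτ => ?_
  have hτ4 : 0 < τ / 4 := ENNReal.div_pos hτ.ne' (by norm_num)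
  obtain ⟨N, hN1, hN2⟩ := ((hfine.eventually (gt_mem_nhds hτ4)).and
    (hrN.eventually (gt_mem_nhds hr))).exists
  obtain ⟨J, hJ⟩ := eventually_atTop.1 ((hconv N).eventually (gt_mem_nhds hτ4))
  have hlt : ∀ j, J ≤ j → ∫⁻ x in K, ‖z (σ j) x - L (N, gridIndex N x)‖ₑ < τ / 4 + τ / 4 :=
    fun j hj => (lintegral_enorm_sub_le (hz _).aestronglyMeasurable
      (hgm N (gridMean (z (σ j)) N)).aestronglyMeasurable).trans_lt (ENNReal.add_lt_add
        ((lintegral_sub_gridMean_le (hz _) (hM _) (hK _) hN2).trans_lt hN1) (hJ j hj))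
  refine ⟨J, fun i hi j hj => ?_⟩
  have h1 := hlt i hi
  have h2 := hlt j hj
  have h3 := lintegral_enorm_sub_le (A := K) (c := z (σ j)) (hz (σ i)).aestronglyMeasurable
    (hgm N fun c => L (N, c)).aestronglyMeasurable
  simp only [enorm_sub_rev (L _)] at h3
  refine (h3.trans_lt (ENNReal.add_lt_add h1 h2)).trans_le (le_of_eq ?_)
  rw [← two_mul, ← two_mul, ← mul_assoc, show (2 : ℝ≥0∞) * 2 = 4 by norm_num,
    ENNReal.mul_div_cancel] <;> norm_num

/-- Where the transformed variables converge and the potential tends to zero, the sequence itself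
converges to one of the wells. -/
lemma tendsto_well {W : ℝ → ℝ} (hW : IsDoubleWell W) {p : ℝ} (hp : 1 < p) {a : ℕ → ℝ}
    (ha : ∀ j, a j ∈ Icc (0 : ℝ) 1) {l : ℝ}
    (hl : Tendsto (fun j => wellPrimitive W p (a j)) atTop (𝓝 l))
    (hWa : liminf (fun j => ENNReal.ofReal (W (a j))) atTop = 0) :
    Tendsto a atTop (𝓝 0) ∨ Tendsto a atTop (𝓝 1) := by
  let Ψ : Icc (0 : ℝ) 1 → ℝ := fun t => wellPrimitive W p t
  have hΨ : Topology.IsClosedEmbedding Ψ :=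
    ((continuous_wellPrimitive hW hp).comp continuous_subtype_val).isClosedEmbedding
      fun s t hst => Subtype.ext ((strictMonoOn_wellPrimitive hW hp).injOn s.2 t.2 hst)
  let b : ℕ → Icc (0 : ℝ) 1 := fun j => ⟨a j, ha j⟩
  have hb : Tendsto (Ψ ∘ b) atTop (𝓝 l) := hl
  obtain ⟨t, rfl⟩ := hΨ.isClosed_range.mem_of_tendsto hb
    (Eventually.of_forall fun j => mem_range_self _)
  have hbt := (hΨ.tendsto_nhds_iff).2 hb
  have hat : Tendsto a atTop (𝓝 (t : ℝ)) := (continuous_subtype_val.tendsto t).comp hbt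
  have hWt := (ENNReal.tendsto_ofReal ((hW.continuous.tendsto _).comp hat)).liminf_eq
  simp only [Function.comp_def] at hWt
  rw [hWa] at hWt
  have h0 : W t = 0 := le_antisymm (ENNReal.ofReal_eq_zero.1 hWt.symm) (hW.nonneg _)
  rcases (hW.eq_zero_iff _).1 h0 with h | h
  · left; rwa [h] at hat
  · right; rwa [h] at hat

/-- Compactness for sequences of bounded energy: along a subsequence they converge in `L¹(K)` to a
function with values in `{0,1}`, whose translations are Lipschitz in `L¹`. -/
lemma exists_subseq_tendsto_of_gradEnergy_le {W : ℝ → ℝ} (hW : IsDoubleWell W) {p : ℝ}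
    (hp : 1 < p) {ε : ℕ → ℝ} (hε : ∀ j, 0 < ε j) (hε0 : Tendsto ε atTop (𝓝 0))
    {K B : Set (Rn n)} (hK : MeasurableSet K) (hB : MeasurableSet B)
    (hBb : Bornology.IsBounded B) {r : ℝ} (hr : 0 < r)
    (hKB : ∀ x ∈ K, Metric.closedBall x (2 * r) ⊆ B) {V : ℕ → Rn n → ℝ} {H : ℕ → Rn n → Rn n}
    (hVH : ∀ j, IsSobolevPair p B (V j) (H j))
    (hVI : ∀ j, ∀ᵐ x ∂(volume.restrict B), V j x ∈ Icc (0 : ℝ) 1)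
    {C : ℝ≥0∞} (hC : C ≠ ⊤) (hE : ∀ j, gradEnergy (modelIntegrand W p) (ε j) B (V j) (H j) ≤ C) :
    ∃ σ : ℕ → ℕ, StrictMono σ ∧ ∃ u : Rn n → ℝ, Measurable u ∧ (∀ x, u x = 0 ∨ u x = 1) ∧
      Tendsto (fun j => ∫⁻ x in K, ‖V (σ j) x - u x‖ₑ) atTop (𝓝 0) ∧
      ∀ A : Set (Rn n), MeasurableSet A → (∀ x ∈ A, Metric.ball x r ⊆ K) →
        Bornology.IsBounded A → MemBV A u := by
  have hKsub : K ⊆ B := fun x hx => hKB x hx (Metric.mem_closedBall_self (by positivity))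
  have hKb : Bornology.IsBounded K := hBb.subset hKsub
  have hKv : volume K ≠ ⊤ := hKb.measure_lt_top.ne
  have hΦ := continuous_wellPrimitive hW hp
  have hΦ1 := wellPrimitive_one_pos hW hp
  -- measurable representatives with values in `[0,1]`
  have hrep : ∀ j, ∃ v : Rn n → ℝ, Measurable v ∧ (∀ x, v x ∈ Icc (0 : ℝ) 1) ∧
      V j =ᵐ[volume.restrict B] v := fun j => by
    have hm := (hVH j).memLp.aestronglyMeasurable
    refine ⟨fun x => max 0 (min 1 (hm.mk (V j) x)),
      measurable_const.max (measurable_const.min hm.stronglyMeasurable_mk.measurable),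
      fun x => ⟨le_max_left _ _, max_le zero_le_one (min_le_left _ _)⟩, ?_⟩
    filter_upwards [hm.ae_eq_mk, hVI j] with x h1 h2
    rw [← h1, min_eq_right h2.2, max_eq_right h2.1]
  choose v hvm hvI hVv using hrep
  have hvH : ∀ j, IsSobolevPair p B (v j) (H j) := fun j => (hVH j).congr (hVv j) ae_eq_rfl
  have hvE : ∀ j, gradEnergy (modelIntegrand W p) (ε j) B (v j) (H j) ≤ C := fun j => by
    rw [← gradEnergy_congr (hVv j) ae_eq_rfl]; exact hE j
  have htr : ∀ A : Set (Rn n), MeasurableSet A → A ⊆ K → ∀ j, ∀ h : Rn n, ‖h‖ < r →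
      ∫⁻ x in A, ‖wellPrimitive W p (v j (x + h)) - wellPrimitive W p (v j x)‖ₑ
        ≤ C * ENNReal.ofReal ‖h‖ := fun A hA hAK j h hh => by
    rw [mul_comm]
    refine (lintegral_wellPrimitive_translate_le hW hp (hε j) hB hBb hA (hvH j)
      (Eventually.of_forall (hvI j)) hr fun x hx t ht => ?_).trans
      (mul_le_mul_right (hvE j) _)
    refine subset_trans (Metric.closedBall_subset_closedBall' ?_) (hKB x (hAK hx))
    rw [dist_eq_norm, add_sub_cancel_left, norm_smul, Real.norm_of_nonneg ht.1]
    nlinarith [ht.2, norm_nonneg h]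
  obtain ⟨σ₁, hσ₁, ζ, hζm, hζ⟩ := exists_subseq_tendsto_L1
    (z := fun j x => wellPrimitive W p (v j x)) (fun j => hΦ.measurable.comp (hvm j))
    (M := wellPrimitive W p 1) (fun j x => by
      have := wellPrimitive_mem_Icc hW hp (hvI j x)
      rw [abs_of_nonneg this.1]; exact this.2) hKb hr hC (htr K hK subset_rfl)
  have hmeas : TendstoInMeasure (volume.restrict K)
      (fun j x => wellPrimitive W p (v (σ₁ j) x)) atTop ζ := by
    refine tendstoInMeasure_of_tendsto_eLpNorm (p := 1) one_ne_zero
      (fun j => (hΦ.measurable.comp (hvm _)).aestronglyMeasurable) hζm ?_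
    simpa only [eLpNorm_one_eq_lintegral_enorm, Pi.sub_apply] using hζ
  obtain ⟨σ₂, hσ₂, hae⟩ := hmeas.exists_seq_tendsto_ae
  set σ : ℕ → ℕ := fun j => σ₁ (σ₂ j) with hσdef
  have hσ : StrictMono σ := hσ₁.comp hσ₂
  -- the energy bound forces `∫ W(v)` to be of order `ε`
  have hpot : ∀ᵐ x ∂(volume.restrict K),
      liminf (fun j => ENNReal.ofReal (W (v (σ j) x))) atTop = 0 := by
    have hm : ∀ j, Measurable fun x => ENNReal.ofReal (W (v (σ j) x)) := fun j =>
      (hW.continuous.measurable.comp (hvm _)).ennreal_ofReal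
    have hlim : Tendsto (fun j => ENNReal.ofReal (ε (σ j)) * C) atTop (𝓝 0) := by
      have h1 := ENNReal.tendsto_ofReal (hε0.comp hσ.tendsto_atTop)
      rw [ENNReal.ofReal_zero] at h1
      simpa using ENNReal.Tendsto.mul_const h1 (Or.inr hC)
    have hle : ∫⁻ x in K, liminf (fun j => ENNReal.ofReal (W (v (σ j) x))) atTop ≤ 0 := by
      refine (lintegral_liminf_le hm).trans ?_
      rw [← hlim.liminf_eq]
      refine liminf_le_liminf (Eventually.of_forall fun j => ?_)
      have h1 := hvE (σ j)
      rw [gradEnergy, one_div, ENNReal.ofReal_inv_of_pos (hε _)] at h1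
      have hne : ENNReal.ofReal (ε (σ j)) ≠ 0 := by
        rw [Ne, ENNReal.ofReal_eq_zero, not_le]; exact hε _
      have h2 := mul_le_mul_right h1 (ENNReal.ofReal (ε (σ j)))
      rw [← mul_assoc, ENNReal.mul_inv_cancel hne ENNReal.ofReal_ne_top, one_mul] at h2
      refine le_trans ((lintegral_mono_set hKsub).trans (lintegral_mono fun x => ?_)) h2
      refine ENNReal.ofReal_le_ofReal ?_
      rw [modelIntegrand]
      have : 0 ≤ ‖ε (σ j) • H (σ j) x‖ ^ p := by positivity
      linarith
    have := (lintegral_eq_zero_iff (Measurable.liminf hm)).1 (nonpos_iff_eq_zero.1 hle)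
    filter_upwards [this] with x hx using hx
  set E : Set (Rn n) := {x | 1 / 2 ≤ limsup (fun j => v (σ j) x) atTop} with hEdef
  have hEm : MeasurableSet E := measurableSet_le measurable_const
    (Measurable.limsup fun j => hvm (σ j))
  set u : Rn n → ℝ := E.indicator 1 with hu
  have hum : Measurable u := measurable_one.indicator hEm
  have hu01 : ∀ x, u x = 0 ∨ u x = 1 := fun x => by
    by_cases hx : x ∈ E
    · right; simp [hu, hx]
    · left; simp [hu, hx]
  have hvu : ∀ᵐ x ∂(volume.restrict K), Tendsto (fun j => v (σ j) x) atTop (𝓝 (u x)) := by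
    filter_upwards [hae, hpot] with x h1 h2
    rcases tendsto_well hW hp (fun j => hvI (σ j) x) h1 h2 with h | h
    · have : x ∉ E := fun hx => by
        rw [hEdef, mem_ofPred_eq, h.limsup_eq] at hx; norm_num at hx
      rw [hu, indicator_of_notMem this]; exact h
    · have : x ∈ E := by rw [hEdef, mem_ofPred_eq, h.limsup_eq]; norm_num
      rw [hu, indicator_of_mem this]; exact h
  have huI : ∀ x, |u x| ≤ 1 := fun x => by rcases hu01 x with h | h <;> simp [h]
  refine ⟨σ, hσ, u, hum, hu01, ?_, fun A hA hAK hAb => ?_⟩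
  · have h0 : (0 : ℝ≥0∞) = ∫⁻ _ in K, (0 : ℝ≥0∞) := by simp
    have key : Tendsto (fun j => ∫⁻ x in K, ‖v (σ j) x - u x‖ₑ) atTop (𝓝 0) := by
      rw [h0]
      refine tendsto_lintegral_of_dominated_convergence (fun _ => ENNReal.ofReal (1 + 1))
        (fun j => ((hvm _).sub hum).enorm) (fun j => Eventually.of_forall fun x => ?_) ?_ ?_
      · dsimp only
        rw [← ofReal_norm]
        refine ENNReal.ofReal_le_ofReal ((norm_sub_le _ _).trans (add_le_add ?_ (huI x)))
        rw [Real.norm_of_nonneg (hvI _ x).1]; exact (hvI _ x).2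
      · rw [setLIntegral_const]
        exact ENNReal.mul_ne_top ENNReal.ofReal_ne_top hKv
      · filter_upwards [hvu] with x hx
        simpa using (hx.sub_const (u x)).enorm
    refine key.congr fun j => lintegral_congr_ae ?_
    filter_upwards [ae_restrict_of_ae_restrict_of_subset hKsub (hVv (σ j))] with x hx
    rw [hx]
  · have hul : LocallyIntegrable u := fun x =>
      ⟨Metric.ball x 1, Metric.ball_mem_nhds x one_pos,
        Measure.integrableOn_of_bounded (M := 1) measure_ball_lt_top.ne hum.aestronglyMeasurable
          (Eventually.of_forall huI)⟩
    have hAsub : A ⊆ K := fun x hx => hAK x hx (Metric.mem_ball_self hr)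
    refine memBV_of_translate_le hAb hul hr
      (C := (wellPrimitive W p 1)⁻¹ * C.toReal) (by positivity) fun h hh => ?_
    have hΦu : ∀ x, wellPrimitive W p (u x) = wellPrimitive W p 1 * u x := fun x => by
      rcases hu01 x with h | h <;> simp [h, wellPrimitive_zero]
    have h1 : ∀ᵐ x ∂(volume.restrict A), Tendsto (fun j => v (σ j) x) atTop (𝓝 (u x)) :=
      ae_restrict_of_ae_restrict_of_subset hAsub hvu
    have h2 : ∀ᵐ x ∂(volume.restrict A),
        Tendsto (fun j => v (σ j) (x + h)) atTop (𝓝 (u (x + h))) := by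
      rw [ae_restrict_iff' hK] at hvu
      have := (measurePreserving_add_right volume h).quasiMeasurePreserving.ae hvu
      filter_upwards [ae_restrict_of_ae this, ae_restrict_mem hA] with x hx hxA
      refine hx (hAK x hxA ?_)
      rw [Metric.mem_ball, dist_eq_norm, add_sub_cancel_left]
      exact hh
    have h3 : ∫⁻ x in A, ‖wellPrimitive W p (u (x + h)) - wellPrimitive W p (u x)‖ₑ
        ≤ C * ENNReal.ofReal ‖h‖ := by
      calc _ = ∫⁻ x in A, liminf (fun j => ‖wellPrimitive W p (v (σ j) (x + h))
              - wellPrimitive W p (v (σ j) x)‖ₑ) atTop := by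
            refine lintegral_congr_ae ?_
            filter_upwards [h1, h2] with x hx1 hx2
            exact (Tendsto.liminf_eq (((hΦ.tendsto _).comp hx2).sub
              ((hΦ.tendsto _).comp hx1)).enorm).symm
        _ ≤ liminf (fun j => ∫⁻ x in A, ‖wellPrimitive W p (v (σ j) (x + h))
              - wellPrimitive W p (v (σ j) x)‖ₑ) atTop :=
            lintegral_liminf_le fun j => ((hΦ.measurable.comp
              ((hvm _).comp (measurable_add_const h))).sub
                (hΦ.measurable.comp (hvm _))).enorm
        _ ≤ _ := liminf_le_of_le (by isBoundedDefault) fun b hb => by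
            obtain ⟨j, hj⟩ := hb.exists
            exact hj.trans (htr A hA hAsub _ h hh)
    simp only [hΦu, ← mul_sub, enorm_mul] at h3
    rw [lintegral_const_mul' _ _ enorm_ne_top] at h3
    have hne : ‖wellPrimitive W p 1‖ₑ ≠ 0 := enorm_ne_zero.2 hΦ1.ne'
    have h4 := mul_le_mul_right h3 ‖wellPrimitive W p 1‖ₑ⁻¹
    rw [← mul_assoc, ENNReal.inv_mul_cancel hne enorm_ne_top, one_mul] at h4
    refine h4.trans (le_of_eq ?_)
    rw [← ofReal_norm, Real.norm_of_nonneg hΦ1.le, ← ENNReal.ofReal_inv_of_pos hΦ1,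
      ENNReal.ofReal_mul (by positivity), ENNReal.ofReal_mul (by positivity),
      ENNReal.ofReal_toReal hC, mul_assoc]

end

/-! ### The lower bound: limits of minimisers on slightly larger cubes -/

section

variable {n : ℕ}

open Classical in
lemma gradEnergy_piecewise_le (f : Rn n → ℝ → Rn n → ℝ) (ε : ℝ) {Q B : Set (Rn n)}
    (hQ : MeasurableSet Q) (hB : MeasurableSet B) (u v : Rn n → ℝ) (g h : Rn n → Rn n) :
    gradEnergy f ε B (Q.piecewise u v) (Q.piecewise g h)
      ≤ gradEnergy f ε Q u g + gradEnergy f ε (B \ Q) v h := by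
  unfold gradEnergy
  rw [← mul_add]
  refine mul_le_mul_right ((lintegral_mono_set (by rw [union_sdiff_self]; exact
    subset_union_right : B ⊆ Q ∪ (B \ Q))).trans ((lintegral_union_le _ _ _).trans
      (add_le_add (le_of_eq ?_) (le_of_eq ?_)))) _
  · refine setLIntegral_congr_fun hQ fun y hy => ?_
    simp only [Set.piecewise_eq_of_mem _ _ _ hy]
  · refine setLIntegral_congr_fun (hB.diff hQ) fun y hy => ?_
    simp only [Set.piecewise_eq_of_notMem _ _ _ hy.2]

/-- The lower inequality of `Γ`-convergence along a subsequence: the missing terms are filled in by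
the limit itself. -/
lemma GammaConvergesL1.le_of_subseq {A : Set (Rn n)} {F : ℕ → (Rn n → ℝ) → ℝ≥0∞}
    {G : (Rn n → ℝ) → ℝ≥0∞} (h : GammaConvergesL1 A F G) {u : Rn n → ℝ}
    (hu : LocallyIntegrable u) {φ : ℕ → ℕ} (hφ : StrictMono φ) {V : ℕ → Rn n → ℝ}
    (hV : ∀ i, LocallyIntegrable (V i))
    (hVu : Tendsto (fun i => ∫⁻ x in A, ‖V i x - u x‖ₑ) atTop (𝓝 0)) {b : ℝ≥0∞}
    (hb : ∀ i, F (φ i) (V i) ≤ b) : G u ≤ b := by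
  set v : ℕ → Rn n → ℝ := Function.extend φ V fun _ => u with hv
  have hvφ : ∀ i, v (φ i) = V i := fun i => hφ.injective.extend_apply _ _ i
  have hvn : ∀ j, (¬ ∃ i, φ i = j) → v j = u := fun j hj => Function.extend_apply' _ _ _ hj
  have hvl : ∀ j, LocallyIntegrable (v j) := fun j => by
    by_cases hj : ∃ i, φ i = j
    · obtain ⟨i, rfl⟩ := hj; rw [hvφ]; exact hV i
    · rw [hvn j hj]; exact hu
  refine ((h u hu).1 v hvl ?_).trans ?_
  · rw [ENNReal.tendsto_nhds_zero] at hVu ⊢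
    intro τ hτ
    obtain ⟨I, hI⟩ := eventually_atTop.1 (hVu τ hτ)
    filter_upwards [eventually_ge_atTop (φ I)] with j hj
    by_cases hj' : ∃ i, φ i = j
    · obtain ⟨i, rfl⟩ := hj'
      rw [hvφ]
      exact hI i (hφ.le_iff_le.1 hj)
    · rw [hvn j hj']
      simp
  · refine liminf_le_of_frequently_le ?_ (by isBoundedDefault)
    refine Filter.frequently_atTop.2 fun N => ⟨φ N, hφ.id_le N, ?_⟩
    rw [hvφ]
    exact hb N

lemma exists_isSobolevPair_of_minEnergy_lt {p ε : ℝ} {f : Rn n → ℝ → Rn n → ℝ} {w : Rn n → ℝ}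
    {A : Set (Rn n)} {b : ℝ≥0∞} (h : minEnergy p ε f w A < b) :
    ∃ u g, IsSobolevPair p A u g ∧ (∀ᵐ x ∂(volume.restrict A), u x ∈ Icc (0 : ℝ) 1) ∧
      EqNearBoundary A u w ∧ gradEnergy f ε A u g ≤ b := by
  simp only [minEnergy, iInf_lt_iff] at h
  obtain ⟨u, hu, hlt⟩ := h
  obtain ⟨g, hg, hI, hE⟩ := exists_isSobolevPair_of_energy_ne_top (ne_top_of_lt hlt)
  exact ⟨u, g, hg, hI, hu.2.2, hE ▸ hlt.le⟩

variable [NeZero n]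

/-- Lower bound: the minimum of the `Γ`-limit on a larger cube is controlled by the lower limit of
the minima on a smaller one, up to the cost of the regularised jump in between. Almost minimisers
are extended by the regularised jump; a limit of the extensions jumps across the hyperplane in the
outer shell, so it is admissible for the limit problem. -/
theorem minSurface_le_liminf_minEnergy {W w : ℝ → ℝ} (hW : IsDoubleWell W) (hw : IsProfile w)
    {p c₁ c₂ : ℝ} (hp : 1 < p) (hc₁ : 0 < c₁) {ε : ℕ → ℝ} (hε : ∀ j, 0 < ε j)
    (hε0 : Tendsto ε atTop (𝓝 0)) {f : ℕ → Rn n → ℝ → Rn n → ℝ}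
    (hf : ∀ j, IsIntegrand W p c₁ c₂ (f j)) {T : Rn n ≃ₗᵢ[ℝ] Rn n} {ν : Sph n} {k : Fin n}
    (hT : T (EuclideanSpace.single k (1 : ℝ)) = (ν : Rn n)) (x : Rn n) {M : ℝ} (hM : 0 ≤ M)
    (hreg : ∀ f : Rn n → ℝ → Rn n → ℝ, IsIntegrand W p c₁ c₂ f → ∀ ε : ℝ, 0 < ε →
      ∀ (x : Rn n) (ν : Sph n) (S : Set (Rn n)), MeasurableSet S →
      gradEnergy f ε S (regJump w ε x ν) (gradient (regJump w ε x ν))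
        ≤ ENNReal.ofReal (1 / ε * M) * volume (S ∩ slab x ν ε))
    {ρ ρ' : ℝ} (hρ : 0 < ρ) (hρ' : ρ < ρ') (G : (Rn n → ℝ) → Set (Rn n) → ℝ≥0∞)
    (hG : GammaConvergesL1 (rotatedCube T x ρ')
      (fun j u => energy p (ε j) (f j) u (rotatedCube T x ρ')) fun u => G u (rotatedCube T x ρ')) :
    minSurface G (jumpFun x ν) (rotatedCube T x ρ')
      ≤ liminf (fun j => minEnergy p (ε j) (f j) (regJump w (ε j) x ν) (rotatedCube T x ρ)) atTop
        + ENNReal.ofReal (2 * M * (ρ' ^ (n - 1) - ρ ^ (n - 1))) := by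
  classical
  have hp1 : 1 ≤ p := hp.le
  set L := liminf (fun j => minEnergy p (ε j) (f j) (regJump w (ε j) x ν) (rotatedCube T x ρ)) atTop
    with hL
  by_cases hLt : L = ⊤
  · rw [hLt, top_add]; exact le_top
  refine ENNReal.le_of_forall_pos_le_add fun τ hτ _ => ?_
  set Q := rotatedCube T x ρ with hQ
  set Q' := rotatedCube T x ρ' with hQ'
  -- enlarged cubes leave room for the translations in the compactness argument
  set K := rotatedCube T x (ρ' + 2) with hK
  set B := rotatedCube T x (ρ' + 4) with hB
  have hQo : IsOpen Q := isOpen_rotatedCube T x ρ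
  have hQo' : IsOpen Q' := isOpen_rotatedCube T x ρ'
  have hQm := hQo.measurableSet
  have hQm' := hQo'.measurableSet
  have hBm : MeasurableSet B := (isOpen_rotatedCube T x (ρ' + 4)).measurableSet
  have hBb : Bornology.IsBounded B := isBounded_rotatedCube T x _
  have hQQ' : Q ⊆ Q' := rotatedCube_mono T x hρ'.le
  have hQ'K : Q' ⊆ K := rotatedCube_mono T x (by linarith)
  have hQ'B : Q' ⊆ B := rotatedCube_mono T x (by linarith)
  have hQB : Q ⊆ B := hQQ'.trans hQ'B
  -- almost minimisers along a subsequence that realises the lower limit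
  have hfreq : ∃ᶠ j in atTop, minEnergy p (ε j) (f j) (regJump w (ε j) x ν) Q < L + τ ∧
      ε j < ρ / 2 :=
    (frequently_lt_of_liminf_lt (by isBoundedDefault)
      (ENNReal.lt_add_right hLt (by simpa using hτ.ne'))).and_eventually
      (hε0.eventually (gt_mem_nhds (by positivity)))
  obtain ⟨ψ, hψ, hψlt⟩ := extraction_of_frequently_atTop hfreq
  choose v g hvg hvI hvb hvE using fun i => exists_isSobolevPair_of_minEnergy_lt (hψlt i).1
  set r : ℕ → Rn n → ℝ := fun i => regJump w (ε (ψ i)) x ν with hr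
  have hrc : ∀ i, ContDiff ℝ 1 (r i) := fun i => contDiff_regJump hw _ x ν
  set V : ℕ → Rn n → ℝ := fun i => Q.piecewise (v i) (r i) with hV
  set H : ℕ → Rn n → Rn n := fun i => Q.piecewise (g i) (gradient (r i)) with hH
  have hVH : ∀ i, IsSobolevPair p B (V i) (H i) := fun i =>
    (hvg i).extend hp1 hQo (isBounded_rotatedCube T x ρ) hBm hQB
      (isSobolevPair_of_contDiff hBb (hrc i)) (hvb i)
  have hVI : ∀ i, ∀ᵐ y ∂(volume.restrict B), V i y ∈ Icc (0 : ℝ) 1 := fun i => by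
    have := (ae_restrict_iff' hQm).1 (hvI i)
    filter_upwards [ae_restrict_of_ae this] with y hy
    by_cases hyQ : y ∈ Q
    · simp only [hV, Set.piecewise_eq_of_mem _ _ _ hyQ]; exact hy hyQ
    · simp only [hV, Set.piecewise_eq_of_notMem _ _ _ hyQ]; exact regJump_mem_Icc hw _ _ _ _
  have hVl : ∀ i, LocallyIntegrable (V i) := fun i => by
    have hfin : IsFiniteMeasure (volume.restrict Q) := ⟨by
      rw [Measure.restrict_apply_univ]; exact (isBounded_rotatedCube T x ρ).measure_lt_top⟩
    have h1 : IntegrableOn (v i) Q := (hvg i).memLp.integrable (by simpa using hp1)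
    rw [hV]
    dsimp only
    rw [← Set.indicator_add_compl_eq_piecewise]
    exact ((integrable_indicator_iff hQm).2 h1).locallyIntegrable.add
      ((hrc i).continuous.locallyIntegrable.indicator hQm.compl)
  -- the extensions have bounded energy on `B`, and on `Q'` only the shell adds to the energy
  have hEB : ∀ i, gradEnergy (modelIntegrand W p) (ε (ψ i)) B (V i) (H i)
      ≤ ENNReal.ofReal (1 / c₁) * ((L + τ) + ENNReal.ofReal (2 * M * (ρ' + 4) ^ (n - 1))) :=
    fun i => by
      refine (gradEnergy_model_le hc₁ (hf (ψ i)) _ _ _ _).trans (mul_le_mul_right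
        ((gradEnergy_piecewise_le _ _ hQm hBm _ _ _ _).trans (add_le_add (hvE i) ?_)) _)
      refine (hreg _ (hf _) _ (hε _) x ν _ (hBm.diff hQm)).trans (ofReal_mul_volume_le hM (hε _) ?_)
      exact (measure_mono (inter_subset_inter_left _ sdiff_subset)).trans
        (volume_cube_inter_slab hT x (by linarith) (hε _).le)
  have hEQ : ∀ i, energy p (ε (ψ i)) (f (ψ i)) (V i) Q'
      ≤ L + τ + ENNReal.ofReal (2 * M * (ρ' ^ (n - 1) - ρ ^ (n - 1))) := fun i => by
    rw [energy_eq_gradEnergy hp1 hQo' ((hVH i).mono hQ'B)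
      (ae_restrict_of_ae_restrict_of_subset hQ'B (hVI i))]
    refine (gradEnergy_piecewise_le _ _ hQm hQm' _ _ _ _).trans (add_le_add (hvE i) ?_)
    exact (hreg _ (hf _) _ (hε _) x ν _ (hQm'.diff hQm)).trans (ofReal_mul_volume_le hM (hε _)
      (volume_shell_inter_slab hT x hρ'.le (hε _).le (hψlt i).2))
  obtain ⟨σ, hσ, u, hum, hu01, huK, hBV⟩ := exists_subseq_tendsto_of_gradEnergy_le hW hp
    (fun i => hε (ψ i)) (hε0.comp hψ.tendsto_atTop)
    (isOpen_rotatedCube T x (ρ' + 2)).measurableSet hBm hBb (r := 1 / 2) (by norm_num)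
    (fun y hy z hz => by
      rw [Metric.mem_closedBall, dist_eq_norm] at hz
      rw [← add_sub_cancel y z]
      exact add_mem_rotatedCube hy (by linarith)) hVH hVI
    (ENNReal.mul_ne_top ENNReal.ofReal_ne_top (ENNReal.add_ne_top.2
      ⟨ENNReal.add_ne_top.2 ⟨hLt, ENNReal.coe_ne_top⟩, ENNReal.ofReal_ne_top⟩)) hEB
  have huI : ∀ y, ‖u y‖ ≤ 1 := fun y => by rcases hu01 y with h | h <;> simp [h]
  have hul : LocallyIntegrable u := fun y =>
    ⟨Metric.ball y 1, Metric.ball_mem_nhds y one_pos,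
      Measure.integrableOn_of_bounded (M := 1) measure_ball_lt_top.ne hum.aestronglyMeasurable
        (Eventually.of_forall huI)⟩
  -- in the shell all extensions are regularised jumps, which converge to the jump function
  have hshell : u =ᵐ[volume.restrict (Q' \ Q)] jumpFun x ν := by
    have h0 : ∫⁻ y in Q' \ Q, ‖u y - jumpFun x ν y‖ₑ ≤ 0 := by
      have hlim : Tendsto (fun i => (∫⁻ y in K, ‖V (σ i) y - u y‖ₑ)
          + ENNReal.ofReal (2 * ε (ψ (σ i)) * ρ' ^ (n - 1))) atTop (𝓝 0) := by
        have h1 := ENNReal.tendsto_ofReal (((hε0.comp (hψ.comp hσ).tendsto_atTop).const_mul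
          2).mul_const (ρ' ^ (n - 1)))
        simpa using huK.add h1
      refine ge_of_tendsto' hlim fun i => ?_
      refine (lintegral_enorm_sub_le (b := V (σ i)) hum.aestronglyMeasurable
        ((hVl _).aestronglyMeasurable.mono_measure Measure.restrict_le_self)).trans
        (add_le_add ?_ ?_)
      · simp only [enorm_sub_rev (u _)]
        exact lintegral_mono_set (sdiff_subset.trans hQ'K)
      · refine le_trans (le_of_eq ?_) ((lintegral_mono_set (sdiff_subset : Q' \ Q ⊆ Q')).trans
          (lintegral_regJump_sub_jumpFun_le hw hT x (hρ.trans hρ').le (hε (ψ (σ i)))))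
        refine setLIntegral_congr_fun (hQm'.diff hQm) fun y hy => ?_
        simp only [hV, Set.piecewise_eq_of_notMem _ _ _ hy.2, hr]
    have := (lintegral_eq_zero_iff
      (hum.sub (measurable_jumpFun x ν)).enorm).1 (nonpos_iff_eq_zero.1 h0)
    filter_upwards [this] with y hy
    simpa [sub_eq_zero] using hy
  have hub : EqNearBoundary Q' u (jumpFun x ν) := by
    refine ⟨{y | ρ / 2 < cubeNorm T x y}, isOpen_lt continuous_const (continuous_cubeNorm T x),
      fun y hy => ?_, ?_⟩
    · rw [mem_ofPred_eq, cubeNorm_eq_of_mem_frontier hy]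
      linarith
    · refine ae_restrict_of_ae_restrict_of_subset ?_ hshell
      exact fun y hy => ⟨hy.1, fun hyQ => lt_asymm hy.2 (mem_rotatedCube.1 hyQ)⟩
  have hGu := hG.le_of_subseq hul (hψ.comp hσ) (V := fun i => V (σ i)) (fun i => hVl _)
    (tendsto_of_tendsto_of_tendsto_of_le_of_le tendsto_const_nhds huK (fun _ => zero_le)
      fun i => lintegral_mono_set hQ'K) (fun i => hEQ (σ i))
  refine (iInf₂_le u ⟨hul, hBV Q' hQm' (fun y hy z hz => ?_) (isBounded_rotatedCube T x ρ'),
    Eventually.of_forall hu01, hub⟩).trans (hGu.trans (le_of_eq (add_right_comm _ _ _)))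
  rw [Metric.mem_ball, dist_eq_norm] at hz
  rw [← add_sub_cancel y z]
  exact add_mem_rotatedCube hy (by linarith)

end

/-! ### Comparison of the surface densities -/

section

variable {n : ℕ}

/-- A comparison between slightly dilated arguments passes to the upper limits at `0⁺`, since these
are invariant under dilations. -/
lemma limsup_le_of_dilation {a b c : ℝ → ℝ≥0∞} (hc : Tendsto c (𝓝[>] 1) (𝓝 0))
    (h : ∀ t, 1 < t → ∀ ρ, 0 < ρ → a (t * ρ) ≤ b ρ + c t) :
    limsup a (𝓝[>] 0) ≤ limsup b (𝓝[>] 0) := by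
  have key : ∀ t, 1 < t → limsup a (𝓝[>] 0) ≤ limsup b (𝓝[>] 0) + c t := fun t ht => by
    have ht0 : 0 < t := one_pos.trans ht
    have hmap : Tendsto (fun ρ : ℝ => t⁻¹ * ρ) (𝓝[>] 0) (𝓝[>] 0) := by
      refine tendsto_nhdsWithin_iff.2 ⟨?_, ?_⟩
      · have : Tendsto (fun ρ : ℝ => t⁻¹ * ρ) (𝓝 0) (𝓝 (t⁻¹ * 0)) :=
          (continuous_const_mul t⁻¹).tendsto 0
        rw [mul_zero] at this
        exact this.mono_left nhdsWithin_le_nhds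
      · filter_upwards [self_mem_nhdsWithin] with ρ hρ
        exact mul_pos (inv_pos.2 ht0) hρ
    calc limsup a (𝓝[>] 0) ≤ limsup (fun ρ => b (t⁻¹ * ρ) + c t) (𝓝[>] 0) := by
          refine limsup_le_limsup ?_
          filter_upwards [self_mem_nhdsWithin] with ρ hρ
          have := h t ht (t⁻¹ * ρ) (mul_pos (inv_pos.2 ht0) hρ)
          rwa [mul_inv_cancel_left₀ ht0.ne'] at this
      _ = limsup (fun ρ => b (t⁻¹ * ρ)) (𝓝[>] 0) + c t :=
          limsup_add_const _ _ _ (by isBoundedDefault) (by isBoundedDefault)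
      _ ≤ limsup b (𝓝[>] 0) + c t := add_le_add_left (limsup_le_limsup_of_le (u := b) hmap) _
  have hlim : Tendsto (fun t => limsup b (𝓝[>] 0) + c t) (𝓝[>] 1) (𝓝 (limsup b (𝓝[>] 0))) := by
    simpa using hc.const_add (limsup b (𝓝[>] 0))
  exact ge_of_tendsto hlim (by filter_upwards [self_mem_nhdsWithin] with t ht using key t ht)

/-- The three surface densities of a sequence of scales and integrands whose energies `Γ`-converge
on all Lipschitz domains agree. -/
theorem fHat_eq_fLower_and_fLower_eq_fUpper (hn : 0 < n) {W w : ℝ → ℝ} (hW : IsDoubleWell W)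
    (hw : IsProfile w) {p c₁ c₂ : ℝ} (hp : 1 < p) (hc₁ : 0 < c₁) (hc : c₁ ≤ c₂)
    {R : Sph n → Rn n ≃ₗᵢ[ℝ] Rn n} {k : Fin n}
    (hR : ∀ ν : Sph n, R ν (EuclideanSpace.single k (1 : ℝ)) = (ν : Rn n))
    {ε : ℕ → ℝ} (hε : ∀ j, 0 < ε j) (hε0 : Tendsto ε atTop (𝓝 0))
    {f : ℕ → Rn n → ℝ → Rn n → ℝ} (hf : ∀ j, IsIntegrand W p c₁ c₂ (f j))
    {G : (Rn n → ℝ) → Set (Rn n) → ℝ≥0∞}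
    (hG : ∀ A : Set (Rn n), IsLipschitzDomain A →
      GammaConvergesL1 A (fun j u => energy p (ε j) (f j) u A) fun u => G u A)
    (x : Rn n) (ν : Sph n) :
    fHat R G x ν = fLower R w p ε f x ν ∧ fLower R w p ε f x ν = fUpper R w p ε f x ν := by
  have : NeZero n := ⟨hn.ne'⟩
  have h₁ : fLower R w p ε f x ν ≤ fUpper R w p ε f x ν :=
    limsup_le_limsup (Eventually.of_forall fun ρ => mul_le_mul_right
      (liminf_le_limsup (by isBoundedDefault) (by isBoundedDefault)) _)
  have h₂ : fUpper R w p ε f x ν ≤ fHat R G x ν := by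
    refine limsup_le_limsup ?_
    filter_upwards [self_mem_nhdsWithin] with ρ hρ
    exact mul_le_mul_right (limsup_minEnergy_le_minSurface hW hw hp hc₁ hc hε hε0 hf (hR ν) x hρ G
      (hG _ (isLipschitzDomain_rotatedCube (R ν) x hρ))) _
  have h₃ : fHat R G x ν ≤ fLower R w p ε f x ν := by
    obtain ⟨M, hM, hreg⟩ := exists_gradEnergy_regJump_le (n := n) (c₁ := c₁) hp (hc₁.le.trans hc)
      hW hw
    refine limsup_le_of_dilation (c := fun t => ENNReal.ofReal (2 * M * (t ^ (n - 1) - 1))) ?_ ?_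
    · have : Tendsto (fun t : ℝ => ENNReal.ofReal (2 * M * (t ^ (n - 1) - 1))) (𝓝 1)
          (𝓝 (ENNReal.ofReal (2 * M * (1 ^ (n - 1) - 1)))) :=
        ENNReal.tendsto_ofReal (Continuous.tendsto (by fun_prop) _)
      rw [one_pow, sub_self, mul_zero, ENNReal.ofReal_zero] at this
      exact this.mono_left nhdsWithin_le_nhds
    · intro t ht ρ hρ
      have ht0 : 0 < t := one_pos.trans ht
      have hρt : ρ < t * ρ := lt_mul_of_one_lt_left hρ ht
      have key := minSurface_le_liminf_minEnergy hW hw hp hc₁ hε hε0 hf (hR ν) x hM hreg hρ hρt G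
        (hG _ (isLipschitzDomain_rotatedCube (R ν) x (hρ.trans hρt)))
      have hpow : 1 / (t * ρ) ^ (n - 1) ≤ 1 / ρ ^ (n - 1) :=
        one_div_le_one_div_of_le (by positivity) (pow_le_pow_left₀ hρ.le hρt.le _)
      refine (mul_le_mul' (ENNReal.ofReal_le_ofReal hpow) key).trans (le_of_eq ?_)
      rw [mul_add, ← ENNReal.ofReal_mul (by positivity)]
      congr 2
      rw [mul_pow]
      field_simp
  exact ⟨le_antisymm h₃ (h₁.trans h₂), le_antisymm h₁ (h₂.trans h₃)⟩

end

end PhaseTransition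

end

theorem proposition5p1
    (n : ℕ) (hn : 2 ≤ n)
    (p : ℝ) (hp : 1 < p)
    (c₁ c₂ : ℝ) (hc₁ : 0 < c₁) (hc : c₁ ≤ c₂)
    (W : ℝ → ℝ) (hW : PhaseTransition.IsDoubleWell W)
    (R : PhaseTransition.Sph n → PhaseTransition.Rn n ≃ₗᵢ[ℝ] PhaseTransition.Rn n)
    (hR : ∀ ν : PhaseTransition.Sph n,
      R ν (EuclideanSpace.single (⟨n - 1, by omega⟩ : Fin n) (1 : ℝ)) = (ν : PhaseTransition.Rn n))
    (w : ℝ → ℝ) (hw : PhaseTransition.IsProfile w)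
    (ε : ℕ → ℝ) (hε : ∀ k, ε k ∈ Set.Ioc (0 : ℝ) 1) (hε_anti : Antitone ε)
    (hε_lim : Filter.Tendsto ε Filter.atTop (nhds 0))
    (f : ℕ → PhaseTransition.Rn n → ℝ → PhaseTransition.Rn n → ℝ)
    (hf : ∀ k, PhaseTransition.IsIntegrand W p c₁ c₂ (f k))
    (κ : ℕ → ℕ) (hκ : StrictMono κ)
    (G : (PhaseTransition.Rn n → ℝ) → Set (PhaseTransition.Rn n) → ENNReal)
    (hG : ∀ A : Set (PhaseTransition.Rn n), PhaseTransition.IsLipschitzDomain A →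
      PhaseTransition.GammaConvergesL1 A
        (fun j u => PhaseTransition.energy p (ε (κ j)) (f (κ j)) u A) (fun u => G u A)) :
    ∀ (x : PhaseTransition.Rn n) (ν : PhaseTransition.Sph n),
      PhaseTransition.fHat R G x ν =
          PhaseTransition.fLower R w p (fun j => ε (κ j)) (fun j => f (κ j)) x ν ∧
        PhaseTransition.fLower R w p (fun j => ε (κ j)) (fun j => f (κ j)) x ν =
          PhaseTransition.fUpper R w p (fun j => ε (κ j)) (fun j => f (κ j)) x ν :=
  PhaseTransition.fHat_eq_fLower_and_fLower_eq_fUpper (by omega) hW hw hp hc₁ hc hR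
    (fun j => (hε (κ j)).1) (hε_lim.comp hκ.tendsto_atTop) (fun j => hf (κ j)) hG
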